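/- **Setting.** $\log$ is to base 2. A deterministic RAM program $\Pi$, given a memory size $n$ and an input $x\in\{0,1\}^*$, reads and writes the cells of a memory of $n$ words (initially zero), a word being $\bot$ or a string of $\log n$ bits. The compiled program $\Pi'(n,x)$ performs each $\mathrm{Read}(r)$, $\mathrm{Write}(r,v)$ through the following randomized data structure (ORAM), with parameters $\alpha\ge 2$ (cells per block), $\ell=\ell(n)$, $\ell'=\ell'(n)$, $q_{\max}=q_{\max}(n)$. *Data.* Cell $r$ lies in block $i=\lfloor r/\alpha\rfloor$. There are a full binary tree of depth $d$, where $d$ is least with $2^d\ge 2(N/\alpha)/(\log n\log\log n)$ for a table of $N$ cells ($N=n$ for the main table), each of whose nodes holds a bucket of blocks; a position map $P$ assigning to each block index a leaf (or $\bot$, initially); and a queue of blocks. Each block carries its index, its position (a leaf) and its content. *Access to cell $r$.* One $\mathrm{Fetch}$, then twice $\mathrm{Dequeue}$. $\mathrm{Fetch}$: if $P[i]=\bot$, create block $i$ with zero content; otherwise find it on the path from the root to the leaf $P[i]$, or else in the queue, and remove it from there; give it a fresh uniformly random position, recorded in $P[i]$; read or overwrite the cell; append the block to the queue. $\mathrm{Dequeue}$: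 move the first block of the queue, if any, to the root bucket ($\mathrm{Put\text{-}Back}$), then perform a number $k$ of $\mathrm{Flush}$es, where $\Pr[k=j]=(2/3)^j\cdot\frac13$ for $j\ge0$. $\mathrm{Flush}$: pick a uniformly random leaf $p^*$ and traverse the path $p_0,\dots,p_d$ from the root to $p^*$; at each $p_i$ with $i<d$, first put the block carried from $p_{i-1}$ (if any) into the bucket, then take out the block that can travel furthest along the path towards its own position (if some block can move down to $p_{i+1}$; ties are broken arbitrarily) and carry it to $p_{i+1}$; then, for each of the two children of $p_i$, if at least $\ell/2$ blocks left in the bucket are assigned to leaves below that child, remove an arbitrary such block, give it a fresh uniformly random position (updating $P$) and append it to the queue (an overflow). At $p_d$ the carried block is put into the bucket. *Aborts.* The algorithm stops and outputs $\mathrm{AbortQueue}$ as soon as the size of the queue reaches $q_{\max}$, and stops and outputs $\mathrm{AbortLeaf}$ if a leaf bucket reaches $\ell'$ blocks. *Recursion.* The position map is implemented with $R=R(n)\ge 0$ levels of recursion: for $R=0$ it is a plain table; otherwise it is itself such an ORAM, with the same $\alpha,\ell,\ell',q_{\max}$ and with one cell per block, whose own position map (of size smaller by a factor $\alpha$, rounded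 up) has $R-1$ levels of recursion. Reading an entry of the position map and replacing it is one access. An abort in any of these ORAMs aborts the whole execution. **Lemma.** There is an absolute constant $C>0$ such that the following holds for every integer $\alpha\ge2$, all reals $\varepsilon>0$, $K>0$, $K'$, and all functions $\ell,\ell',q_{\max},R:\mathbb N\to\mathbb N$ such that, for all sufficiently large $n$, $$\ell(n)\ge C\log\log n,\qquad q_{\max}(n)\ge K(\log n)^{2+\varepsilon},\qquad R(n)\le K'\log n .$$ (This includes $\ell=\Theta(\log\log n)$ with a large enough constant and $q_{\max}=\Theta(\log^{2+\varepsilon}n)$.) There is a negligible function $\mu$ such that for every program $\Pi$, every $n$, every input $x$, every $T$ such that $\Pi(n,x)$ halts after at most $T$ memory accesses, and all rules for the arbitrary choices that depend only on the indices and positions of the admissible blocks, $$\Pr[\Pi'(n,x)\text{ outputs }\mathrm{AbortQueue}]\le T\cdot\mu(n).$$ In particular, this probability is negligible in $n$ whenever the running time of $\Pi$ is polynomial in $n$. -/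

import Mathlib

noncomputable section

namespace ORAM

/-! ### Probabilistic computations that may abort -/

/-- The two ways in which the algorithm aborts: `AbortQueue` and `AbortLeaf`. -/
inductive Abort where
  | queue
  | leaf

/-- Randomized computations that may abort (and then stop immediately). -/
abbrev Comp (A : Type) : Type := ExceptT Abort PMF A

/-- Draw a sample from a distribution. -/
def sample {A : Type} (p : PMF A) : Comp A := ExceptT.lift p

/-- A uniformly random leaf of the full binary tree of depth `d`, as a bit string of length `d`. -/
def uniformLeaf (d : ℕ) : PMF (List Bool) :=
  (PMF.uniformOfFintype (Fin d → Bool)).map List.ofFn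

/-- The number of `1`s before the first `0` in a sequence of independent coins, each of which is `1`
with probability `2/3`. -/
def numFlushes : PMF ℕ :=
  ⟨fun k => (2 / 3 : ENNReal) ^ k * (1 / 3), by
    have h : ∑' k : ℕ, (2 / 3 : ENNReal) ^ k * (1 / 3) = 1 := by
      rw [ENNReal.tsum_mul_right, ENNReal.tsum_geometric]
      have h3 : (1 : ENNReal) - 2 / 3 = 1 / 3 := by
        refine ENNReal.sub_eq_of_eq_add (ENNReal.div_ne_top (by simp) (by simp)) ?_
        rw [← ENNReal.add_div]
        norm_num
        exact (ENNReal.div_self (by simp) (by simp)).symm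
      rw [h3]
      exact ENNReal.inv_mul_cancel (by simp) (ENNReal.div_ne_top (by simp) (by simp))
    exact ENNReal.summable.hasSum_iff.2 h⟩

/-! ### Memories -/

/-- An implementation of a table of cells with contents in `V`. The operation `access r f` returns
the content of cell `r` and replaces it by its image under `f`; thus `Read(r)` is `access r id` and
`Write(r, v)` is `access r (fun _ => v)`. -/
structure Mem (V : Type) where
  State : Type
  init : State
  access : ℕ → (V → V) → State → Comp (V × State)

/-- The plain table, all of whose cells contain `v₀` at the beginning. -/
def arrayMem {V : Type} (v₀ : V) : Mem V where
  State := ℕ → V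
  init := fun _ => v₀
  access := fun r f s => pure (s r, Function.update s r (f (s r)))

/-! ### The construction -/

/-- The parameters: the size `n` of the memory that is compiled, the number `α` of cells in a block,
the bucket sizes `ℓ` (internal nodes) and `ℓ'` (leaves), and the maximum size `qmax` of the queues.
The rules `pull` and `spill` resolve the arbitrary choices of the algorithm: given the indices and
positions of the admissible blocks, they designate one of them. -/
structure Params where
  n : ℕ
  α : ℕ
  ℓ : ℕ
  ℓ' : ℕ
  qmax : ℕ
  pull : List (ℕ × List Bool) → ℕ
  spill : List (ℕ × List Bool) → ℕ

/-- The depth of the tree for a table of `N` cells: the least `d` such that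
`2 ^ d ≥ 2 (N / α) / (log n log log n)`. -/
def Params.depth (P : Params) (N : ℕ) : ℕ :=
  Nat.clog 2 ⌈2 * ((N : ℝ) / P.α) / (Real.logb 2 P.n * Real.logb 2 (Real.logb 2 P.n))⌉₊

/-- A block: its index, its position (a leaf), and the contents of its cells, of which only those
with offset less than `α` are used. -/
structure Block (V : Type) where
  idx : ℕ
  pos : List Bool
  val : ℕ → V

/-- The state of one ORAM: the state of the position map, the tree (nodes are bit strings, the root
is `[]`, and each node has a bucket of blocks), and the queue. -/
structure TreeState (V S : Type) where
  posMap : S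
  tree : List Bool → List (Block V)
  queue : List (Block V)

/-- The length of the longest common prefix of two bit strings. -/
def common : List Bool → List Bool → ℕ
  | a :: p, b :: q => if a = b then common p q + 1 else 0
  | _, _ => 0

section Tree

variable {V : Type}

/-- The element of a list of admissible blocks that a choice rule designates (`none` if the list is
empty). -/
def choose (rule : List (ℕ × List Bool) → ℕ) (bs : List (Block V)) : Option (Block V) :=
  bs[rule (bs.map fun b => (b.idx, b.pos)) % bs.length]?

/-- Remove from a bucket the given block, if any. -/
def remove (o : Option (Block V)) (bs : List (Block V)) : List (Block V) :=
  match o with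
  | none => bs
  | some b => bs.filter fun c => decide (c.idx ≠ b.idx)

/-- A block of a bucket at depth `i` on the path to the leaf `p` that can be pulled down along this
path as far as possible; `none` if no block can be pulled down. -/
def pullBlock (P : Params) (p : List Bool) (i : ℕ) (bs : List (Block V)) : Option (Block V) :=
  choose P.pull (bs.filter fun b =>
    decide (i < common b.pos p ∧ ∀ c ∈ bs, common c.pos p ≤ common b.pos p))

/-- A block of a bucket that overflows to the queue: if at least `ℓ / 2` blocks of the bucket are
assigned to leaves below the child node `c`, then one of them. -/
def spillBlock (P : Params) (c : List Bool) (bs : List (Block V)) : Option (Block V) :=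
  let S := bs.filter fun b => c.isPrefixOf b.pos
  if P.ℓ ≤ 2 * S.length then choose P.spill S else none

/-- The block with index `i` on the path from the root to the leaf `p`, if any. -/
def findOnPath (tree : List Bool → List (Block V)) (p : List Bool) (i : ℕ) : Option (Block V) :=
  ((List.range (p.length + 1)).flatMap fun k => tree (p.take k)).find? fun b => decide (b.idx = i)

/-- Delete the block with index `i` from all buckets on the path from the root to the leaf `p`. -/
def deleteOnPath (tree : List Bool → List (Block V)) (p : List Bool) (i : ℕ) :
    List Bool → List (Block V) :=
  fun v => if v.isPrefixOf p then (tree v).filter fun b => decide (b.idx ≠ i) else tree v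

variable (P : Params) (N : ℕ) (M : Mem (Option (List Bool))) (v₀ : V)

/-- Insert a block into the queue; abort if the queue reaches its maximum size. -/
def insertQueue (b : Block V) (s : TreeState V M.State) : Comp (TreeState V M.State) :=
  if P.qmax ≤ (s.queue ++ [b]).length then throw Abort.queue
  else pure { s with queue := s.queue ++ [b] }

/-- `Overflow(b)`: re-sample the position of `b` and insert `b` into the queue. -/
def overflow (b : Block V) (s : TreeState V M.State) : Comp (TreeState V M.State) := do
  let p ← sample (uniformLeaf (P.depth N))
  let (_, pm) ← M.access b.idx (fun _ => some p) s.posMap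
  insertQueue P M { b with pos := p } { s with posMap := pm }

/-- `Overflow` for an optional block. -/
def overflow? : Option (Block V) → TreeState V M.State → Comp (TreeState V M.State)
  | none, s => pure s
  | some b, s => overflow P N M b s

/-- The part of a `Flush` along the path to the leaf `p` from the node at depth `i` on, where `k`
further nodes lie below this node on the path and `carry` is the block pulled down into it. -/
def flushFrom (p : List Bool) : (k i : ℕ) → (carry : Option (Block V)) →
    TreeState V M.State → Comp (TreeState V M.State)
  | 0, i, carry, s =>
    let bs := carry.toList ++ s.tree (p.take i)
    if P.ℓ' ≤ bs.length then throw Abort.leaf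
    else pure { s with tree := Function.update s.tree (p.take i) bs }
  | k + 1, i, carry, s => do
    let bs := carry.toList ++ s.tree (p.take i)
    let next := pullBlock P p i bs
    let bs₁ := remove next bs
    let o₀ := spillBlock P (p.take i ++ [false]) bs₁
    let o₁ := spillBlock P (p.take i ++ [true]) bs₁
    let bs₂ := remove o₁ (remove o₀ bs₁)
    let s ← overflow? P N M o₀ { s with tree := Function.update s.tree (p.take i) bs₂ }
    let s ← overflow? P N M o₁ s
    flushFrom p k (i + 1) next s

/-- `Flush`: flush along the path to a uniformly random leaf. -/
def flush (s : TreeState V M.State) : Comp (TreeState V M.State) := do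
  let p ← sample (uniformLeaf (P.depth N))
  flushFrom P N M p (P.depth N) 0 none s

/-- `k` consecutive `Flush`es. -/
def flushes : ℕ → TreeState V M.State → Comp (TreeState V M.State)
  | 0, s => pure s
  | k + 1, s => do
    let s ← flush P N M s
    flushes k s

/-- `Put-Back`: move the first block of the queue, if any, to the root (which is itself a leaf if
the tree has depth `0`). -/
def putBack (s : TreeState V M.State) : Comp (TreeState V M.State) :=
  match s.queue with
  | [] => pure s
  | b :: q =>
    let bs := b :: s.tree []
    if P.depth N = 0 ∧ P.ℓ' ≤ bs.length then throw Abort.leaf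
    else pure { s with tree := Function.update s.tree [] bs, queue := q }

/-- `Dequeue`: one `Put-Back` and a geometrically distributed number of `Flush`es. -/
def dequeue (s : TreeState V M.State) : Comp (TreeState V M.State) := do
  let s ← putBack P N M s
  let k ← sample numFlushes
  flushes P N M k s

/-- `Fetch` for cell `r` (of block `r / α`): find and remove the block, in the tree or else in the
queue, give it a fresh uniformly random position, update the cell by `f`, and insert the block into
the queue. A block without a position is created with all cells containing `v₀`. The old content of
the cell is returned. The position map is read and updated in one access. -/
def fetch (r : ℕ) (f : V → V) (s : TreeState V M.State) : Comp (V × TreeState V M.State) := do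
  let i := r / P.α
  let p' ← sample (uniformLeaf (P.depth N))
  let (old, pm) ← M.access i (fun _ => some p') s.posMap
  let s := { s with posMap := pm }
  let (val, s) : (ℕ → V) × TreeState V M.State :=
    match old with
    | none => (fun _ => v₀, s)
    | some p =>
      match findOnPath s.tree p i with
      | some b => (b.val, { s with tree := deleteOnPath s.tree p i })
      | none =>
        match s.queue.find? fun b => decide (b.idx = i ∧ b.pos = p) with
        | some b =>
          (b.val, { s with queue := s.queue.filter fun b => decide (¬ (b.idx = i ∧ b.pos = p)) })
        | none => (fun _ => v₀, s)
  let s ← insertQueue P M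
    ⟨i, p', Function.update val (r % P.α) (f (val (r % P.α)))⟩ s
  pure (val (r % P.α), s)

/-- The ORAM for a table of `N` cells, initially all containing `v₀`, with position map `M`: each
access is one `Fetch` followed by two `Dequeue`s. -/
def oramMem : Mem V where
  State := TreeState V M.State
  init := ⟨M.init, fun _ => [], []⟩
  access := fun r f s => do
    let (v, s) ← fetch P N M v₀ r f s
    let s ← dequeue P N M s
    let s ← dequeue P N M s
    pure (v, s)

end Tree

/-- The position map with `N` entries, all undefined at the beginning, after `R` levels of
recursion: a plain table if `R = 0`, and an ORAM whose own position map has `⌈N / α⌉` entries and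
`R - 1` levels of recursion otherwise. -/
def posMem (P : Params) : (R N : ℕ) → Mem (Option (List Bool))
  | 0, _ => arrayMem none
  | R + 1, N => oramMem P N (posMem P R (N ⌈/⌉ P.α)) none

/-! ### Programs and their compilation -/

/-- A word: `⊥`, or a bit string of length `log n`. -/
abbrev Word (n : ℕ) : Type := Option (Fin (Nat.clog 2 n) → Bool)

/-- The zero word. -/
def zeroWord (n : ℕ) : Word n := some fun _ => false

/-- What a CPU with states `S` does next: halt, read a memory cell and continue in a state that
depends on the word read, or write a word into a memory cell and continue. -/
inductive Instr (n : ℕ) (S : Type) where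
  | halt
  | read (r : Fin n) (k : Word n → S)
  | write (r : Fin n) (v : Word n) (s : S)

/-- A deterministic RAM program: the states of the CPU, the state in which it starts when it is
given the memory size `n` and the input `x`, and its next instruction in each state. -/
structure Program where
  State : Type
  start : (n : ℕ) → (x : List Bool) → State
  instr : (n : ℕ) → State → Instr n State

/-- The program, run in CPU state `s` with memory contents `m`, halts after at most `T` memory
accesses. -/
def Program.HaltsWithinFrom (Q : Program) (n : ℕ) : (T : ℕ) → Q.State → (Fin n → Word n) → Prop
  | 0, s, _ => Q.instr n s = Instr.halt
  | T + 1, s, m =>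
    match Q.instr n s with
    | Instr.halt => True
    | Instr.read r k => Q.HaltsWithinFrom n T (k (m r)) m
    | Instr.write r v s' => Q.HaltsWithinFrom n T s' (Function.update m r v)

/-- The execution of the program on `n` and `x` halts after at most `T` memory accesses. -/
def Program.HaltsWithin (Q : Program) (n : ℕ) (x : List Bool) (T : ℕ) : Prop :=
  Q.HaltsWithinFrom n T (Q.start n x) fun _ => zeroWord n

/-- The execution of the program on the memory `M` from CPU state `s` and memory state `σ`, until it
halts or aborts or has made `t` memory accesses. -/
def Program.run (Q : Program) (n : ℕ) (M : Mem (Word n)) : (t : ℕ) → Q.State → M.State → Comp Unit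
  | 0, _, _ => pure ()
  | t + 1, s, σ =>
    match Q.instr n s with
    | Instr.halt => pure ()
    | Instr.read r k => do
      let (v, σ) ← M.access r id σ
      Q.run n M t (k v) σ
    | Instr.write r v s' => do
      let (_, σ) ← M.access r (fun _ => v) σ
      Q.run n M t s' σ

/-- The memory of the compiled program: an ORAM for the `n` cells whose position map is implemented
with `R` levels of recursion. -/
def compiledMem (P : Params) (R : ℕ) : Mem (Word P.n) :=
  oramMem P P.n (posMem P R (P.n ⌈/⌉ P.α)) (zeroWord P.n)

/-- The first `t` simulated memory accesses of the compiled program on input `x`. -/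
def Program.compiledRun (Q : Program) (P : Params) (R : ℕ) (x : List Bool) (t : ℕ) : Comp Unit :=
  Q.run P.n (compiledMem P R) t (Q.start P.n x) (compiledMem P R).init

/-- The probability that the execution of the compiled program on input `x` ever aborts with
`AbortQueue`: the limit, for `t → ∞`, of the nondecreasing probabilities that this happens during
the first `t` simulated memory accesses. -/
def Program.probAbortQueue (Q : Program) (P : Params) (R : ℕ) (x : List Bool) : ENNReal :=
  ⨆ t : ℕ, (Q.compiledRun P R x t).run (Except.error Abort.queue)

end ORAM

end

noncomputable section
namespace ORAM

/-! ### Expectations and almost sure properties of computations that may abort -/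

/-! There are three layers: a reduction to an oblivious Markov chain, a domination of that chain by
a process of loads, and a potential function for the loads and the queue.

Deferred decisions. The position of a block in the queue is uniform and has not yet influenced the
tree or the queue, so it may be drawn only when the block is put back. The resulting lazy process
depends on the accessed indices alone. Given its state and the contents of the cells, the true state
is recovered by drawing independent positions for the queue and then a state of the position map
(`realize`). Every operation commutes with this randomization (`sample_realize_access`), so an ORAM
over an obliviously represented position map is again obliviously represented (`oramObl`), and the
recursion is handled by induction. Since reads return the true contents, the program makes the
accesses of its plain execution, and it suffices to find a potential that grows in expectation by at
most a negligible amount per access when `AbortQueue` costs `1` (`wp_run_le`).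

Loads. Let the load of a node `c` be the number of blocks at proper ancestors of `c` that are
assigned below `c`. A put-back raises the loads along a uniformly random path by at most one. As
`Flush` is greedy, it lowers every positive load along its random path by at least one
(`target_flushStep_le`). A block overflows towards a child only if the load of the child is at least
`ℓ / 2`. Hence loads and queue length are dominated by an explicit process (`wp_lDequeue_le`), in
which each put-back is followed by two flushes on average. An overflow also costs an access to the
position map; it is prepaid when the block enters the tree, so that an access costs three accesses
to the position map in the amortized sense, and the recursion loses only a factor of order `3 ^ R`,
polynomial in `n`.

Potentials. The potential of a level is the product of `1 + b * 1.1 ^ X c` over its nodes, where `b`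
is so small that an overloaded node has weight at least `2`. Put-backs increase it less than flushes
decrease it, and the surplus pays for the overflows (`flushPot_step`). All levels see the same
random path; the inequality between the geometric and the arithmetic mean, with exponents `1 / (d +
1)`, reduces the product over the levels to averages over single levels (`queueFlush_step`). This
divides the exponential rate of the queue by `d + 1`, which is one factor `log n` in `qmax`; the
remaining `(log n) ^ (1 + ε)` makes the error negligible even after multiplication by polynomials.

The potential must be small when the queue is empty, so only levels with at most `D = (log n) ^ 4`
nodes enter it. In larger levels the average relative weight is small unless a second potential,
`treePot`, is at least `1`, and then the truncated total potential is already `1`. Finally `Fetch`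
adds one element to the queue while two `Dequeue`s remove up to two; for a nonempty queue this gain
outweighs all losses (`Valid.rate_le`), and an empty queue contributes only `idle` (`bounded`). -/

/-- The expectation of a function under a distribution. -/
def expect {A : Type} (p : PMF A) (f : A → ENNReal) : ENNReal := ∑' a, p a * f a

/-- The extension of a cost function to outcomes: `AbortQueue` costs `1` and `AbortLeaf` nothing. -/
def outcomeCost {A : Type} (g : A → ENNReal) : Except Abort A → ENNReal
  | .ok a => g a
  | .error .queue => 1
  | .error .leaf => 0

/-- The expected cost of a computation. -/
def wp {A : Type} (x : Comp A) (g : A → ENNReal) : ENNReal := expect x.run (outcomeCost g)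

/-- The property `Post` holds for every result of the computation. -/
def Sat {A : Type} (x : Comp A) (Post : A → Prop) : Prop :=
  ∀ a, x.run (Except.ok a) ≠ 0 → Post a

section Expect
variable {A B : Type}

theorem expect_pure (a : A) (f : A → ENNReal) : expect (pure a) f = f a := by
  unfold expect
  rw [tsum_eq_single a]
  · rw [show (pure a : PMF A) a = 1 from PMF.pure_apply_self a, one_mul]
  · intro b hb
    rw [show (pure a : PMF A) b = 0 from PMF.pure_apply_of_ne a b hb, zero_mul]

theorem expect_bind (p : PMF A) (k : A → PMF B) (f : B → ENNReal) :
    expect (p >>= k) f = expect p fun a => expect (k a) f := by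
  unfold expect
  have h : ∀ b, (p >>= k) b = ∑' a, p a * k a b := fun b => rfl
  simp_rw [h, ← ENNReal.tsum_mul_right, ← ENNReal.tsum_mul_left]
  rw [ENNReal.tsum_comm]
  simp_rw [mul_assoc]

theorem expect_mono (p : PMF A) {f g : A → ENNReal} (h : ∀ a, f a ≤ g a) :
    expect p f ≤ expect p g :=
  ENNReal.tsum_le_tsum fun a => mul_le_mul_right (h a) _

theorem expect_mono_support (p : PMF A) {f g : A → ENNReal} (h : ∀ a ∈ p.support, f a ≤ g a) :
    expect p f ≤ expect p g := by
  refine ENNReal.tsum_le_tsum fun a => ?_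
  by_cases ha : p a = 0
  · simp [ha]
  · exact mul_le_mul_right (h a ha) _

theorem expect_add (p : PMF A) (f g : A → ENNReal) :
    (expect p fun a => f a + g a) = expect p f + expect p g := by
  unfold expect
  rw [← ENNReal.tsum_add]
  simp_rw [mul_add]

theorem expect_const (p : PMF A) (c : ENNReal) : (expect p fun _ => c) = c := by
  unfold expect
  rw [ENNReal.tsum_mul_right, PMF.tsum_coe, one_mul]

theorem expect_map (p : PMF A) (h : A → B) (f : B → ENNReal) :
    expect (p.map h) f = expect p fun a => f (h a) := by
  have := expect_bind p (fun a => (pure (h a) : PMF B)) f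
  simp_rw [expect_pure] at this
  exact this

end Expect

section Comp
variable {A B C D : Type}

theorem sample_run (p : PMF A) : (sample p).run = p.map Except.ok := rfl

theorem run_sample_bind (p : PMF A) (k : A → Comp B) :
    (sample p >>= k).run = p >>= fun a => (k a).run :=
  ExceptT.run_bind_lift p k

theorem run_bind' (x : Comp A) (k : A → Comp B) :
    (x >>= k).run = x.run >>= fun e => match e with
      | .ok a => (k a).run
      | .error e => (pure (Except.error e) : PMF _) := by
  rw [ExceptT.run_bind]
  congr 1
  funext e
  rcases e with e | a <;> rfl

theorem wp_pure (a : A) (g : A → ENNReal) : wp (pure a) g = g a := by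
  unfold wp
  rw [ExceptT.run_pure, expect_pure]
  rfl

theorem wp_throw_queue (g : A → ENNReal) : wp (throw Abort.queue : Comp A) g = 1 := by
  unfold wp
  rw [ExceptT.run_throw, expect_pure]
  rfl

theorem wp_throw_leaf (g : A → ENNReal) : wp (throw Abort.leaf : Comp A) g = 0 := by
  unfold wp
  rw [ExceptT.run_throw, expect_pure]
  rfl

theorem wp_bind (x : Comp A) (k : A → Comp B) (g : B → ENNReal) :
    wp (x >>= k) g = wp x fun a => wp (k a) g := by
  unfold wp
  rw [run_bind', expect_bind]
  congr 1
  funext e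
  rcases e with (_ | _) | a
  · exact expect_pure _ _
  · exact expect_pure _ _
  · rfl

theorem wp_sample_bind (p : PMF A) (k : A → Comp B) (g : B → ENNReal) :
    wp (sample p >>= k) g = expect p fun a => wp (k a) g := by
  unfold wp
  rw [run_sample_bind, expect_bind]

theorem wp_mono (x : Comp A) {g h : A → ENNReal} (H : ∀ a, g a ≤ h a) : wp x g ≤ wp x h := by
  refine expect_mono _ fun e => ?_
  rcases e with (_ | _) | a
  · exact le_rfl
  · exact le_rfl
  · exact H a

theorem wp_mono_sat (x : Comp A) {g h : A → ENNReal} {Post : A → Prop} (hx : Sat x Post)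
    (H : ∀ a, Post a → g a ≤ h a) : wp x g ≤ wp x h := by
  refine expect_mono_support _ fun e he => ?_
  rcases e with (_ | _) | a
  · exact le_rfl
  · exact le_rfl
  · exact H a (hx a he)

/-- Only an inequality, because an aborted run does not collect the constant. -/
theorem wp_add_const_le (x : Comp A) (g : A → ENNReal) (c : ENNReal) :
    (wp x fun a => c + g a) ≤ c + wp x g := by
  have h : (expect x.run fun e => c + outcomeCost g e) = c + wp x g := by
    rw [expect_add, expect_const]
    rfl
  rw [← h]
  refine expect_mono _ fun e => ?_
  rcases e with (_ | _) | a
  · exact le_add_self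
  · exact zero_le
  · exact le_rfl

/-- Any final cost is allowed here, so a potential has to be controlled only in expectation. -/
theorem run_error_queue_le_wp (x : Comp A) (g : A → ENNReal) :
    x.run (Except.error Abort.queue) ≤ wp x g := by
  have := ENNReal.le_tsum (f := fun e => x.run e * outcomeCost g e) (Except.error Abort.queue)
  exact (mul_one _).symm.le.trans this

theorem sat_pure {a : A} {Post : A → Prop} (h : Post a) : Sat (pure a) Post := by
  intro b hb
  rw [ExceptT.run_pure] at hb
  have : Except.ok b = (Except.ok a : Except Abort A) := by
    by_contra hne
    exact hb (PMF.pure_apply_of_ne _ _ hne)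
  cases this
  exact h

theorem sat_throw (e : Abort) (Post : A → Prop) : Sat (throw e) Post := by
  intro b hb
  rw [ExceptT.run_throw] at hb
  exact absurd (PMF.pure_apply_of_ne _ _ (by simp)) hb

theorem sat_bind {x : Comp A} {k : A → Comp B} {Mid : A → Prop} {Post : B → Prop}
    (hx : Sat x Mid) (hk : ∀ a, Mid a → Sat (k a) Post) : Sat (x >>= k) Post := by
  intro b hb
  rw [run_bind'] at hb
  obtain ⟨e, he, h⟩ := (PMF.mem_support_bind_iff _ _ _).1 ((PMF.mem_support_iff _ _).2 hb)
  rcases e with e | a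
  · exact absurd (PMF.pure_apply_of_ne _ _ (by simp)) h
  · exact hk a (hx a he) b h

theorem sat_sample {p : PMF A} {Post : A → Prop} (h : ∀ a ∈ p.support, Post a) :
    Sat (sample p) Post := by
  intro b hb
  rw [sample_run] at hb
  obtain ⟨a, ha, h'⟩ := (PMF.mem_support_map_iff _ _ _).1 ((PMF.mem_support_iff _ _).2 hb)
  cases h'
  exact h _ ha

theorem Sat.mono {x : Comp A} {P Q : A → Prop} (h : Sat x P) (H : ∀ a, P a → Q a) : Sat x Q :=
  fun a ha => H a (h a ha)

/-- Results of probability zero do not contribute, so the continuations need to agree only where the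
invariant holds. -/
theorem bind_congr_sat {x : Comp A} {k k' : A → Comp B} {Mid : A → Prop}
    (hx : Sat x Mid) (hk : ∀ a, Mid a → k a = k' a) : x >>= k = x >>= k' := by
  apply ExceptT.ext
  rw [run_bind', run_bind']
  ext b
  refine tsum_congr fun e => ?_
  by_cases he : x.run e = 0
  · simp [he]
  · rcases e with e | a
    · rfl
    · exact congrArg (fun z : Comp B => x.run (Except.ok a) * z.run b) (hk a (hx a he))

theorem sample_pure (a : A) : sample (pure a) = (pure a : Comp A) := by
  apply ExceptT.ext
  rw [sample_run]
  exact PMF.pure_map _ _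

theorem sample_bind (p : PMF A) (k : A → PMF B) :
    sample (p >>= k) = (sample p >>= fun a => sample (k a) : Comp B) := by
  apply ExceptT.ext
  rw [run_sample_bind, sample_run]
  exact PMF.map_bind _ _ _

theorem sample_bind_const (p : PMF A) (x : Comp B) : (sample p >>= fun _ => x) = x := by
  apply ExceptT.ext
  rw [run_sample_bind]
  exact PMF.bind_const _ _

/-- The principle of deferred decisions: a draw that `x` does not use may be made after `x`, and if
`x` aborts, the draw has no effect. -/
theorem sample_bind_comm (p : PMF A) (x : Comp B) (k : A → B → Comp C) :
    (sample p >>= fun a => x >>= fun b => k a b) =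
      x >>= fun b => sample p >>= fun a => k a b := by
  apply ExceptT.ext
  rw [run_sample_bind, run_bind']
  simp_rw [run_bind']
  refine (PMF.bind_comm _ _ _).trans ?_
  refine congrArg (PMF.bind x.run) (funext fun e => ?_)
  rcases e with e | b
  · exact PMF.bind_const _ _
  · exact (run_sample_bind p fun a => k a b).symm.trans (run_bind' _ _)

theorem sample_bind_congr {p : PMF A} {k k' : A → Comp B} (h : ∀ a ∈ p.support, k a = k' a) :
    sample p >>= k = sample p >>= k' :=
  bind_congr_sat (sat_sample (Post := fun a => a ∈ p.support) fun _ ha => ha) h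

/-! ### Intertwined computations -/

/-- The computation `x` amounts to the computation `y` followed by a random choice given by `κ`, and
all results of `y` have the property `Post`. -/
def Inter (x : Comp B) (y : Comp A) (κ : A → PMF B) (Post : A → Prop) : Prop :=
  (x = y >>= fun a => sample (κ a)) ∧ Sat y Post

/-- Lets operations be treated one at a time: the randomization is pushed through the first and
handed to the second. -/
theorem Inter.bind {x : Comp B} {y : Comp A} {κ : A → PMF B} {Mid : A → Prop} {F : B → Comp D}
    {G : A → Comp C} {κ' : C → PMF D} {Post : C → Prop} (h : Inter x y κ Mid)
    (hk : ∀ a, Mid a → Inter (sample (κ a) >>= F) (G a) κ' Post) :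
    Inter (x >>= F) (y >>= G) κ' Post := by
  refine ⟨?_, sat_bind h.2 fun a ha => (hk a ha).2⟩
  rw [h.1, bind_assoc, bind_assoc]
  exact bind_congr_sat h.2 fun a ha => (hk a ha).1

theorem Inter.pure {κ : A → PMF B} {a : A} {Post : A → Prop} (h : Post a) :
    Inter (sample (κ a)) (pure a) κ Post :=
  ⟨by rw [pure_bind], sat_pure h⟩

theorem Inter.throw (e : Abort) (κ : A → PMF B) (Post : A → Prop) :
    Inter (throw e) (throw e) κ Post :=
  ⟨(ExceptT.bind_throw (m := PMF) _).symm, sat_throw _ _⟩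

theorem Inter.sample_bind {p : PMF D} {x : D → Comp B} {y : D → Comp A} {κ : A → PMF B}
    {Post : A → Prop} (h : ∀ d ∈ p.support, Inter (x d) (y d) κ Post) :
    Inter (sample p >>= x) (sample p >>= y) κ Post := by
  refine ⟨?_, sat_bind (sat_sample (Post := fun a => a ∈ p.support) fun _ ha => ha)
    fun d hd => (h d hd).2⟩
  rw [bind_assoc]
  exact sample_bind_congr fun d hd => (h d hd).1

theorem Inter.mono {x : Comp B} {y : Comp A} {κ : A → PMF B} {P Q : A → Prop}
    (h : Inter x y κ P) (H : ∀ a, P a → Q a) : Inter x y κ Q :=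
  ⟨h.1, h.2.mono H⟩

end Comp

end ORAM
end

noncomputable section
namespace ORAM

/-! ### Oblivious representations of memories -/

/-- An oblivious representation of a memory: a Markov chain `acc`, which depends only on the cells
that are accessed, together with a description `rho` of the state of the memory in terms of the
state of this chain and the contents of the cells. The function `Psi` bounds the probability of
`AbortQueue`: it increases in expectation by at most `ν` per access. -/
structure Obl {V : Type} (M : Mem V) (v₀ : V) (ν : ENNReal) where
  L : Type
  start : L
  valid : L → (ℕ → V) → Prop
  rho : L → (ℕ → V) → PMF M.State
  acc : ℕ → L → Comp L
  Psi : L → ENNReal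
  valid_start : valid start fun _ => v₀
  rho_start : rho start (fun _ => v₀) = pure M.init
  inter : ∀ l m r f, valid l m →
    Inter (sample (rho l m) >>= M.access r f) (acc r l)
      (fun l' => (rho l' (Function.update m r (f (m r)))).map (Prod.mk (m r)))
      (fun l' => valid l' (Function.update m r (f (m r))))
  step : ∀ r l, wp (acc r l) Psi ≤ Psi l + ν
  Psi_start : Psi start ≤ ν

/-- The representation of a plain table. -/
def arrayObl {V : Type} (v₀ : V) : Obl (arrayMem v₀) v₀ 0 where
  L := Unit
  start := ()
  valid := fun _ _ => True
  rho := fun _ m => pure m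
  acc := fun _ _ => pure ()
  Psi := fun _ => 0
  valid_start := trivial
  rho_start := rfl
  inter := by
    intro l m r f _
    refine ⟨?_, sat_pure trivial⟩
    change (sample (pure m : PMF (ℕ → V)) >>= fun s : ℕ → V =>
      (pure (s r, Function.update s r (f (s r))) : Comp (V × (ℕ → V)))) = _
    rw [sample_pure, pure_bind, pure_bind]
    exact ((congrArg sample (PMF.pure_map _ _)).trans (sample_pure _)).symm
  step := fun r l => by rw [wp_pure]; exact zero_le
  Psi_start := le_rfl

/-! ### The ORAM with lazily sampled positions -/

/-- The state of an ORAM with lazily sampled positions: the positions of the blocks in the queue are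
chosen only when they are moved to the tree, so that the queue consists of indices only, and the
position map `pm` records the positions of the blocks in the tree. The contents of the blocks are
left out. -/
structure LState (L : Type) where
  inner : L
  pm : ℕ → Option (List Bool)
  tree : List Bool → List (Block Unit)
  queue : List ℕ

section Lazy

variable {L : Type} (P : Params) (N : ℕ) (acc : ℕ → L → Comp L)

/-- Insert an index into the queue; abort if the queue reaches its maximum size. -/
def lInsert (i : ℕ) (s : LState L) : Comp (LState L) :=
  if P.qmax ≤ (s.queue ++ [i]).length then throw Abort.queue
  else pure { s with queue := s.queue ++ [i] }

/-- `Overflow` with lazily sampled positions. -/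
def lOverflow (b : Block Unit) (s : LState L) : Comp (LState L) := do
  let l ← acc b.idx s.inner
  lInsert P b.idx { s with inner := l, pm := Function.update s.pm b.idx none }

/-- `Overflow` for an optional block, with lazily sampled positions. -/
def lOverflow? : Option (Block Unit) → LState L → Comp (LState L)
  | none, s => pure s
  | some b, s => lOverflow P acc b s

/-- The part of a `Flush` from depth `i` on, with lazily sampled positions. -/
def lFlushFrom (p : List Bool) : (k i : ℕ) → (carry : Option (Block Unit)) →
    LState L → Comp (LState L)
  | 0, i, carry, s =>
    let bs := carry.toList ++ s.tree (p.take i)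
    if P.ℓ' ≤ bs.length then throw Abort.leaf
    else pure { s with tree := Function.update s.tree (p.take i) bs }
  | k + 1, i, carry, s => do
    let bs := carry.toList ++ s.tree (p.take i)
    let next := pullBlock P p i bs
    let bs₁ := remove next bs
    let o₀ := spillBlock P (p.take i ++ [false]) bs₁
    let o₁ := spillBlock P (p.take i ++ [true]) bs₁
    let bs₂ := remove o₁ (remove o₀ bs₁)
    let s ← lOverflow? P acc o₀ { s with tree := Function.update s.tree (p.take i) bs₂ }
    let s ← lOverflow? P acc o₁ s
    lFlushFrom p k (i + 1) next s

/-- `Flush` with lazily sampled positions. -/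
def lFlush (s : LState L) : Comp (LState L) := do
  let p ← sample (uniformLeaf (P.depth N))
  lFlushFrom P acc p (P.depth N) 0 none s

/-- `k` consecutive `Flush`es with lazily sampled positions. -/
def lFlushes : ℕ → LState L → Comp (LState L)
  | 0, s => pure s
  | k + 1, s => do
    let s ← lFlush P N acc s
    lFlushes k s

/-- `Put-Back` with lazily sampled positions. -/
def lPutBack (s : LState L) : Comp (LState L) :=
  match s.queue with
  | [] => pure s
  | i :: q => do
    let p ← sample (uniformLeaf (P.depth N))
    let bs := ⟨i, p, fun _ => ()⟩ :: s.tree []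
    if P.depth N = 0 ∧ P.ℓ' ≤ bs.length then throw Abort.leaf
    else pure { s with
      tree := Function.update s.tree [] bs, queue := q, pm := Function.update s.pm i (some p) }

/-- `Dequeue` with lazily sampled positions. -/
def lDequeue (s : LState L) : Comp (LState L) := do
  let s ← lPutBack P N s
  let k ← sample numFlushes
  lFlushes P N acc k s

/-- `Fetch` of block `i` with lazily sampled positions. -/
def lFetch (i : ℕ) (s : LState L) : Comp (LState L) := do
  let l ← acc i s.inner
  lInsert P i { inner := l, pm := Function.update s.pm i none,
                tree := fun v => (s.tree v).filter fun b => decide (b.idx ≠ i),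
                queue := s.queue.filter fun j => decide (j ≠ i) }

/-- An access to cell `r` with lazily sampled positions. -/
def lAccess (r : ℕ) (s : LState L) : Comp (LState L) := do
  let s ← lFetch P acc (r / P.α) s
  let s ← lDequeue P N acc s
  lDequeue P N acc s

end Lazy

/-! ### Contents of blocks -/

section Fill

variable {V : Type} (α : ℕ) (v₀ : V)

/-- The content of block `i` when the contents of the cells are given by `m`. -/
def blockVal (m : ℕ → V) (i : ℕ) : ℕ → V := fun j => if j < α then m (i * α + j) else v₀

/-- Supply the content of a block. -/
def fill (m : ℕ → V) (b : Block Unit) : Block V := ⟨b.idx, b.pos, blockVal α v₀ m b.idx⟩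

/-- The block with given index and position. -/
def fillQ (m : ℕ → V) (x : ℕ × List Bool) : Block V := ⟨x.1, x.2, blockVal α v₀ m x.1⟩

variable {α v₀}

/-- The choice rules see only indices and positions. This is where that restriction is needed:
choices must not depend on the contents. -/
theorem choose_map (m : ℕ → V) (rule : List (ℕ × List Bool) → ℕ) (bs : List (Block Unit)) :
    choose rule (bs.map (fill α v₀ m)) = (choose rule bs).map (fill α v₀ m) := by
  simp only [choose, List.map_map, List.length_map, List.getElem?_map]
  rfl

theorem remove_map (m : ℕ → V) (o : Option (Block Unit)) (bs : List (Block Unit)) :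
    remove (o.map (fill α v₀ m)) (bs.map (fill α v₀ m)) = (remove o bs).map (fill α v₀ m) := by
  cases o with
  | none => rfl
  | some b =>
    simp only [Option.map_some, remove, List.filter_map]
    rfl

theorem pullBlock_map (P : Params) (m : ℕ → V) (p : List Bool) (i : ℕ) (bs : List (Block Unit)) :
    pullBlock P p i (bs.map (fill α v₀ m)) = (pullBlock P p i bs).map (fill α v₀ m) := by
  simp only [pullBlock, List.filter_map, List.mem_map, forall_exists_index, and_imp,
    forall_apply_eq_imp_iff₂]
  exact choose_map m _ _

theorem spillBlock_map (P : Params) (m : ℕ → V) (c : List Bool) (bs : List (Block Unit)) :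
    spillBlock P c (bs.map (fill α v₀ m)) = (spillBlock P c bs).map (fill α v₀ m) := by
  simp only [spillBlock, List.filter_map, List.length_map]
  have h : ((fun b : Block V => c.isPrefixOf b.pos) ∘ fill α v₀ m) =
      fun b : Block Unit => c.isPrefixOf b.pos := rfl
  rw [h]
  split_ifs
  · exact choose_map m _ _
  · rfl

theorem choose_mem {rule : List (ℕ × List Bool) → ℕ} {bs : List (Block V)} {b : Block V}
    (h : choose rule bs = some b) : b ∈ bs := List.mem_of_getElem? h

theorem choose_isSome {rule : List (ℕ × List Bool) → ℕ} {bs : List (Block V)} (h : bs ≠ []) :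
    ∃ b, choose rule bs = some b := by
  have hl : 0 < bs.length := List.length_pos_of_ne_nil h
  exact ⟨_, List.getElem?_eq_getElem (Nat.mod_lt _ hl)⟩

theorem mem_of_pullBlock {P : Params} {p : List Bool} {i : ℕ} {bs : List (Block V)} {b : Block V}
    (h : pullBlock P p i bs = some b) :
    b ∈ bs ∧ i < common b.pos p ∧ ∀ c ∈ bs, common c.pos p ≤ common b.pos p := by
  have := choose_mem h
  simpa using this

theorem mem_of_spillBlock {P : Params} {c : List Bool} {bs : List (Block V)} {b : Block V}
    (h : spillBlock P c bs = some b) :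
    b ∈ bs ∧ c <+: b.pos ∧ P.ℓ ≤ 2 * (bs.filter fun b => c.isPrefixOf b.pos).length := by
  simp only [spillBlock] at h
  split_ifs at h with h'
  have := choose_mem h
  rw [List.mem_filter, List.isPrefixOf_iff_prefix] at this
  exact ⟨this.1, this.2, h'⟩

theorem mem_remove_some {b c : Block V} {bs : List (Block V)} :
    c ∈ remove (some b) bs ↔ c ∈ bs ∧ c.idx ≠ b.idx := by
  simp [remove]

theorem remove_subset (o : Option (Block V)) (bs : List (Block V)) : remove o bs ⊆ bs := by
  cases o with
  | none => exact fun _ h => h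
  | some b => exact fun _ h => (mem_remove_some.1 h).1

theorem take_prefix_of_lt_common : ∀ {q p : List Bool} {i : ℕ}, i ≤ common q p → p.take i <+: q
  | [], p, i, h => by
    simp only [common, Nat.le_zero] at h
    simp [h]
  | a :: q, [], i, h => by simp
  | a :: q, b :: p, 0, _ => by simp
  | a :: q, b :: p, i + 1, h => by
    unfold common at h
    split_ifs at h with hab
    · rw [List.take_succ_cons, hab]
      exact List.cons_prefix_cons.2 ⟨rfl, take_prefix_of_lt_common (by omega)⟩
    · omega

end Fill

/-! ### Positions of the blocks in the queue -/

/-- Independent uniformly random positions for a list of block indices. -/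
def queueDist (d : ℕ) : List ℕ → PMF (List (ℕ × List Bool))
  | [] => pure []
  | i :: q => uniformLeaf d >>= fun p => queueDist d q >>= fun qs => pure ((i, p) :: qs)

/-- The position map that is obtained from `pm` by recording the positions of a list of blocks. -/
def withQueue (pm : ℕ → Option (List Bool)) : List (ℕ × List Bool) → ℕ → Option (List Bool)
  | [] => pm
  | x :: qs => Function.update (withQueue pm qs) x.1 (some x.2)

theorem map_fst_of_mem_support {d : ℕ} : ∀ {q : List ℕ} {qs : List (ℕ × List Bool)},
    qs ∈ (queueDist d q).support → qs.map Prod.fst = q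
  | [], qs, h => by
    have : qs = [] := (PMF.mem_support_pure_iff _ _).1 h
    simp [this]
  | i :: q, qs, h => by
    obtain ⟨p, _, h⟩ := (PMF.mem_support_bind_iff _ _ _).1 h
    obtain ⟨qs', h', h⟩ := (PMF.mem_support_bind_iff _ _ _).1 h
    have : qs = (i, p) :: qs' := (PMF.mem_support_pure_iff _ _).1 h
    simp [this, map_fst_of_mem_support h']

theorem queueDist_append (d i : ℕ) : ∀ q : List ℕ,
    queueDist d (q ++ [i]) =
      queueDist d q >>= fun qs => uniformLeaf d >>= fun p => pure (qs ++ [(i, p)])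
  | [] => by simp [queueDist]
  | j :: q => by
    simp only [List.cons_append, queueDist, queueDist_append d i q, bind_assoc, pure_bind]

/-- By independence, forgetting the position of one block leaves the positions of the others
independent and uniform. -/
theorem queueDist_filter (d i : ℕ) : ∀ q : List ℕ,
    queueDist d (q.filter fun j => decide (j ≠ i)) =
      queueDist d q >>= fun qs => pure (qs.filter fun x => decide (x.1 ≠ i))
  | [] => by simp [queueDist]
  | j :: q => by
    by_cases h : j = i
    · have := queueDist_filter d i q
      simp only [h, queueDist, bind_assoc, pure_bind, List.filter_cons, ne_eq, not_true_eq_false,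
        decide_false, Bool.false_eq_true, if_false] at this ⊢
      rw [this]
      exact (PMF.bind_const _ _).symm
    · have := queueDist_filter d i q
      simp only [queueDist, bind_assoc, pure_bind, List.filter_cons, ne_eq, h, not_false_eq_true,
        decide_true, if_true] at this ⊢
      simp only [this, bind_assoc, pure_bind]

theorem withQueue_append (pm : ℕ → Option (List Bool)) (x : ℕ × List Bool) :
    ∀ qs, withQueue pm (qs ++ [x]) = withQueue (Function.update pm x.1 (some x.2)) qs
  | [] => rfl
  | y :: qs => by simp only [List.cons_append, withQueue, withQueue_append pm x qs]

theorem withQueue_update (pm : ℕ → Option (List Bool)) (i : ℕ) (o : Option (List Bool)) :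
    ∀ qs : List (ℕ × List Bool), i ∉ qs.map Prod.fst →
      withQueue (Function.update pm i o) qs = Function.update (withQueue pm qs) i o
  | [], _ => rfl
  | y :: qs, h => by
    simp only [List.map_cons, List.mem_cons, not_or] at h
    simp only [withQueue, withQueue_update pm i o qs h.2]
    rw [Function.update_comm h.1]

/-- Whatever the queue says about `i` is overwritten. -/
theorem update_withQueue_filter (pm : ℕ → Option (List Bool)) (i : ℕ) (o : Option (List Bool)) :
    ∀ qs : List (ℕ × List Bool),
      Function.update (withQueue pm (qs.filter fun x => decide (x.1 ≠ i))) i o =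
        Function.update (withQueue pm qs) i o
  | [] => rfl
  | y :: qs => by
    have ih := update_withQueue_filter pm i o qs
    by_cases h : y.1 = i
    · simp only [List.filter_cons, ne_eq, h, not_true_eq_false, decide_false, Bool.false_eq_true,
        if_false, withQueue, Function.update_idem] at ih ⊢
      exact ih
    · simp only [List.filter_cons, ne_eq, h, not_false_eq_true, decide_true, if_true,
        withQueue] at ih ⊢
      rw [Function.update_comm h, ih, Function.update_comm h]

theorem withQueue_of_not_mem (pm : ℕ → Option (List Bool)) {i : ℕ} :
    ∀ {qs : List (ℕ × List Bool)}, i ∉ qs.map Prod.fst → withQueue pm qs i = pm i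
  | [], _ => rfl
  | y :: qs, h => by
    simp only [List.map_cons, List.mem_cons, not_or] at h
    simp only [withQueue, Function.update_of_ne h.1, withQueue_of_not_mem pm h.2]

theorem withQueue_of_mem (pm : ℕ → Option (List Bool)) {x : ℕ × List Bool} :
    ∀ {qs : List (ℕ × List Bool)}, (qs.map Prod.fst).Nodup → x ∈ qs →
      withQueue pm qs x.1 = some x.2
  | y :: qs, hn, h => by
    simp only [List.map_cons, List.nodup_cons] at hn
    rcases List.mem_cons.1 h with rfl | h
    · simp [withQueue]
    · have hne : x.1 ≠ y.1 := by
        intro he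
        exact hn.1 (he ▸ List.mem_map_of_mem h)
      simp only [withQueue, Function.update_of_ne hne, withQueue_of_mem pm hn.2 h]

end ORAM
end

/-! ### Intertwining the lazy ORAM with the real one: consistency and overflows. -/

noncomputable section
namespace ORAM

section Intertwine

variable {V : Type} {M : Mem (Option (List Bool))} {ν : ENNReal}

/-- The value returned is the constant `m r`, not a random variable, so the continuation can use it
before the state of the memory is drawn. -/
theorem Obl.access_bind {W B : Type} {M : Mem W} {w₀ : W} {ν : ENNReal} (O : Obl M w₀ ν) {l : O.L}
    {m : ℕ → W} {r : ℕ} {f : W → W} (h : O.valid l m) (F : W × M.State → Comp B) :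
    (sample (O.rho l m) >>= fun σ => M.access r f σ >>= F) =
      O.acc r l >>= fun l' => sample (O.rho l' (Function.update m r (f (m r)))) >>= fun σ =>
        F (m r, σ) := by
  rw [← bind_assoc, (O.inter l m r f h).1, bind_assoc]
  congr 1
  funext l'
  dsimp only
  rw [← PMF.bind_pure_comp]
  change sample (O.rho l' _ >>= fun σ => pure _) >>= _ = _
  rw [sample_bind, bind_assoc]
  simp only [sample_pure, pure_bind]

/-- The distribution of the state of an ORAM, given its state with lazily sampled positions and the
contents of the cells. -/
def realize (P : Params) (N : ℕ) (O : Obl M none ν) (v₀ : V) (s : LState O.L) (m : ℕ → V) :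
    PMF (TreeState V M.State) :=
  queueDist (P.depth N) s.queue >>= fun qs =>
    O.rho s.inner (withQueue s.pm qs) >>= fun σ =>
      pure ⟨σ, fun v => (s.tree v).map (fill P.α v₀ m), qs.map (fillQ P.α v₀ m)⟩

/-- Consistency of a state with lazily sampled positions, where `T v b` means that block `b` is at
node `v`. -/
structure WF (α : ℕ) (O : Obl M none ν) (v₀ : V) (T : List Bool → Block Unit → Prop)
    (s : LState O.L) (m : ℕ → V) : Prop where
  pm_eq : ∀ v b, T v b → s.pm b.idx = some b.pos
  pre : ∀ v b, T v b → v <+: b.pos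
  uniq : ∀ v w b c, T v b → T w c → b.idx = c.idx → v = w
  notq : ∀ v b, T v b → b.idx ∉ s.queue
  ex : ∀ i p, s.pm i = some p → ∃ v b, T v b ∧ b.idx = i
  nodup : s.queue.Nodup
  fresh : ∀ r, s.pm (r / α) = none → r / α ∉ s.queue → m r = v₀
  val : ∀ qs : List (ℕ × List Bool), qs.map Prod.fst = s.queue →
    O.valid s.inner (withQueue s.pm qs)

/-- The tree with the carried block put into the bucket at `u`. -/
def place {V : Type} (tree : List Bool → List (Block V)) (u : List Bool) (o : Option (Block V)) :
    List Bool → List (Block V) :=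
  Function.update tree u (o.toList ++ tree u)

variable {P : Params} {N : ℕ} {O : Obl M none ν} {v₀ : V} {s : LState O.L} {m : ℕ → V}
  {T T' : List Bool → Block Unit → Prop}

theorem sample_realize_bind {B : Type} (s : LState O.L) (m : ℕ → V)
    (F : TreeState V M.State → Comp B) :
    sample (realize P N O v₀ s m) >>= F =
      sample (queueDist (P.depth N) s.queue) >>= fun qs =>
        sample (O.rho s.inner (withQueue s.pm qs)) >>= fun σ =>
          F ⟨σ, fun v => (s.tree v).map (fill P.α v₀ m), qs.map (fillQ P.α v₀ m)⟩ := by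
  simp only [realize, sample_bind, bind_assoc, sample_pure, pure_bind]

theorem WF.tree_congr (h : WF P.α O v₀ T s m) (tree : List Bool → List (Block Unit)) :
    WF P.α O v₀ T { s with tree := tree } m :=
  ⟨h.pm_eq, h.pre, h.uniq, h.notq, h.ex, h.nodup, h.fresh, h.val⟩

theorem WF.congr (h : WF P.α O v₀ T s m) (H : ∀ v b, T' v b ↔ T v b) :
    WF P.α O v₀ T' s m := by
  have : T' = T := by
    funext v b
    exact propext (H v b)
  rwa [this]

/-- Blocks may be moved along the path to their leaf. -/
theorem WF.move (h : WF P.α O v₀ T s m) (H : ∀ v b, T' v b → ∃ w, T w b)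
    (hpre : ∀ v b, T' v b → v <+: b.pos)
    (huniq : ∀ v w b c, T' v b → T' w c → b.idx = c.idx → v = w)
    (hex : ∀ v b, T v b → ∃ w c, T' w c ∧ c.idx = b.idx) : WF P.α O v₀ T' s m where
  pm_eq := fun v b hb => let ⟨w, hw⟩ := H v b hb; h.pm_eq w b hw
  pre := hpre
  uniq := huniq
  notq := fun v b hb => let ⟨w, hw⟩ := H v b hb; h.notq w b hw
  ex := fun i p hp => by
    obtain ⟨v, b, hb, rfl⟩ := h.ex i p hp
    exact hex v b hb
  nodup := h.nodup
  fresh := h.fresh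
  val := h.val

theorem withQueue_append_update (pm : ℕ → Option (List Bool)) {i : ℕ} {p : List Bool}
    {qs : List (ℕ × List Bool)} (h : i ∉ qs.map Prod.fst) :
    withQueue (Function.update pm i none) (qs ++ [(i, p)]) =
      Function.update (withQueue pm qs) i (some p) := by
  rw [withQueue_append]
  simp only [Function.update_idem]
  rw [withQueue_update _ _ _ _ h]

/-- The new position is uniform and independent of the earlier ones, which is the law `queueDist` of
the longer queue. The abort test looks only at the length. -/
theorem sample_insertQueue (pm : ℕ → Option (List Bool)) (l : O.L) (i : ℕ)
    (tree : List Bool → List (Block Unit)) (q : List ℕ) (hi : i ∉ q) :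
    (sample (queueDist (P.depth N) q) >>= fun qs => sample (uniformLeaf (P.depth N)) >>= fun p =>
      sample (O.rho l (Function.update (withQueue pm qs) i (some p))) >>= fun σ =>
        insertQueue P M (fillQ P.α v₀ m (i, p))
          ⟨σ, fun v => (tree v).map (fill P.α v₀ m), qs.map (fillQ P.α v₀ m)⟩) =
    lInsert P i ⟨l, Function.update pm i none, tree, q⟩ >>= fun s' =>
      sample (realize P N O v₀ s' m) := by
  unfold lInsert insertQueue
  have hlen : ∀ qs ∈ (queueDist (P.depth N) q).support, ∀ p,
      (qs.map (fillQ P.α v₀ m) ++ [fillQ P.α v₀ m (i, p)]).length = (q ++ [i]).length := by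
    intro qs hqs p
    have := congrArg List.length (map_fst_of_mem_support hqs)
    simpa using this
  by_cases hq : P.qmax ≤ (q ++ [i]).length
  · rw [if_pos hq]
    -- Both sides abort whatever positions are drawn.
    refine (sample_bind_congr fun qs hqs => ?_).trans
      ((sample_bind_const _ _).trans (ExceptT.bind_throw (m := PMF) _).symm)
    simp only [hlen qs hqs, hq, if_true, sample_bind_const]
  · rw [if_neg hq, pure_bind, realize]
    dsimp only
    rw [queueDist_append]
    simp only [sample_bind, bind_assoc, sample_pure, pure_bind]
    refine sample_bind_congr fun qs hqs => sample_bind_congr fun p _ => ?_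
    simp only [hlen qs hqs, hq, if_false]
    rw [withQueue_append_update _ (by rwa [map_fst_of_mem_support hqs])]
    simp only [List.map_append, List.map_cons, List.map_nil]

/-- The chain of the position map sees the index `b.idx` but not the new entry, so the new position
can be drawn after the access, that is, deferred. -/
theorem sample_realize_overflow (hval : ∀ qs : List (ℕ × List Bool), qs.map Prod.fst = s.queue →
    O.valid s.inner (withQueue s.pm qs)) (b : Block Unit) (hb : b.idx ∉ s.queue) :
    Inter (sample (realize P N O v₀ s m) >>= overflow P N M (fill P.α v₀ m b))
      (lOverflow P O.acc b s) (fun s' => realize P N O v₀ s' m)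
      (fun s' => s'.tree = s.tree ∧ s'.pm = Function.update s.pm b.idx none ∧
        s'.queue = s.queue ++ [b.idx] ∧
        ∀ qs : List (ℕ × List Bool), qs.map Prod.fst = s'.queue →
          O.valid s'.inner (withQueue s'.pm qs)) := by
  set d := P.depth N
  have hsat : Sat (O.acc b.idx s.inner) fun l' => ∀ qs : List (ℕ × List Bool),
      qs.map Prod.fst = s.queue ++ [b.idx] →
        O.valid l' (withQueue (Function.update s.pm b.idx none) qs) := by
    intro l' hl' qs hq
    obtain ⟨qs₁, qs₂, rfl, h₁, h₂⟩ := List.map_eq_append_iff.1 hq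
    obtain ⟨⟨i, p⟩, rfl, rfl⟩ : ∃ x : ℕ × List Bool, qs₂ = [x] ∧ x.1 = b.idx := by
      obtain ⟨x, rfl, h⟩ := List.map_eq_singleton_iff.1 h₂
      exact ⟨x, rfl, h⟩
    rw [withQueue_append_update _ (by rwa [h₁])]
    exact (O.inter s.inner (withQueue s.pm qs₁) b.idx (fun _ => some p) (hval qs₁ h₁)).2 l' hl'
  constructor
  · rw [sample_realize_bind]
    have h1 : ∀ qs ∈ (queueDist d s.queue).support,
        (sample (O.rho s.inner (withQueue s.pm qs)) >>= fun σ =>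
          overflow P N M (fill P.α v₀ m b)
            ⟨σ, fun v => (s.tree v).map (fill P.α v₀ m), qs.map (fillQ P.α v₀ m)⟩) =
        sample (uniformLeaf d) >>= fun p => O.acc b.idx s.inner >>= fun l' =>
          sample (O.rho l' (Function.update (withQueue s.pm qs) b.idx (some p))) >>= fun σ =>
            insertQueue P M (fillQ P.α v₀ m (b.idx, p))
              ⟨σ, fun v => (s.tree v).map (fill P.α v₀ m), qs.map (fillQ P.α v₀ m)⟩ := by
      intro qs hq
      have hv := hval qs (map_fst_of_mem_support hq)
      unfold overflow
      rw [sample_bind_comm]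
      congr 1
      funext p
      exact O.access_bind hv fun x => insertQueue P M (fillQ P.α v₀ m (b.idx, p))
        ⟨x.2, fun v => (s.tree v).map (fill P.α v₀ m), qs.map (fillQ P.α v₀ m)⟩
    rw [sample_bind_congr h1]
    simp_rw [sample_bind_comm (uniformLeaf d) (O.acc b.idx s.inner)]
    rw [sample_bind_comm]
    unfold lOverflow
    rw [bind_assoc]
    congr 1
    funext l'
    exact sample_insertQueue s.pm l' b.idx s.tree s.queue hb
  · unfold lOverflow
    refine sat_bind hsat fun l' hl' => ?_
    unfold lInsert
    split_ifs
    · exact sat_throw _ _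
    · exact sat_pure ⟨rfl, rfl, rfl, hl'⟩

theorem sample_realize_overflow? (h : WF P.α O v₀ T s m) (o : Option (Block Unit))
    (ho : ∀ b ∈ o, ∃ v, T v b) :
    Inter (sample (realize P N O v₀ s m) >>= overflow? P N M (o.map (fill P.α v₀ m)))
      (lOverflow? P O.acc o s) (fun s' => realize P N O v₀ s' m)
      (fun s' => s'.tree = s.tree ∧
        WF P.α O v₀ (fun v c => T v c ∧ ∀ b ∈ o, c.idx ≠ b.idx) s' m) := by
  cases o with
  | none =>
    refine ⟨?_, sat_pure ⟨rfl, h.congr (by simp)⟩⟩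
    exact (bind_pure _).trans (pure_bind s fun s' => sample (realize P N O v₀ s' m)).symm
  | some b =>
    obtain ⟨v, hv⟩ := ho b rfl
    refine (sample_realize_overflow h.val b (h.notq v b hv)).mono ?_
    rintro s' ⟨h1, h2, h3, h4⟩
    refine ⟨h1, ?_⟩
    simp only [Option.mem_def, Option.some.injEq, forall_eq']
    constructor
    · rintro w c ⟨hc, hne⟩
      rw [h2, Function.update_of_ne hne]
      exact h.pm_eq w c hc
    · rintro w c ⟨hc, hne⟩
      exact h.pre w c hc
    · rintro w w' c c' ⟨hc, hne⟩ ⟨hc', hne'⟩ he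
      exact h.uniq w w' c c' hc hc' he
    · rintro w c ⟨hc, hne⟩
      rw [h3]
      simp only [List.mem_append, List.mem_singleton, not_or]
      exact ⟨h.notq w c hc, hne⟩
    · intro i p hp
      rw [h2] at hp
      have hi : i ≠ b.idx := by
        rintro rfl
        simp at hp
      rw [Function.update_of_ne hi] at hp
      obtain ⟨w, c, hc, rfl⟩ := h.ex i p hp
      exact ⟨w, c, ⟨hc, hi⟩, rfl⟩
    · rw [h3]
      refine List.nodup_append.2 ⟨h.nodup, List.nodup_singleton _, ?_⟩
      rintro a ha c hc rfl
      exact h.notq v b hv (by rwa [List.mem_singleton.1 hc] at ha)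
    · intro r hr hq
      rw [h3] at hq
      simp only [List.mem_append, List.mem_singleton, not_or] at hq
      rw [h2, Function.update_of_ne hq.2] at hr
      exact h.fresh r hr hq.1
    · exact h4

end Intertwine

end ORAM
end

/-! ### Intertwining: flushes. -/

noncomputable section
namespace ORAM

section Intertwine

variable {V : Type} {M : Mem (Option (List Bool))} {ν : ENNReal}
variable {P : Params} {N : ℕ} {O : Obl M none ν} {v₀ : V} {s : LState O.L} {m : ℕ → V}
  {T T' : List Bool → Block Unit → Prop}

theorem mem_place {W : Type} {tree : List Bool → List (Block W)} {u v : List Bool}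
    {o : Option (Block W)} {b : Block W} :
    b ∈ place tree u o v ↔ b ∈ tree v ∨ (v = u ∧ o = some b) := by
  unfold place
  by_cases h : v = u
  · subst h
    simp [or_comm]
  · simp [h]

theorem mem_update_tree {W : Type} {tree : List Bool → List (Block W)} {u v : List Bool}
    {bs : List (Block W)} {b : Block W} :
    b ∈ Function.update tree u bs v ↔ (v = u ∧ b ∈ bs) ∨ (v ≠ u ∧ b ∈ tree v) := by
  by_cases h : v = u
  · subst h
    simp
  · simp [h]

theorem take_succ_ne_take {p : List Bool} {i : ℕ} (h : i < p.length) :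
    p.take (i + 1) ≠ p.take i := by
  intro he
  have := congrArg List.length he
  simp only [List.length_take] at this
  omega

/-- The pulled block agrees with `p` in more than `i` bits, so the next node of the path is still
above its own leaf. -/
theorem WF.pull {p : List Bool} {i : ℕ} (hi : i < p.length) {carry : Option (Block Unit)}
    (h : WF P.α O v₀ (fun v b => b ∈ place s.tree (p.take i) carry v) s m) :
    let bs := carry.toList ++ s.tree (p.take i)
    let next := pullBlock P p i bs
    WF P.α O v₀ (fun v b => b ∈ place (Function.update s.tree (p.take i) (remove next bs))
      (p.take (i + 1)) next v) s m := by
  intro bs next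
  have hbs : ∀ b, b ∈ bs ↔ b ∈ place s.tree (p.take i) carry (p.take i) := by
    intro b
    simp [bs, place]
  have hne := take_succ_ne_take hi
  have hnext : ∀ b, next = some b → b ∈ bs ∧ p.take (i + 1) <+: b.pos := by
    intro b hb
    have := mem_of_pullBlock hb
    exact ⟨this.1, take_prefix_of_lt_common this.2.1⟩
  have hrem : ∀ b c, next = some b → c ∈ remove next bs → c.idx ≠ b.idx := by
    intro b c hb hc
    rw [hb] at hc
    exact (mem_remove_some.1 hc).2
  have hplace : ∀ v b, v ≠ p.take i → b ∈ s.tree v → b ∈ place s.tree (p.take i) carry v := by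
    intro v b _ hb
    exact mem_place.2 (Or.inl hb)
  have key : ∀ v b, b ∈ place (Function.update s.tree (p.take i) (remove next bs))
      (p.take (i + 1)) next v →
      (next = some b ∧ v = p.take (i + 1) ∧ b ∈ place s.tree (p.take i) carry (p.take i)) ∨
      (b ∈ place s.tree (p.take i) carry v ∧ ∀ c, next = some c → b.idx ≠ c.idx) := by
    intro v b hb
    rcases mem_place.1 hb with hb | ⟨hv, hb⟩
    · right
      rcases mem_update_tree.1 hb with ⟨rfl, hb'⟩ | ⟨hv, hb⟩
      · exact ⟨(hbs b).1 (remove_subset _ _ hb'), fun c hc => hrem c b hc hb'⟩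
      · refine ⟨hplace v b hv hb, fun c hc he => hv ?_⟩
        exact h.uniq v _ b c (hplace v b hv hb) ((hbs c).1 (hnext c hc).1) he
    · exact Or.inl ⟨hb, hv, (hbs b).1 (hnext b hb).1⟩
  refine h.move ?_ ?_ ?_ ?_
  · intro v b hb
    rcases key v b hb with ⟨_, _, h'⟩ | ⟨h', _⟩
    · exact ⟨_, h'⟩
    · exact ⟨_, h'⟩
  · intro v b hb
    rcases key v b hb with ⟨h', rfl, _⟩ | ⟨h', _⟩
    · exact (hnext b h').2
    · exact h.pre v b h'
  · intro v w b c hb hc he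
    rcases key v b hb with ⟨h1, h2, _⟩ | ⟨h1, h2⟩ <;>
      rcases key w c hc with ⟨h3, h4, _⟩ | ⟨h3, h4⟩
    · rw [h2, h4]
    · exact absurd he.symm (h4 b h1)
    · exact absurd he (h2 c h3)
    · exact h.uniq v w b c h1 h3 he
  · intro v b hb
    by_cases hn : ∃ c, next = some c ∧ b.idx = c.idx
    · obtain ⟨c, hc, he⟩ := hn
      exact ⟨_, c, mem_place.2 (Or.inr ⟨rfl, hc⟩), he.symm⟩
    · push Not at hn
      refine ⟨v, b, mem_place.2 (Or.inl (mem_update_tree.2 ?_)), rfl⟩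
      by_cases hv : v = p.take i
      · subst hv
        refine Or.inl ⟨rfl, ?_⟩
        have hb' := (hbs b).2 hb
        cases hnx : next with
        | none => exact hb'
        | some c => exact mem_remove_some.2 ⟨hb', hn c hnx⟩
      · refine Or.inr ⟨hv, ?_⟩
        rcases mem_place.1 hb with hb | ⟨hv', _⟩
        · exact hb
        · exact absurd hv' hv

/-- Removing a block from the bucket that contains it amounts to deleting its index. -/
theorem mem_place_remove {tree : List Bool → List (Block Unit)} {u w : List Bool}
    {next o : Option (Block Unit)} {bs : List (Block Unit)} (hne : w ≠ u)
    (h : WF P.α O v₀ (fun v b => b ∈ place (Function.update tree u bs) w next v) s m)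
    (ho : ∀ b ∈ o, b ∈ bs) (v : List Bool) (c : Block Unit) :
    c ∈ place (Function.update tree u (remove o bs)) w next v ↔
      c ∈ place (Function.update tree u bs) w next v ∧ ∀ b ∈ o, c.idx ≠ b.idx := by
  cases o with
  | none => simp [remove]
  | some b =>
    have hb : b ∈ place (Function.update tree u bs) w next u :=
      mem_place.2 (Or.inl (mem_update_tree.2 (Or.inl ⟨rfl, ho b rfl⟩)))
    have hmem : ∀ v c, c ∈ place (Function.update tree u bs) w next v → v ≠ u →
        c.idx ≠ b.idx := fun v c hc hv he => hv (h.uniq v u c b hc hb he)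
    simp only [Option.mem_def, Option.some.injEq, forall_eq']
    constructor
    · intro hc
      rcases mem_place.1 hc with hc | ⟨rfl, hc'⟩
      · rcases mem_update_tree.1 hc with ⟨rfl, hc'⟩ | ⟨hv, hc⟩
        · have := mem_remove_some.1 hc'
          exact ⟨mem_place.2 (Or.inl (mem_update_tree.2 (Or.inl ⟨rfl, this.1⟩))), this.2⟩
        · have h' := mem_place (o := next) (u := w).2
            (Or.inl (mem_update_tree (bs := bs).2 (Or.inr ⟨hv, hc⟩)))
          exact ⟨h', hmem v c h' hv⟩
      · have h' := mem_place (tree := Function.update tree u bs) (u := v).2 (Or.inr ⟨rfl, hc'⟩)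
        exact ⟨h', hmem v c h' hne⟩
    · rintro ⟨hc, hi⟩
      rcases mem_place.1 hc with hc | hc
      · rcases mem_update_tree.1 hc with ⟨rfl, hc'⟩ | hc
        · exact mem_place.2 (Or.inl (mem_update_tree.2
            (Or.inl ⟨rfl, mem_remove_some.2 ⟨hc', hi⟩⟩)))
        · exact mem_place.2 (Or.inl (mem_update_tree.2 (Or.inr hc)))
      · exact mem_place.2 (Or.inr hc)

theorem sample_realize_update {B : Type} (s : LState O.L) (m : ℕ → V) (u : List Bool)
    (bs : List (Block Unit)) (F : TreeState V M.State → Comp B) :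
    (sample (realize P N O v₀ s m) >>= fun st =>
      F { st with tree := Function.update st.tree u (bs.map (fill P.α v₀ m)) }) =
    sample (realize P N O v₀ { s with tree := Function.update s.tree u bs } m) >>= F := by
  rw [sample_realize_bind, sample_realize_bind]
  have : (fun v => ((Function.update s.tree u bs) v).map (fill P.α v₀ m)) =
      Function.update (fun v => (s.tree v).map (fill P.α v₀ m)) u (bs.map (fill P.α v₀ m)) := by
    funext v
    by_cases hv : v = u
    · subst hv
      simp
    · simp [Function.update_of_ne hv]
  simp only [this]

theorem sample_realize_tree {B : Type} (s : LState O.L) (m : ℕ → V)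
    (F : (List Bool → List (Block V)) → TreeState V M.State → Comp B) :
    (sample (realize P N O v₀ s m) >>= fun st => F st.tree st) =
      sample (realize P N O v₀ s m) >>= fun st =>
        F (fun v => (s.tree v).map (fill P.α v₀ m)) st := by
  rw [sample_realize_bind, sample_realize_bind]

theorem toList_map_append (o : Option (Block Unit)) (bs : List (Block Unit)) :
    (o.map (fill P.α v₀ m)).toList ++ bs.map (fill P.α v₀ m) =
      (o.toList ++ bs).map (fill P.α v₀ m) := by
  cases o <;> simp

theorem eq_of_append_singleton_prefix {u q : List Bool} {x y : Bool} (hx : u ++ [x] <+: q)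
    (hy : u ++ [y] <+: q) : x = y := by
  have := List.prefix_of_prefix_length_le hx hy (by simp)
  simpa using this.eq_of_length (by simp)

/-- The carried block is in no bucket, so the invariant is stated for the tree in which it has been
placed at the node about to be processed. -/
theorem sample_realize_flushFrom {p : List Bool} : ∀ (k i : ℕ) (_ : i + k = p.length)
    (carry : Option (Block Unit)) (s : LState O.L),
    WF P.α O v₀ (fun v b => b ∈ place s.tree (p.take i) carry v) s m →
    Inter (sample (realize P N O v₀ s m) >>=
        flushFrom P N M p k i (carry.map (fill P.α v₀ m)))
      (lFlushFrom P O.acc p k i carry s) (fun s' => realize P N O v₀ s' m)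
      (fun s' => WF P.α O v₀ (fun v b => b ∈ s'.tree v) s' m)
  | 0, i, _, carry, s, h => by
    have e : (sample (realize P N O v₀ s m) >>=
        flushFrom P N M p 0 i (carry.map (fill P.α v₀ m))) =
        if P.ℓ' ≤ (carry.toList ++ s.tree (p.take i)).length then throw Abort.leaf
        else sample (realize P N O v₀ { s with tree := place s.tree (p.take i) carry } m) := by
      refine (sample_realize_tree s m fun t st =>
        let bs := (carry.map (fill P.α v₀ m)).toList ++ t (p.take i)
        if P.ℓ' ≤ bs.length then throw Abort.leaf
        else pure { st with tree := Function.update st.tree (p.take i) bs }).trans ?_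
      simp only [toList_map_append, List.length_map]
      split_ifs
      · exact sample_bind_const _ _
      · exact (sample_realize_update s m (p.take i) _ pure).trans (bind_pure _)
    rw [e]
    unfold lFlushFrom
    dsimp only
    split_ifs
    · exact Inter.throw _ _ _
    · exact Inter.pure (κ := fun s' => realize P N O v₀ s' m) (h.tree_congr _)
  | k + 1, i, hk, carry, s, h => by
    have hi : i < p.length := by omega
    have h1 := h.pull hi
    dsimp only at h1
    unfold lFlushFrom
    dsimp only
    set bs := carry.toList ++ s.tree (p.take i) with hbs
    set next := pullBlock P p i bs with hnext
    set bs₁ := remove next bs with hbs₁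
    set o₀ := spillBlock P (p.take i ++ [false]) bs₁ with ho₀
    set o₁ := spillBlock P (p.take i ++ [true]) bs₁ with ho₁
    set bs₂ := remove o₁ (remove o₀ bs₁) with hbs₂
    have e : (sample (realize P N O v₀ s m) >>=
        flushFrom P N M p (k + 1) i (carry.map (fill P.α v₀ m))) =
        (sample (realize P N O v₀ { s with tree := Function.update s.tree (p.take i) bs₂ } m) >>=
          overflow? P N M (o₀.map (fill P.α v₀ m))) >>= fun st =>
            overflow? P N M (o₁.map (fill P.α v₀ m)) st >>= fun st =>
              flushFrom P N M p k (i + 1) (next.map (fill P.α v₀ m)) st := by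
      refine (sample_realize_tree s m fun t st => do
        let bs := (carry.map (fill P.α v₀ m)).toList ++ t (p.take i)
        let next := pullBlock P p i bs
        let bs₁ := remove next bs
        let o₀ := spillBlock P (p.take i ++ [false]) bs₁
        let o₁ := spillBlock P (p.take i ++ [true]) bs₁
        let bs₂ := remove o₁ (remove o₀ bs₁)
        let st ← overflow? P N M o₀ { st with tree := Function.update st.tree (p.take i) bs₂ }
        let st ← overflow? P N M o₁ st
        flushFrom P N M p k (i + 1) next st).trans ?_
      simp only [toList_map_append, pullBlock_map, remove_map, spillBlock_map]
      rw [bind_assoc]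
      exact sample_realize_update s m (p.take i) bs₂ fun st =>
        overflow? P N M (o₀.map (fill P.α v₀ m)) st >>= fun st =>
        overflow? P N M (o₁.map (fill P.α v₀ m)) st >>= fun st =>
          flushFrom P N M p k (i + 1) (next.map (fill P.α v₀ m)) st
    rw [e]
    have hm₀ : ∀ b ∈ o₀, b ∈ bs₁ ∧ p.take i ++ [false] <+: b.pos :=
      fun b hb => ⟨(mem_of_spillBlock hb).1, (mem_of_spillBlock hb).2.1⟩
    have hm₁ : ∀ b ∈ o₁, b ∈ bs₁ ∧ p.take i ++ [true] <+: b.pos :=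
      fun b hb => ⟨(mem_of_spillBlock hb).1, (mem_of_spillBlock hb).2.1⟩
    have hplace : ∀ b ∈ bs₁, b ∈ place (Function.update s.tree (p.take i) bs₁)
        (p.take (i + 1)) next (p.take i) :=
      fun b hb => mem_place.2 (Or.inl (mem_update_tree.2 (Or.inl ⟨rfl, hb⟩)))
    -- The two overflowing blocks lie below different children, hence have different positions and,
    -- as the position map is a function, different indices. Removing the first therefore keeps the
    -- second.
    have hdisj : ∀ b ∈ o₁, b ∈ remove o₀ bs₁ := by
      intro b hb
      cases hc : o₀ with
      | none => exact (hm₁ b hb).1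
      | some c =>
        refine mem_remove_some.2 ⟨(hm₁ b hb).1, fun he => ?_⟩
        have hpos : b.pos = c.pos := by
          have hb' := h1.pm_eq _ b (hplace b (hm₁ b hb).1)
          have hc' := h1.pm_eq _ c (hplace c (hm₀ c hc).1)
          rw [he, hc'] at hb'
          exact (Option.some.inj hb').symm
        have := eq_of_append_singleton_prefix (hpos ▸ (hm₁ b hb).2) (hm₀ c hc).2
        cases this
    have hne := take_succ_ne_take hi
    refine (sample_realize_overflow? (h1.tree_congr _) o₀
      fun b hb => ⟨_, hplace b (hm₀ b hb).1⟩).bind ?_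
    rintro s₁ ⟨ht₁, hw₁⟩
    rw [← bind_assoc]
    have hw₁' : WF P.α O v₀ (fun v b => b ∈ place (Function.update s.tree (p.take i)
        (remove o₀ bs₁)) (p.take (i + 1)) next v) s₁ m :=
      hw₁.congr fun v c => mem_place_remove hne h1 (fun b hb => (hm₀ b hb).1) v c
    refine (sample_realize_overflow? hw₁' o₁ fun b hb => ⟨p.take i,
      mem_place.2 (Or.inl (mem_update_tree.2 (Or.inl ⟨rfl, hdisj b hb⟩)))⟩).bind ?_
    rintro s₂ ⟨ht₂, hw₂⟩
    refine sample_realize_flushFrom k (i + 1) (by omega) next s₂ ?_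
    rw [ht₂, ht₁]
    exact hw₂.congr fun v c => mem_place_remove hne hw₁' hdisj v c

theorem length_of_mem_uniformLeaf {d : ℕ} {p : List Bool} (h : p ∈ (uniformLeaf d).support) :
    p.length = d := by
  obtain ⟨c, _, rfl⟩ := (PMF.mem_support_map_iff _ _ _).1 h
  simp

theorem sample_realize_flush (h : WF P.α O v₀ (fun v b => b ∈ s.tree v) s m) :
    Inter (sample (realize P N O v₀ s m) >>= flush P N M) (lFlush P N O.acc s)
      (fun s' => realize P N O v₀ s' m)
      (fun s' => WF P.α O v₀ (fun v b => b ∈ s'.tree v) s' m) := by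
  have e : sample (realize P N O v₀ s m) >>= flush P N M =
      sample (uniformLeaf (P.depth N)) >>= fun p => sample (realize P N O v₀ s m) >>=
        flushFrom P N M p (P.depth N) 0 none := by
    unfold flush
    rw [sample_bind_comm]
  rw [e]
  refine Inter.sample_bind fun p hp => ?_
  refine sample_realize_flushFrom (P.depth N) 0
    (by rw [length_of_mem_uniformLeaf hp, zero_add]) none s (h.congr fun v b => ?_)
  simp [mem_place]

theorem sample_realize_flushes : ∀ (k : ℕ) (s : LState O.L),
    WF P.α O v₀ (fun v b => b ∈ s.tree v) s m →
    Inter (sample (realize P N O v₀ s m) >>= flushes P N M k) (lFlushes P N O.acc k s)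
      (fun s' => realize P N O v₀ s' m)
      (fun s' => WF P.α O v₀ (fun v b => b ∈ s'.tree v) s' m)
  | 0, s, h => by
    have : sample (realize P N O v₀ s m) >>= flushes P N M 0 =
      sample (realize P N O v₀ s m) := bind_pure _
    rw [this]
    exact Inter.pure (κ := fun s' => realize P N O v₀ s' m) h
  | k + 1, s, h => by
    have : sample (realize P N O v₀ s m) >>= flushes P N M (k + 1) =
      (sample (realize P N O v₀ s m) >>= flush P N M) >>= flushes P N M k :=
      (bind_assoc _ _ _).symm
    rw [this]
    exact (sample_realize_flush h).bind fun s' h' => sample_realize_flushes k s' h'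

end Intertwine

end ORAM
end

/-! ### Intertwining: put-back, dequeue and the location of a block. -/

noncomputable section
namespace ORAM

section Intertwine

variable {V : Type} {M : Mem (Option (List Bool))} {ν : ENNReal}
variable {P : Params} {N : ℕ} {O : Obl M none ν} {v₀ : V} {s : LState O.L} {m : ℕ → V}

theorem WF.putBack {i : ℕ} {q : List ℕ} (hq : s.queue = i :: q)
    (h : WF P.α O v₀ (fun v b => b ∈ s.tree v) s m) (p : List Bool) :
    let s' : LState O.L := { s with
      tree := Function.update s.tree [] (⟨i, p, fun _ => ()⟩ :: s.tree []), queue := q,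
      pm := Function.update s.pm i (some p) }
    WF P.α O v₀ (fun v b => b ∈ s'.tree v) s' m := by
  intro s'
  have hn := h.nodup
  rw [hq, List.nodup_cons] at hn
  have hni : ∀ v b, b ∈ s.tree v → b.idx ≠ i := by
    intro v b hb he
    have := h.notq v b hb
    rw [hq, he] at this
    simp at this
  have hmem : ∀ v b, b ∈ s'.tree v ↔ b ∈ s.tree v ∨ (v = [] ∧ b = ⟨i, p, fun _ => ()⟩) := by
    intro v b
    by_cases hv : v = []
    · subst hv
      simp [s', or_comm]
    · simp [s', hv]
  constructor
  · intro v b hb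
    rcases (hmem v b).1 hb with hb | ⟨rfl, rfl⟩
    · simp only [s', Function.update_of_ne (hni v b hb)]
      exact h.pm_eq v b hb
    · simp [s']
  · intro v b hb
    rcases (hmem v b).1 hb with hb | ⟨rfl, rfl⟩
    · exact h.pre v b hb
    · exact List.nil_prefix
  · intro v w b c hb hc he
    rcases (hmem v b).1 hb with hb | ⟨rfl, rfl⟩ <;> rcases (hmem w c).1 hc with hc | ⟨rfl, rfl⟩
    · exact h.uniq v w b c hb hc he
    · exact absurd he (hni v b hb)
    · exact absurd he.symm (hni w c hc)
    · rfl
  · intro v b hb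
    rcases (hmem v b).1 hb with hb | ⟨rfl, rfl⟩
    · have := h.notq v b hb
      rw [hq, List.mem_cons, not_or] at this
      exact this.2
    · exact hn.1
  · intro j r hr
    by_cases hj : j = i
    · exact ⟨[], _, (hmem _ _).2 (Or.inr ⟨rfl, rfl⟩), hj.symm⟩
    · simp only [s', Function.update_of_ne hj] at hr
      obtain ⟨v, b, hb, he⟩ := h.ex j r hr
      exact ⟨v, b, (hmem _ _).2 (Or.inl hb), he⟩
  · exact hn.2
  · intro r hr hrq
    by_cases hj : r / P.α = i
    · simp [s', hj] at hr
    · simp only [s', Function.update_of_ne hj] at hr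
      refine h.fresh r hr ?_
      rw [hq, List.mem_cons, not_or]
      exact ⟨hj, hrq⟩
  · intro qs hqs
    have hi : i ∉ qs.map Prod.fst := by
      rw [hqs]
      exact hn.1
    have := h.val ((i, p) :: qs) (by rw [hq, List.map_cons, hqs])
    simp only [s']
    rwa [withQueue_update _ _ _ _ hi]

/-- The first entry of `queueDist` is a uniform leaf independent of the rest, so drawing it at the
put-back has the same law as having drawn it earlier. -/
theorem sample_realize_putBack (h : WF P.α O v₀ (fun v b => b ∈ s.tree v) s m) :
    Inter (sample (realize P N O v₀ s m) >>= putBack P N M) (lPutBack P N s)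
      (fun s' => realize P N O v₀ s' m)
      (fun s' => WF P.α O v₀ (fun v b => b ∈ s'.tree v) s' m) := by
  rw [sample_realize_bind]
  cases hq : s.queue with
  | nil =>
    have e : lPutBack P N s = pure s := by
      unfold lPutBack
      rw [hq]
    rw [e]
    have e' : (sample (queueDist (P.depth N) []) >>= fun qs =>
        sample (O.rho s.inner (withQueue s.pm qs)) >>= fun σ =>
          putBack P N M ⟨σ, fun v => (s.tree v).map (fill P.α v₀ m), qs.map (fillQ P.α v₀ m)⟩) =
        sample (realize P N O v₀ s m) := by
      rw [realize, hq]
      simp only [queueDist, sample_pure, pure_bind, sample_bind]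
      rfl
    rw [e']
    exact Inter.pure (κ := fun s' => realize P N O v₀ s' m) h
  | cons i q =>
    have e : lPutBack P N s = sample (uniformLeaf (P.depth N)) >>= fun p =>
        if P.depth N = 0 ∧ P.ℓ' ≤ (s.tree []).length + 1 then throw Abort.leaf
        else pure { s with
          tree := Function.update s.tree [] (⟨i, p, fun _ => ()⟩ :: s.tree []), queue := q,
          pm := Function.update s.pm i (some p) } := by
      unfold lPutBack
      rw [hq]
      rfl
    have hn := h.nodup
    rw [hq, List.nodup_cons] at hn
    rw [e]
    simp only [queueDist, sample_bind, bind_assoc, sample_pure, pure_bind]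
    refine Inter.sample_bind fun p _ => ?_
    by_cases hl : P.depth N = 0 ∧ P.ℓ' ≤ (s.tree []).length + 1
    · rw [if_pos hl]
      have e' : (sample (queueDist (P.depth N) q) >>= fun qs =>
        sample (O.rho s.inner (withQueue s.pm ((i, p) :: qs))) >>= fun σ =>
          putBack P N M ⟨σ, fun v => (s.tree v).map (fill P.α v₀ m),
            ((i, p) :: qs).map (fillQ P.α v₀ m)⟩) = throw Abort.leaf := by
        simp only [putBack, List.map_cons, List.length_cons, List.length_map, hl, and_self,
          if_true, sample_bind_const]
      rw [e']
      exact Inter.throw _ _ _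
    · rw [if_neg hl]
      have e' : (sample (queueDist (P.depth N) q) >>= fun qs =>
        sample (O.rho s.inner (withQueue s.pm ((i, p) :: qs))) >>= fun σ =>
          putBack P N M ⟨σ, fun v => (s.tree v).map (fill P.α v₀ m),
            ((i, p) :: qs).map (fillQ P.α v₀ m)⟩) = sample (realize P N O v₀ { s with
          tree := Function.update s.tree [] (⟨i, p, fun _ => ()⟩ :: s.tree []), queue := q,
          pm := Function.update s.pm i (some p) } m) := by
        simp only [putBack, List.map_cons, List.length_cons, List.length_map, hl, if_false]
        rw [realize]
        simp only [sample_bind, sample_pure]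
        refine sample_bind_congr fun qs hqs => ?_
        have hi : i ∉ qs.map Prod.fst := by
          rw [map_fst_of_mem_support hqs]
          exact hn.1
        rw [withQueue_update _ _ _ _ hi]
        refine congrArg _ (funext fun σ => congrArg pure ?_)
        congr 1
        funext v
        by_cases hv : v = []
        · subst hv
          simp [fill, fillQ]
        · simp [hv]
      rw [e']
      exact Inter.pure (κ := fun s' => realize P N O v₀ s' m) (h.putBack hq p)

theorem sample_realize_dequeue (h : WF P.α O v₀ (fun v b => b ∈ s.tree v) s m) :
    Inter (sample (realize P N O v₀ s m) >>= dequeue P N M) (lDequeue P N O.acc s)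
      (fun s' => realize P N O v₀ s' m)
      (fun s' => WF P.α O v₀ (fun v b => b ∈ s'.tree v) s' m) := by
  have e : sample (realize P N O v₀ s m) >>= dequeue P N M =
      (sample (realize P N O v₀ s m) >>= putBack P N M) >>= fun st =>
        sample numFlushes >>= fun k => flushes P N M k st := (bind_assoc _ _ _).symm
  rw [e]
  refine (sample_realize_putBack h).bind fun s' h' => ?_
  rw [sample_bind_comm]
  exact Inter.sample_bind fun k _ => sample_realize_flushes k s' h'

/-- The content of the block that `Fetch` finds, and the state after the block has been removed. -/
def locate (v₀ : V) {S : Type} (i : ℕ) (old : Option (List Bool)) (s : TreeState V S) :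
    (ℕ → V) × TreeState V S :=
  match old with
  | none => (fun _ => v₀, s)
  | some p =>
    match findOnPath s.tree p i with
    | some b => (b.val, { s with tree := deleteOnPath s.tree p i })
    | none =>
      match s.queue.find? fun b => decide (b.idx = i ∧ b.pos = p) with
      | some b =>
        (b.val, { s with queue := s.queue.filter fun b => decide (¬ (b.idx = i ∧ b.pos = p)) })
      | none => (fun _ => v₀, s)

theorem fetch_eq (r : ℕ) (f : V → V) (st : TreeState V M.State) :
    fetch P N M v₀ r f st = sample (uniformLeaf (P.depth N)) >>= fun p' =>
      M.access (r / P.α) (fun _ => some p') st.posMap >>= fun x =>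
        insertQueue P M ⟨r / P.α, p', Function.update
            (locate v₀ (r / P.α) x.1 { st with posMap := x.2 }).1 (r % P.α)
            (f ((locate v₀ (r / P.α) x.1 { st with posMap := x.2 }).1 (r % P.α)))⟩
            (locate v₀ (r / P.α) x.1 { st with posMap := x.2 }).2 >>= fun s' =>
          pure ((locate v₀ (r / P.α) x.1 { st with posMap := x.2 }).1 (r % P.α), s') := by
  unfold fetch locate
  rfl

theorem blockVal_div_mod (hα : 0 < P.α) (m : ℕ → V) (r : ℕ) :
    blockVal P.α v₀ m (r / P.α) (r % P.α) = m r := by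
  rw [blockVal, if_pos (Nat.mod_lt _ hα), Nat.div_add_mod']

theorem update_blockVal (hα : 0 < P.α) (m : ℕ → V) (r : ℕ) (x : V) :
    Function.update (blockVal P.α v₀ m (r / P.α)) (r % P.α) x =
      blockVal P.α v₀ (Function.update m r x) (r / P.α) := by
  funext j
  by_cases hj : j = r % P.α
  · subst hj
    rw [blockVal_div_mod hα]
    simp
  · rw [Function.update_of_ne hj, blockVal, blockVal]
    split_ifs with hlt
    · rw [Function.update_of_ne]
      intro he
      apply hj
      rw [← he, mul_comm, Nat.mul_add_mod, Nat.mod_eq_of_lt hlt]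
    · rfl

theorem blockVal_update_of_ne {i r : ℕ} (h : i ≠ r / P.α) (m : ℕ → V) (x : V) :
    blockVal P.α v₀ (Function.update m r x) i = blockVal P.α v₀ m i := by
  funext j
  rw [blockVal, blockVal]
  split_ifs with hlt
  · rw [Function.update_of_ne]
    rintro rfl
    apply h
    rw [mul_comm, Nat.mul_add_div (by omega), Nat.div_eq_of_lt hlt, add_zero]
  · rfl

/-- Correctness of the search. A block in the queue is not in the tree, so the path search fails and
the queue search finds it; a block in the tree lies on the path to its recorded position; a block
without a position still has its initial content by `WF.fresh`. -/
theorem locate_realize (h : WF P.α O v₀ (fun v b => b ∈ s.tree v) s m) (i : ℕ)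
    {qs : List (ℕ × List Bool)} (hqs : qs.map Prod.fst = s.queue) {S : Type} (σ : S) :
    locate v₀ i (withQueue s.pm qs i)
      ⟨σ, fun v => (s.tree v).map (fill P.α v₀ m), qs.map (fillQ P.α v₀ m)⟩ =
    (blockVal P.α v₀ m i,
      ⟨σ, fun v => ((s.tree v).filter fun b => decide (b.idx ≠ i)).map (fill P.α v₀ m),
        (qs.filter fun x => decide (x.1 ≠ i)).map (fillQ P.α v₀ m)⟩) := by
  have htree : (∀ v b, b ∈ s.tree v → b.idx ≠ i) →
      (fun v => ((s.tree v).filter fun b => decide (b.idx ≠ i)).map (fill P.α v₀ m)) =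
        fun v => (s.tree v).map (fill P.α v₀ m) := by
    intro hh
    funext v
    rw [List.filter_eq_self.2 fun b hb => by simpa using hh v b hb]
  have hqueue : i ∉ s.queue → qs.filter (fun x => decide (x.1 ≠ i)) = qs := by
    intro hi
    refine List.filter_eq_self.2 fun x hx => ?_
    have : x.1 ≠ i := by
      rintro rfl
      exact hi (hqs ▸ List.mem_map_of_mem hx)
    simpa using this
  by_cases hi : i ∈ s.queue
  · have hnot : ∀ v b, b ∈ s.tree v → b.idx ≠ i := by
      rintro v b hb rfl
      exact h.notq v b hb hi
    obtain ⟨⟨j, p⟩, hx, rfl⟩ := List.mem_map.1 (hqs ▸ hi)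
    have hnd : (qs.map Prod.fst).Nodup := hqs ▸ h.nodup
    have hw := withQueue_of_mem s.pm hnd hx
    dsimp only at hw hnot htree ⊢
    have huniq : ∀ y ∈ qs, y.1 = j → y = (j, p) := fun y hy he =>
      List.inj_on_of_nodup_map hnd hy hx he
    have hfind : findOnPath (fun v => (s.tree v).map (fill P.α v₀ m)) p j = none := by
      unfold findOnPath
      rw [List.find?_eq_none]
      intro b hb
      obtain ⟨k, _, hb⟩ := List.mem_flatMap.1 hb
      obtain ⟨c, hc, rfl⟩ := List.mem_map.1 hb
      exact fun hh => hnot _ c hc (of_decide_eq_true hh)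
    have hfind' : (qs.map (fillQ P.α v₀ m)).find? (fun b => decide (b.idx = j ∧ b.pos = p)) =
        some (fillQ P.α v₀ m (j, p)) := by
      rcases hf : (qs.map (fillQ P.α v₀ m)).find? (fun b => decide (b.idx = j ∧ b.pos = p)) with
        _ | b
      · have := List.find?_eq_none.1 hf _ (List.mem_map_of_mem hx)
        simp [fillQ] at this
      · have h1 := List.mem_of_find?_eq_some hf
        have h2 := List.find?_some hf
        obtain ⟨y, hy, rfl⟩ := List.mem_map.1 h1
        have h2 := of_decide_eq_true h2
        rw [← huniq y hy h2.1]
        exact hf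
    unfold locate
    rw [hw]
    dsimp only
    rw [hfind]
    dsimp only
    rw [hfind', htree hnot]
    simp only [fillQ, Prod.mk.injEq, TreeState.mk.injEq, true_and]
    rw [List.filter_map]
    congr 1
    refine List.filter_congr fun y hy => ?_
    simp only [Function.comp, decide_eq_decide, ne_eq, not_iff_not]
    exact ⟨fun h => h.1, fun h => by rw [huniq y hy h]; exact ⟨rfl, rfl⟩⟩
  · rw [hqueue hi, withQueue_of_not_mem _ (by rw [hqs]; exact hi)]
    rcases hp : s.pm i with _ | p
    · have hnot : ∀ v b, b ∈ s.tree v → b.idx ≠ i := by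
        rintro v b hb rfl
        have := h.pm_eq v b hb
        rw [hp] at this
        cases this
      rw [htree hnot]
      unfold locate
      dsimp only
      refine Prod.ext ?_ rfl
      funext j
      dsimp only
      rw [blockVal]
      split_ifs with hlt
      · have hd : (i * P.α + j) / P.α = i := by
          rw [mul_comm, Nat.mul_add_div (by omega), Nat.div_eq_of_lt hlt, add_zero]
        exact (h.fresh _ (by rw [hd]; exact hp) (by rw [hd]; exact hi)).symm
      · rfl
    · obtain ⟨v, b, hb, rfl⟩ := h.ex i p hp
      have hpos : ∀ w c, c ∈ s.tree w → c.idx = b.idx → w <+: p := by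
        intro w c hc he
        have h1 := h.pm_eq w c hc
        rw [he, hp] at h1
        exact Option.some.inj h1 ▸ h.pre w c hc
      unfold locate
      dsimp only
      rcases hf : findOnPath (fun v => (s.tree v).map (fill P.α v₀ m)) p b.idx with _ | c
      · unfold findOnPath at hf
        have hv := hpos v b hb rfl
        have := List.find?_eq_none.1 hf (fill P.α v₀ m b) (List.mem_flatMap.2
          ⟨v.length, List.mem_range.2 (Nat.lt_succ_of_le hv.length_le), by
            rw [← List.prefix_iff_eq_take.1 hv]
            exact List.mem_map_of_mem hb⟩)
        simp [fill] at this
      · unfold findOnPath at hf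
        have h2 := List.find?_some hf
        obtain ⟨k, _, h3⟩ := List.mem_flatMap.1 (List.mem_of_find?_eq_some hf)
        obtain ⟨c, hc, rfl⟩ := List.mem_map.1 h3
        have h2 : c.idx = b.idx := of_decide_eq_true h2
        dsimp only
        refine Prod.ext ?_ ?_
        · simp only [fill, h2]
        · simp only [TreeState.mk.injEq, true_and, and_true]
          funext w
          unfold deleteOnPath
          split_ifs with hw
          · rw [List.filter_map]
            rfl
          · rw [List.filter_eq_self.2]
            intro e he
            rw [List.isPrefixOf_iff_prefix] at hw
            simpa using fun h' => hw (hpos w e he h')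

end Intertwine

end ORAM
end

/-! ### Intertwining: fetch and a whole access. -/

noncomputable section
namespace ORAM

section Intertwine

variable {V : Type} {M : Mem (Option (List Bool))} {ν : ENNReal}
variable {P : Params} {N : ℕ} {O : Obl M none ν} {v₀ : V} {s : LState O.L} {m : ℕ → V}

theorem sample_map_bind {A B C : Type} (p : PMF A) (f : A → B) (F : B → Comp C) :
    sample (p.map f) >>= F = sample p >>= fun a => F (f a) := by
  rw [← PMF.bind_pure_comp]
  change sample (p >>= fun a => pure _) >>= _ = _
  rw [sample_bind, bind_assoc]
  simp only [sample_pure, pure_bind]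

/-- The old position of the block is revealed but then forgotten; the lazy chain only deletes the
index `i` and appends it to the queue. -/
theorem sample_realize_fetch (hα : 0 < P.α) (h : WF P.α O v₀ (fun v b => b ∈ s.tree v) s m)
    (r : ℕ) (f : V → V) :
    Inter (sample (realize P N O v₀ s m) >>= fetch P N M v₀ r f) (lFetch P O.acc (r / P.α) s)
      (fun s' => (realize P N O v₀ s' (Function.update m r (f (m r)))).map (Prod.mk (m r)))
      (fun s' => WF P.α O v₀ (fun v b => b ∈ s'.tree v) s' (Function.update m r (f (m r)))) := by
  set i := r / P.α with hi
  set m' := Function.update m r (f (m r)) with hm'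
  set d := P.depth N
  set q := s.queue.filter fun j => decide (j ≠ i) with hq
  have hiq : i ∉ q := by simp [hq]
  have hsat : Sat (O.acc i s.inner) fun l' => ∀ qs : List (ℕ × List Bool),
      qs.map Prod.fst = q ++ [i] →
        O.valid l' (withQueue (Function.update s.pm i none) qs) := by
    intro l' hl' qs hqs
    obtain ⟨qs₁, qs₂, rfl, h₁, h₂⟩ := List.map_eq_append_iff.1 hqs
    obtain ⟨⟨i', p⟩, rfl, hi'⟩ : ∃ x : ℕ × List Bool, qs₂ = [x] ∧ x.1 = i := by
      obtain ⟨x, rfl, h⟩ := List.map_eq_singleton_iff.1 h₂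
      exact ⟨x, rfl, h⟩
    obtain rfl : i' = i := hi'
    rw [withQueue_append_update _ (by rwa [h₁])]
    -- Validity of the inner state is known for position lists of the full queue. The entry of `i`,
    -- if it was deleted, is restored with the arbitrary position `[]`, which the access overwrites.
    obtain ⟨qs₃, h₃, rfl⟩ : ∃ qs₃ : List (ℕ × List Bool), qs₃.map Prod.fst = s.queue ∧
        qs₁ = qs₃.filter fun x => decide (x.1 ≠ i) := by
      refine ⟨s.queue.map fun j => (j, ((qs₁.find? fun x => decide (x.1 = j)).map
        Prod.snd).getD []), ?_, ?_⟩
      · simp [List.map_map, Function.comp_def]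
      · rw [List.filter_map]
        change qs₁ = q.map _
        rw [← h₁, List.map_map]
        refine (List.map_id qs₁).symm.trans (List.map_congr_left fun x hx => ?_)
        have hnd : (qs₁.map Prod.fst).Nodup := h₁ ▸ h.nodup.filter _
        have hfind : qs₁.find? (fun y => decide (y.1 = x.1)) = some x := by
          rcases hf : qs₁.find? (fun y => decide (y.1 = x.1)) with _ | y
          · simpa using List.find?_eq_none.1 hf x hx
          · have h5 : y.1 = x.1 := by simpa using List.find?_some hf
            rw [hf, List.inj_on_of_nodup_map hnd (List.mem_of_find?_eq_some hf) hx h5]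
        simp [hfind]
    rw [update_withQueue_filter]
    exact (O.inter s.inner (withQueue s.pm qs₃) i (fun _ => some p) (h.val qs₃ h₃)).2 l' hl'
  have hpost : Sat (lFetch P O.acc i s) fun s' =>
      WF P.α O v₀ (fun v b => b ∈ s'.tree v) s' m' := by
    refine sat_bind hsat fun l' hl' => ?_
    unfold lInsert
    split_ifs
    · exact sat_throw _ _
    · refine sat_pure ?_
      have hmem : ∀ v (b : Block Unit), b ∈ (s.tree v).filter (fun b => decide (b.idx ≠ i)) ↔
          b ∈ s.tree v ∧ b.idx ≠ i := by
        intro v b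
        simp
      constructor
      · intro v b hb
        have hb := (hmem v b).1 hb
        dsimp only
        rw [Function.update_of_ne hb.2]
        exact h.pm_eq v b hb.1
      · exact fun v b hb => h.pre v b ((hmem v b).1 hb).1
      · exact fun v w b c hb hc => h.uniq v w b c ((hmem v b).1 hb).1 ((hmem w c).1 hc).1
      · intro v b hb
        have hb := (hmem v b).1 hb
        have := h.notq v b hb.1
        simp [this, hb.2]
      · intro j p hj
        dsimp only at hj
        have hji : j ≠ i := by
          rintro rfl
          simp at hj
        rw [Function.update_of_ne hji] at hj
        obtain ⟨v, b, hb, rfl⟩ := h.ex j p hj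
        exact ⟨v, b, (hmem v b).2 ⟨hb, hji⟩, rfl⟩
      · refine List.nodup_append.2 ⟨h.nodup.filter _, List.nodup_singleton _, ?_⟩
        rintro a ha c hc rfl
        rw [List.mem_singleton.1 hc] at ha
        exact hiq ha
      · intro r' hr hrq
        dsimp only at hr hrq
        simp only [List.mem_append, List.mem_singleton, not_or, List.mem_filter, not_and] at hrq
        rw [Function.update_of_ne hrq.2] at hr
        have hrr : r' ≠ r := by
          rintro rfl
          exact hrq.2 rfl
        rw [hm', Function.update_of_ne hrr]
        refine h.fresh r' hr fun hin => ?_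
        exact hrq.1 hin (by simpa using hrq.2)
      · exact hl'
  refine ⟨?_, hpost⟩
  rw [sample_realize_bind]
  have hins : ∀ p, (⟨i, p, Function.update (blockVal P.α v₀ m i) (r % P.α)
      (f (blockVal P.α v₀ m i (r % P.α)))⟩ : Block V) = fillQ P.α v₀ m' (i, p) := by
    intro p
    rw [hi, blockVal_div_mod hα, update_blockVal hα]
    rfl
  have htree : (fun v => ((s.tree v).filter fun b => decide (b.idx ≠ i)).map (fill P.α v₀ m)) =
      fun v => ((s.tree v).filter fun b => decide (b.idx ≠ i)).map (fill P.α v₀ m') := by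
    funext v
    refine List.map_congr_left fun b hb => ?_
    have hb : b.idx ≠ i := by simpa using (List.mem_filter.1 hb).2
    rw [fill, fill, hm', blockVal_update_of_ne hb]
  have hqueue : ∀ qs : List (ℕ × List Bool),
      (qs.filter fun x => decide (x.1 ≠ i)).map (fillQ P.α v₀ m) =
        (qs.filter fun x => decide (x.1 ≠ i)).map (fillQ P.α v₀ m') := by
    intro qs
    refine List.map_congr_left fun b hb => ?_
    have hb : b.1 ≠ i := by simpa using (List.mem_filter.1 hb).2
    rw [fillQ, fillQ, hm', blockVal_update_of_ne hb]
  have h1 : ∀ qs ∈ (queueDist d s.queue).support,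
      (sample (O.rho s.inner (withQueue s.pm qs)) >>= fun σ => fetch P N M v₀ r f
        ⟨σ, fun v => (s.tree v).map (fill P.α v₀ m), qs.map (fillQ P.α v₀ m)⟩) =
      sample (uniformLeaf d) >>= fun p => O.acc i s.inner >>= fun l' =>
        sample (O.rho l' (Function.update (withQueue s.pm qs) i (some p))) >>= fun σ =>
          insertQueue P M (fillQ P.α v₀ m' (i, p))
            ⟨σ, fun v => ((s.tree v).filter fun b => decide (b.idx ≠ i)).map (fill P.α v₀ m'),
              (qs.filter fun x => decide (x.1 ≠ i)).map (fillQ P.α v₀ m')⟩ >>= fun s' =>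
            pure (m r, s') := by
    intro qs hqs
    have hqs := map_fst_of_mem_support hqs
    simp only [fetch_eq]
    rw [sample_bind_comm]
    refine congrArg _ (funext fun p => ?_)
    refine (O.access_bind (h.val qs hqs) _).trans ?_
    refine congrArg _ (funext fun l' => congrArg _ (funext fun σ => ?_))
    dsimp only
    rw [← hi, locate_realize h i hqs]
    dsimp only
    rw [hins, blockVal_div_mod hα, htree, hqueue]
  rw [sample_bind_congr h1]
  simp_rw [sample_bind_comm (uniformLeaf d) (O.acc i s.inner)]
  rw [sample_bind_comm]
  unfold lFetch
  rw [bind_assoc]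
  refine congrArg _ (funext fun l' => ?_)
  have h2 := sample_insertQueue (m := m') (v₀ := v₀) (P := P) (N := N) s.pm l' i
    (fun v => (s.tree v).filter fun b => decide (b.idx ≠ i)) q hiq
  rw [hq, queueDist_filter] at h2
  simp only [sample_bind, bind_assoc, sample_pure, pure_bind] at h2
  simp only [update_withQueue_filter] at h2
  have h3 := congrArg (fun x => x >>= fun s' => (pure (m r, s') : Comp (V × _))) h2
  simp only [bind_assoc] at h3
  refine h3.trans ?_
  refine congrArg _ (funext fun s' => ?_)
  have h4 := sample_map_bind (realize P N O v₀ s' m') (Prod.mk (m r)) pure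
  rw [bind_pure] at h4
  exact h4.symm

theorem sample_realize_access (hα : 0 < P.α) (h : WF P.α O v₀ (fun v b => b ∈ s.tree v) s m)
    (r : ℕ) (f : V → V) :
    Inter (sample (realize P N O v₀ s m) >>= fun st : TreeState V M.State =>
        fetch P N M v₀ r f st >>= fun x => dequeue P N M x.2 >>= fun st =>
          dequeue P N M st >>= fun st => (pure (x.1, st) : Comp (V × TreeState V M.State)))
      (lAccess P N O.acc r s)
      (fun s' => (realize P N O v₀ s' (Function.update m r (f (m r)))).map (Prod.mk (m r)))
      (fun s' => WF P.α O v₀ (fun v b => b ∈ s'.tree v) s' (Function.update m r (f (m r)))) := by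
  rw [← bind_assoc]
  refine (sample_realize_fetch hα h r f).bind fun s₁ h₁ => ?_
  rw [sample_map_bind]
  dsimp only
  rw [← bind_assoc]
  refine (sample_realize_dequeue h₁).bind fun s₂ h₂ => ?_
  rw [← bind_assoc]
  have h₃ := sample_realize_dequeue (N := N) h₂
  refine ⟨?_, h₃.2⟩
  rw [h₃.1, bind_assoc]
  refine congrArg _ (funext fun s' => ?_)
  have h4 := sample_map_bind (realize P N O v₀ s' (Function.update m r (f (m r)))) (Prod.mk (m r))
    pure
  rw [bind_pure] at h4
  exact h4.symm

/-- The representation of an ORAM by lazily sampled positions. -/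
def oramObl (P : Params) (N : ℕ) (O : Obl M none ν) (v₀ : V) (hα : 0 < P.α)
    (Psi : LState O.L → ENNReal) (ν' : ENNReal)
    (step : ∀ r s, wp (lAccess P N O.acc r s) Psi ≤ Psi s + ν')
    (Psi_start : Psi ⟨O.start, fun _ => none, fun _ => [], []⟩ ≤ ν') :
    Obl (oramMem P N M v₀) v₀ ν' where
  L := LState O.L
  start := ⟨O.start, fun _ => none, fun _ => [], []⟩
  valid := fun s m => WF P.α O v₀ (fun v b => b ∈ s.tree v) s m
  rho := fun s m => realize P N O v₀ s m
  acc := lAccess P N O.acc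
  Psi := Psi
  valid_start := by
    constructor
    · intro v b hb
      simp at hb
    · intro v b hb
      simp at hb
    · intro v w b c hb
      simp at hb
    · intro v b hb
      simp at hb
    · intro i p hp
      simp at hp
    · exact List.nodup_nil
    · intro r _ _
      rfl
    · intro qs hqs
      rw [List.map_eq_nil_iff.1 hqs]
      exact O.valid_start
  rho_start := by
    simp only [realize, queueDist, pure_bind, withQueue, O.rho_start]
    rfl
  inter := fun s m r f h => sample_realize_access hα h r f
  step := step
  Psi_start := Psi_start

end Intertwine

/-! ### From an oblivious representation to the execution of a program. -/

section Run

variable {n : ℕ} {M : Mem (Word n)} {ν : ENNReal}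

/-- Reads return the contents of the plain memory, so the halting bound of the plain execution
limits the number of steps at which `ν` is paid. For `T = 0` nothing is accessed and not even the
initial potential is charged. -/
theorem wp_run_le (O : Obl M (zeroWord n) ν) (Q : Program) : ∀ (T t : ℕ) (c : Q.State) (l : O.L)
    (m : ℕ → Word n), O.valid l m → Q.HaltsWithinFrom n T c (fun i => m i) →
    wp (sample (O.rho l m) >>= Q.run n M t c) (fun _ => 0) ≤
      if T = 0 then 0 else O.Psi l + T * ν
  | T, 0, c, l, m, _, _ => by
    have : sample (O.rho l m) >>= Q.run n M 0 c = sample (O.rho l m) >>= fun _ => pure () := rfl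
    rw [this, sample_bind_const, wp_pure]
    exact zero_le
  | 0, t + 1, c, l, m, _, hT => by
    have hT : Q.instr n c = Instr.halt := hT
    have : sample (O.rho l m) >>= Q.run n M (t + 1) c =
        sample (O.rho l m) >>= fun _ => pure () := by
      refine congrArg _ (funext fun σ => ?_)
      simp only [Program.run, hT]
    rw [this, sample_bind_const, wp_pure]
    exact zero_le
  | T + 1, t + 1, c, l, m, hv, hT => by
    have main : ∀ (r : ℕ) (f : Word n → Word n) (k : Word n → Q.State),
        Q.HaltsWithinFrom n T (k (m r)) (fun i => Function.update m r (f (m r)) i) →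
        wp (sample (O.rho l m) >>= fun σ => M.access r f σ >>= fun x =>
          Q.run n M t (k x.1) x.2) (fun _ => 0) ≤ O.Psi l + (T + 1 : ℕ) * ν := by
      intro r f k hk
      rw [← bind_assoc, (O.inter l m r f hv).1, bind_assoc, wp_bind]
      have h1 : (wp (O.acc r l) fun l' => wp (sample ((O.rho l' (Function.update m r
          (f (m r)))).map (Prod.mk (m r))) >>= fun x => Q.run n M t (k x.1) x.2) fun _ => 0) ≤
          wp (O.acc r l) fun l' => T * ν + O.Psi l' := by
        refine wp_mono_sat _ (O.inter l m r f hv).2 fun l' hl' => ?_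
        rw [sample_map_bind]
        refine (wp_run_le O Q T t (k (m r)) l' _ hl' hk).trans ?_
        split_ifs
        · exact zero_le
        · rw [add_comm]
      refine h1.trans ((wp_add_const_le _ _ _).trans ((add_le_add_right (O.step r l) _).trans ?_))
      push_cast
      rw [add_mul, one_mul]
      exact (by ring : (T : ENNReal) * ν + (O.Psi l + ν) = O.Psi l + (T * ν + ν)).le
    rw [if_neg (Nat.succ_ne_zero T)]
    unfold Program.HaltsWithinFrom at hT
    change wp (sample (O.rho l m) >>= fun σ => Q.run n M (t + 1) c σ) _ ≤ _
    simp only [Program.run]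
    cases hI : Q.instr n c with
    | halt =>
      dsimp only
      rw [sample_bind_const, wp_pure]
      exact zero_le
    | read r k =>
      rw [hI] at hT
      refine main r id k ?_
      simpa using hT
    | write r v c' =>
      rw [hI] at hT
      refine main r (fun _ => v) (fun _ => c') ?_
      convert hT using 2 with i
      by_cases hir : i = r
      · subst hir
        simp
      · rw [Function.update_of_ne hir, Function.update_of_ne (fun h => hir (Fin.ext h))]

end Run

/-- The factor `2` absorbs the initial potential, which is at most `ν ≤ T * ν` for `T ≥ 1`. -/
theorem probAbortQueue_le {P : Params} {R : ℕ} {ν : ENNReal}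
    (O : Obl (compiledMem P R) (zeroWord P.n) ν) (Q : Program) (x : List Bool) (T : ℕ)
    (hT : Q.HaltsWithin P.n x T) : Q.probAbortQueue P R x ≤ T * (2 * ν) := by
  refine iSup_le fun t => ?_
  have h := wp_run_le O Q T t (Q.start P.n x) O.start _ O.valid_start hT
  rw [O.rho_start, sample_pure, pure_bind] at h
  refine (run_error_queue_le_wp _ _).trans (h.trans ?_)
  split_ifs with h0
  · exact zero_le
  · have h1 : (1 : ENNReal) ≤ T := by exact_mod_cast Nat.one_le_iff_ne_zero.2 h0
    calc O.Psi O.start + T * ν ≤ T * ν + T * ν := by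
          gcongr
          exact O.Psi_start.trans (by simpa using mul_le_mul_left h1 ν)
      _ = T * (2 * ν) := by ring

end ORAM
end

noncomputable section
namespace ORAM

/-! ### Loads -/

/-- The number of blocks of a bucket that are assigned to leaves below the node `c`. -/
def cnt (c : List Bool) (bs : List (Block Unit)) : ℕ := bs.countP fun b => c.isPrefixOf b.pos

/-- The number of blocks in buckets at proper ancestors of the node `c` that are assigned to leaves
below `c`. -/
def load (tree : List Bool → List (Block Unit)) (c : List Bool) : ℕ :=
  ∑ j ∈ Finset.range c.length, cnt c (tree (c.take j))

/-- The number of children of the node `u` whose load is at least `ℓ / 2`. -/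
def kids (ℓ : ℕ) (X : List Bool → ℕ) (u : List Bool) : ℕ :=
  (if ℓ ≤ 2 * X (u ++ [false]) then 1 else 0) + (if ℓ ≤ 2 * X (u ++ [true]) then 1 else 0)

/-- A bound for the number of overflows when the path to `p` is flushed. -/
def overflows (ℓ : ℕ) (X : List Bool → ℕ) (p : List Bool) : ℕ :=
  ∑ t ∈ Finset.range p.length, kids ℓ X (p.take t)

/-- One more block for the nodes on the path to `p`. -/
def incLoad (p : List Bool) (X : List Bool → ℕ) : List Bool → ℕ :=
  fun c => X c + if c <+: p then 1 else 0

/-- One block less for the nodes on the path to `p`. -/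
def decLoad (p : List Bool) (X : List Bool → ℕ) : List Bool → ℕ :=
  fun c => X c - if c <+: p then 1 else 0

/-- A bound for the loads at the end of a `Flush` along the path to `p`, when the bucket at depth `i`
is about to be processed. -/
def target (p : List Bool) (i : ℕ) (tree : List Bool → List (Block Unit)) (c : List Bool) : ℕ :=
  if c <+: p ∧ i < c.length then
    (∑ j ∈ Finset.range i, cnt c (tree (c.take j))) +
      ((∑ j ∈ Finset.Ico i c.length, cnt c (tree (c.take j))) - 1)
  else load tree c

theorem kids_mono {ℓ : ℕ} {X Y : List Bool → ℕ} (h : X ≤ Y) (u : List Bool) :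
    kids ℓ X u ≤ kids ℓ Y u := by
  have h0 : X (u ++ [false]) ≤ Y (u ++ [false]) := h _
  have h1 : X (u ++ [true]) ≤ Y (u ++ [true]) := h _
  unfold kids
  gcongr ?_ + ?_
  · split_ifs <;> omega
  · split_ifs <;> omega

theorem overflows_mono {ℓ : ℕ} {X Y : List Bool → ℕ} (h : X ≤ Y) (p : List Bool) :
    overflows ℓ X p ≤ overflows ℓ Y p :=
  Finset.sum_le_sum fun _ _ => kids_mono h _

theorem common_ge_of_prefix : ∀ {c p q : List Bool}, c <+: p → c <+: q → c.length ≤ common q p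
  | [], _, _, _, _ => Nat.zero_le _
  | a :: c, [], q, h, _ => by simp at h
  | a :: c, b :: p, [], _, h => by simp at h
  | a :: c, b :: p, e :: q, h, h' => by
    rw [List.cons_prefix_cons] at h h'
    obtain ⟨rfl, h⟩ := h
    obtain ⟨rfl, h'⟩ := h'
    simp only [common, if_true, List.length_cons, add_le_add_iff_right]
    exact common_ge_of_prefix h h'

theorem cnt_remove_le (c : List Bool) (o : Option (Block Unit)) (bs : List (Block Unit)) :
    cnt c (remove o bs) ≤ cnt c bs := by
  cases o with
  | none => exact le_rfl
  | some b => exact (List.filter_sublist).countP_le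

/-- Only an inequality, since `remove` deletes all blocks with the given index. The potential bounds
have to hold for all lazy states, well-formed or not, so uniqueness of indices is not available. -/
theorem cnt_remove_add (c : List Bool) {o : Option (Block Unit)} {bs : List (Block Unit)}
    (h : ∀ b ∈ o, b ∈ bs) : cnt c (remove o bs) + cnt c o.toList ≤ cnt c bs := by
  cases o with
  | none => simp [remove, cnt]
  | some b =>
    have hp : bs.Perm ((bs.filter fun c => decide (c.idx ≠ b.idx)) ++
        bs.filter fun c => !decide (c.idx ≠ b.idx)) := (List.filter_append_perm _ _).symm
    have hb : b ∈ bs.filter fun c => !decide (c.idx ≠ b.idx) := by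
      simp [h b rfl]
    have h1 : cnt c [b] ≤ cnt c (bs.filter fun c => !decide (c.idx ≠ b.idx)) :=
      (List.singleton_sublist.2 hb).countP_le
    have h2 := hp.countP_eq (fun b => c.isPrefixOf b.pos)
    rw [List.countP_append] at h2
    simp only [cnt, remove, Option.toList_some] at h1 ⊢
    omega

theorem length_remove_add {o : Option (Block Unit)} {bs : List (Block Unit)}
    (h : ∀ b ∈ o, b ∈ bs) : (remove o bs).length + o.toList.length ≤ bs.length := by
  have := cnt_remove_add [] h
  simpa [cnt] using this

theorem length_remove_remove_add {o o' : Option (Block Unit)} {bs : List (Block Unit)}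
    (h : ∀ b ∈ o, b ∈ bs) (h' : ∀ b ∈ o', b ∈ bs) (hne : ∀ b ∈ o, ∀ b' ∈ o', b ≠ b') :
    (remove o' (remove o bs)).length + o.toList.length + o'.toList.length ≤ bs.length := by
  rcases o with _ | b
  · simpa [remove] using length_remove_add h'
  rcases o' with _ | b'
  · simpa [remove] using length_remove_add h
  have hb := h b rfl
  have hb' := h' b' rfl
  have hne := hne b rfl b' rfl
  have hp := (List.filter_append_perm (fun c : Block Unit => decide (c.idx ≠ b.idx ∧ c.idx ≠ b'.idx))
    bs).length_eq
  rw [List.length_append] at hp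
  have h2 : 2 ≤ (bs.filter fun c => !decide (c.idx ≠ b.idx ∧ c.idx ≠ b'.idx)).length := by
    have hs : [b, b'].Subperm
        (bs.filter fun c => !decide (c.idx ≠ b.idx ∧ c.idx ≠ b'.idx)) := by
      refine List.subperm_of_subset ?_ ?_
      · simpa using hne
      · intro x hx
        rcases List.mem_pair.1 hx with rfl | rfl
        · simp [hb]
        · simp [hb']
    exact hs.length_le
  have h3 : remove (some b') (remove (some b) bs) =
      bs.filter fun c => decide (c.idx ≠ b.idx ∧ c.idx ≠ b'.idx) := by
    simp [remove, List.filter_filter, Bool.and_comm]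
  rw [h3]
  simp only [Option.toList_some, List.length_singleton]
  omega

/-! ### How a flush changes the loads. -/

section FlushStep

variable {P : Params} {p : List Bool} {i : ℕ} {tree : List Bool → List (Block Unit)}
  {bs₁ bs₂ : List (Block Unit)} {next : Option (Block Unit)}

/-- The effect of one step of a `Flush` on the buckets above the node `c`. -/
theorem flushStep_counts (hi : i < p.length) (c : List Bool)
    (hcnt : cnt c bs₂ + cnt c next.toList ≤ cnt c (tree (p.take i))) :
    let T' := place (Function.update tree (p.take i) bs₂) (p.take (i + 1)) next
    (¬ (i < c.length ∧ c.take i = p.take i) →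
      ∀ j, j < c.length → cnt c (T' (c.take j)) = cnt c (tree (c.take j))) ∧
    (i < c.length → c.take i = p.take i →
      (∀ j < i, cnt c (T' (c.take j)) = cnt c (tree (c.take j))) ∧
      cnt c (T' (c.take i)) + cnt c next.toList ≤ cnt c (tree (c.take i)) ∧
      (∑ j ∈ Finset.Ico (i + 1) c.length, cnt c (T' (c.take j))) ≤
        (∑ j ∈ Finset.Ico (i + 1) c.length, cnt c (tree (c.take j))) + cnt c next.toList) := by
  intro T'
  have hlen : ∀ j, j < c.length → (c.take j).length = j := by
    intro j hj
    rw [List.length_take]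
    omega
  have hlen' : ∀ j, j ≤ p.length → (p.take j).length = j := by
    intro j hj
    rw [List.length_take]
    omega
  have hu : ∀ j, j < c.length → j ≠ i → c.take j ≠ p.take i := by
    intro j hj hji he
    have := congrArg List.length he
    rw [hlen j hj, hlen' i hi.le] at this
    exact hji this
  have hw : ∀ j, j < c.length → j ≠ i + 1 → c.take j ≠ p.take (i + 1) := by
    intro j hj hji he
    have := congrArg List.length he
    rw [hlen j hj, hlen' (i + 1) hi] at this
    exact hji this
  have hT : ∀ v, v ≠ p.take i → v ≠ p.take (i + 1) → T' v = tree v := by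
    intro v h1 h2
    simp [T', place, h1, h2]
  have hTu : T' (p.take i) = bs₂ := by
    simp [T', place, (take_succ_ne_take hi).symm]
  constructor
  · intro hn j hj
    have h1 : c.take j ≠ p.take i := by
      by_cases hji : j = i
      · subst hji
        exact fun he => hn ⟨hj, he⟩
      · exact hu j hj hji
    have h2 : c.take j ≠ p.take (i + 1) := by
      by_cases hji : j = i + 1
      · subst hji
        intro he
        refine hn ⟨by omega, ?_⟩
        have := congrArg (List.take i) he
        simpa [List.take_take] using this
      · exact hw j hj hji
    rw [hT _ h1 h2]
  · intro hic hci
    refine ⟨fun j hj => ?_, ?_, ?_⟩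
    · rw [hT _ (hu j (by omega) (by omega)) (hw j (by omega) (by omega))]
    · rw [hci, hTu]
      exact hcnt
    · by_cases hlt : i + 1 < c.length
      · rw [← Finset.add_sum_Ioo_eq_sum_Ico hlt, ← Finset.add_sum_Ioo_eq_sum_Ico hlt]
        have h1 : ∑ j ∈ Finset.Ioo (i + 1) c.length, cnt c (T' (c.take j)) =
            ∑ j ∈ Finset.Ioo (i + 1) c.length, cnt c (tree (c.take j)) := by
          refine Finset.sum_congr rfl fun j hj => ?_
          rw [Finset.mem_Ioo] at hj
          rw [hT _ (hu j (by omega) (by omega)) (hw j (by omega) (by omega))]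
        have h2 : cnt c (T' (c.take (i + 1))) ≤
            cnt c (tree (c.take (i + 1))) + cnt c next.toList := by
          by_cases he : c.take (i + 1) = p.take (i + 1)
          · rw [he]
            simp [T', place, take_succ_ne_take hi, cnt, List.countP_append, add_comm]
          · rw [hT _ (hu (i + 1) hlt (by omega)) he]
            exact Nat.le_add_right _ _
        omega
      · rw [Finset.Ico_eq_empty (by omega)]
        simp

theorem sum_range_length_eq {f : ℕ → ℕ} {i n : ℕ} (h : i < n) :
    ∑ j ∈ Finset.range n, f j =
      (∑ j ∈ Finset.range i, f j) + (f i + ∑ j ∈ Finset.Ico (i + 1) n, f j) := by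
  rw [← Finset.sum_eq_sum_Ico_succ_bot h, Finset.sum_range_add_sum_Ico _ h.le]

/-- The pulled block leaves one ancestor of `c` and enters at most one other, and overflows only
delete. -/
theorem load_flushStep_le (hi : i < p.length) (c : List Bool)
    (hcnt : cnt c bs₂ + cnt c next.toList ≤ cnt c (tree (p.take i))) :
    load (place (Function.update tree (p.take i) bs₂) (p.take (i + 1)) next) c ≤ load tree c := by
  obtain ⟨h1, h2⟩ := flushStep_counts hi c hcnt
  unfold load
  by_cases h : i < c.length ∧ c.take i = p.take i
  · obtain ⟨h3, h4, h5⟩ := h2 h.1 h.2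
    rw [sum_range_length_eq h.1, sum_range_length_eq h.1]
    have : ∀ (f g : ℕ → ℕ), (∀ j < i, f j = g j) →
        ∑ j ∈ Finset.range i, f j = ∑ j ∈ Finset.range i, g j :=
      fun f g hfg => Finset.sum_congr rfl fun j hj => hfg j (Finset.mem_range.1 hj)
    rw [this _ _ h3]
    omega
  · exact (Finset.sum_congr rfl fun j hj => h1 h j (Finset.mem_range.1 hj)).le

/-- If the bucket at depth `i` holds a block assigned below `c`, greediness moves such a block one
step closer to `c`, which keeps the count from depth `i + 1` on positive or completes the decrease.
Otherwise that bucket contributes nothing and the pending decrease carries over to the deeper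
buckets. -/
theorem target_flushStep_le (hi : i < p.length) (c : List Bool)
    (hcnt : cnt c bs₂ + cnt c next.toList ≤ cnt c (tree (p.take i)))
    (hnext : c <+: p → i < c.length → 0 < cnt c (tree (p.take i)) → cnt c next.toList = 1) :
    target p (i + 1) (place (Function.update tree (p.take i) bs₂) (p.take (i + 1)) next) c ≤
      target p i tree c := by
  by_cases hc : c <+: p ∧ i < c.length
  · have hci : c.take i = p.take i := by
      rw [List.prefix_iff_eq_take.1 hc.1, List.take_take, min_eq_left hc.2.le]
    obtain ⟨h3, h4, h5⟩ := (flushStep_counts hi c hcnt).2 hc.2 hci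
    have hn := hnext hc.1 hc.2
    rw [← hci] at hn
    have hA : ∀ (f g : ℕ → ℕ), (∀ j < i, f j = g j) →
        ∑ j ∈ Finset.range i, f j = ∑ j ∈ Finset.range i, g j :=
      fun f g hfg => Finset.sum_congr rfl fun j hj => hfg j (Finset.mem_range.1 hj)
    have hA := hA _ _ h3
    have hR : target p i tree c = (∑ j ∈ Finset.range i, cnt c (tree (c.take j))) +
        (cnt c (tree (c.take i)) + (∑ j ∈ Finset.Ico (i + 1) c.length, cnt c (tree (c.take j)))
          - 1) := by
      unfold target
      rw [if_pos hc, Finset.sum_eq_sum_Ico_succ_bot hc.2]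
    rw [hR]
    unfold target
    split_ifs with hc'
    · rw [Finset.sum_range_succ, hA]
      omega
    -- The processed node is the parent of `c`: the pulled block arrives at `c` itself, which is not
    -- a proper ancestor, so the load has really dropped.
    · have hlen : c.length = i + 1 := by
        by_contra hne
        exact hc' ⟨hc.1, by omega⟩
      unfold load
      rw [hlen, Finset.sum_range_succ, hA, Finset.Ico_self, Finset.sum_empty]
      omega
  · unfold target
    rw [if_neg hc, if_neg fun h => hc ⟨h.1, by omega⟩]
    exact load_flushStep_le hi c hcnt

theorem target_length (p : List Bool) (tree : List Bool → List (Block Unit)) (c : List Bool) :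
    target p p.length tree c = load tree c := by
  unfold target
  rw [if_neg]
  rintro ⟨h, h'⟩
  exact absurd h.length_le (by omega)

theorem target_zero (p : List Bool) (tree : List Bool → List (Block Unit)) (c : List Bool) :
    target p 0 tree c = decLoad p (load tree) c := by
  unfold target decLoad load
  by_cases hc : c <+: p
  · rw [if_pos hc]
    by_cases h0 : 0 < c.length
    · rw [if_pos ⟨hc, h0⟩]
      simp
    · have : c = [] := List.length_eq_zero_iff.1 (by omega)
      subst this
      simp
  · rw [if_neg hc, if_neg fun h => hc h.1]
    simp

/-- A block assigned below `c` shares at least `c.length` bits with `p`; the block that can travel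
furthest shares at least as many and is therefore also assigned below `c`. -/
theorem cnt_pullBlock {bs : List (Block Unit)} {c : List Bool} (hc : c <+: p)
    (hi : i < c.length) (h : 0 < cnt c bs) : cnt c (pullBlock P p i bs).toList = 1 := by
  obtain ⟨b, hb, hbc⟩ := List.countP_pos_iff.1 h
  rw [List.isPrefixOf_iff_prefix] at hbc
  have h1 := common_ge_of_prefix hc hbc
  obtain ⟨x, hx, hmax⟩ : ∃ x ∈ bs, ∀ y ∈ bs, common y.pos p ≤ common x.pos p := by
    exact Set.exists_max_image {y | y ∈ bs} (fun y => common y.pos p) bs.finite_toSet ⟨b, hb⟩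
  obtain ⟨y, hy⟩ : ∃ y, pullBlock P p i bs = some y := by
    refine choose_isSome (List.ne_nil_of_mem (a := x) (List.mem_filter.2 ⟨hx, ?_⟩))
    exact decide_eq_true ⟨lt_of_lt_of_le hi (h1.trans (hmax b hb)), hmax⟩
  have hy' := mem_of_pullBlock hy
  have h2 : c <+: y.pos := by
    have := take_prefix_of_lt_common (h1.trans (hy'.2.2 b hb))
    rwa [← List.prefix_iff_eq_take.1 hc] at this
  rw [hy]
  simp [cnt, List.isPrefixOf_iff_prefix, h2]

/-- The bucket of the parent is one summand of the load of the child, so an overflow forces a large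
load. -/
theorem spillBlock_length_le (hi : i ≤ p.length) (x : Bool) {bs₁ : List (Block Unit)}
    (h : ∀ c, cnt c bs₁ ≤ cnt c (tree (p.take i))) :
    (spillBlock P (p.take i ++ [x]) bs₁).toList.length ≤
      if P.ℓ ≤ 2 * load tree (p.take i ++ [x]) then 1 else 0 := by
  rcases hs : spillBlock P (p.take i ++ [x]) bs₁ with _ | b
  · simp
  · have hl := (mem_of_spillBlock hs).2.2
    rw [← List.countP_eq_length_filter] at hl
    have h1 := h (p.take i ++ [x])
    have hlen : (p.take i).length = i := by
      rw [List.length_take]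
      omega
    have h2 : cnt (p.take i ++ [x]) (tree (p.take i)) ≤ load tree (p.take i ++ [x]) := by
      unfold load
      refine le_trans (le_of_eq ?_) (Finset.single_le_sum (fun _ _ => Nat.zero_le _)
        (Finset.mem_range.2 (show i < _ by simp [hlen])))
      congr 2
      rw [List.take_append_of_le_length hlen.ge, List.take_take, min_self]
    rw [if_pos (by unfold cnt at h1 h2; omega)]
    simp

end FlushStep

/-! ### The size of the tree -/

/-- The nodes at depth `k`. -/
def level (k : ℕ) : Finset (List Bool) := (Finset.univ : Finset (Fin k → Bool)).image List.ofFn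

theorem mem_level {k : ℕ} {c : List Bool} : c ∈ level k ↔ c.length = k := by
  unfold level
  rw [Finset.mem_image]
  constructor
  · rintro ⟨f, _, rfl⟩
    simp
  · rintro rfl
    exact ⟨c.get, Finset.mem_univ _, List.ofFn_get c⟩

/-- The nodes of the tree of depth `d`. -/
def nodes (d : ℕ) : Finset (List Bool) := (Finset.range (d + 1)).biUnion level

theorem mem_nodes {d : ℕ} {c : List Bool} : c ∈ nodes d ↔ c.length ≤ d := by
  simp [nodes, mem_level]

/-- The number of blocks in the tree of depth `d`. -/
def treeSize (d : ℕ) (tree : List Bool → List (Block Unit)) : ℕ :=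
  ∑ v ∈ nodes d, (tree v).length

theorem treeSize_update {d : ℕ} (tree : List Bool → List (Block Unit)) {v : List Bool}
    (hv : v.length ≤ d) (bs : List (Block Unit)) :
    treeSize d (Function.update tree v bs) + (tree v).length = treeSize d tree + bs.length := by
  have hv := mem_nodes.2 hv
  unfold treeSize
  rw [← Finset.add_sum_erase _ _ hv, ← Finset.add_sum_erase _ _ hv]
  have : ∑ w ∈ (nodes d).erase v, (Function.update tree v bs w).length =
      ∑ w ∈ (nodes d).erase v, (tree w).length :=
    Finset.sum_congr rfl fun w hw => by rw [Function.update_of_ne (Finset.ne_of_mem_erase hw)]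
  rw [this, Function.update_self]
  omega

theorem treeSize_place {d : ℕ} (tree : List Bool → List (Block Unit)) {v : List Bool}
    (hv : v.length ≤ d) (o : Option (Block Unit)) :
    treeSize d (place tree v o) = treeSize d tree + o.toList.length := by
  have := treeSize_update tree hv (o.toList ++ tree v)
  rw [List.length_append] at this
  unfold place
  omega

end ORAM
end

noncomputable section
namespace ORAM

/-! ### The abstract process of loads -/

/-- The average over the leaves of the tree of depth `d`. -/
def leafAvg (d : ℕ) (f : List Bool → ENNReal) : ENNReal := (∑ p ∈ level d, f p) / 2 ^ d

/-- The effect of a `Flush` on a function of the loads and the length of the queue. -/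
def flushOp (d ℓ : ℕ) (G : (List Bool → ℕ) → ℕ → ENNReal) (X : List Bool → ℕ) (q : ℕ) : ENNReal :=
  leafAvg d fun p => G (decLoad p X) (q + overflows ℓ X p)

/-- The effect of a geometrically distributed number of `Flush`es. -/
def geomOp (d ℓ : ℕ) (G : (List Bool → ℕ) → ℕ → ENNReal) (X : List Bool → ℕ) (q : ℕ) : ENNReal :=
  expect numFlushes fun k => (flushOp d ℓ)^[k] G X q

/-- The effect of a `Dequeue`. -/
def dequeueOp (d ℓ : ℕ) (G : (List Bool → ℕ) → ℕ → ENNReal) (X : List Bool → ℕ) (q : ℕ) :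
    ENNReal :=
  if q = 0 then geomOp d ℓ G X 0 else leafAvg d fun p => geomOp d ℓ G (incLoad p X) (q - 1)

/-- A function of the loads and the length of the queue is admissible if it is monotone and at least
`1` as soon as the queue reaches its maximum size. -/
structure Admissible (qmax : ℕ) (G : (List Bool → ℕ) → ℕ → ENNReal) : Prop where
  mono : ∀ X Y q r, X ≤ Y → q ≤ r → G X q ≤ G Y r
  one_le : ∀ X q, qmax ≤ q → 1 ≤ G X q

theorem card_level (d : ℕ) : (level d).card = 2 ^ d := by
  rw [level, Finset.card_image_of_injective _ List.ofFn_injective, Finset.card_univ]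
  simp

theorem expect_uniformLeaf (d : ℕ) (f : List Bool → ENNReal) :
    expect (uniformLeaf d) f = leafAvg d f := by
  unfold uniformLeaf leafAvg
  rw [expect_map]
  unfold expect
  rw [tsum_fintype, level, Finset.sum_image (fun _ _ _ _ h => List.ofFn_injective h)]
  simp only [PMF.uniformOfFintype_apply]
  rw [← Finset.mul_sum, ENNReal.div_eq_inv_mul]
  simp

theorem leafAvg_mono (d : ℕ) {f g : List Bool → ENNReal} (h : ∀ p ∈ level d, f p ≤ g p) :
    leafAvg d f ≤ leafAvg d g :=
  ENNReal.div_le_div_right (Finset.sum_le_sum h) _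

theorem leafAvg_const (d : ℕ) (c : ENNReal) : (leafAvg d fun _ => c) = c := by
  rw [← expect_uniformLeaf, expect_const]

theorem decLoad_mono (p : List Bool) {X Y : List Bool → ℕ} (h : X ≤ Y) :
    decLoad p X ≤ decLoad p Y := fun c => Nat.sub_le_sub_right (h c) _

section Admissible

variable {qmax d ℓ : ℕ} {G H : (List Bool → ℕ) → ℕ → ENNReal}

theorem Admissible.flushOp (h : Admissible qmax G) : Admissible qmax (flushOp d ℓ G) := by
  constructor
  · intro X Y q r hX hq
    exact leafAvg_mono d fun p _ => h.mono _ _ _ _ (decLoad_mono p hX)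
      (Nat.add_le_add hq (overflows_mono hX p))
  · intro X q hq
    rw [← leafAvg_const d 1]
    exact leafAvg_mono d fun p _ => h.one_le _ _ (by omega)

theorem Admissible.iterate (h : Admissible qmax G) :
    ∀ k, Admissible qmax ((ORAM.flushOp d ℓ)^[k] G)
  | 0 => h
  | k + 1 => by
    rw [Function.iterate_succ_apply']
    exact (h.iterate k).flushOp

theorem Admissible.geomOp (h : Admissible qmax G) : Admissible qmax (geomOp d ℓ G) := by
  constructor
  · intro X Y q r hX hq
    exact expect_mono _ fun k => (h.iterate k).mono _ _ _ _ hX hq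
  · intro X q hq
    rw [← expect_const numFlushes 1]
    exact expect_mono _ fun k => (h.iterate k).one_le _ _ hq

end Admissible

/-! ### Domination of the lazy ORAM by the process of loads. -/

section WP

variable {M : Mem (Option (List Bool))} {ν : ENNReal}
variable {P : Params} {N : ℕ} {O : Obl M none ν} {G : (List Bool → ℕ) → ℕ → ENNReal}

/-- The potential of a state: the abstract potential, the potential of the position map, and the cost
of the accesses to the position map that are caused by overflows. -/
def potential (P : Params) (N : ℕ) (O : Obl M none ν) (G : (List Bool → ℕ) → ℕ → ENNReal)
    (s : LState O.L) : ENNReal :=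
  G (load s.tree) s.queue.length + (O.Psi s.inner + ν * treeSize (P.depth N) s.tree)

theorem wp_lInsert_le {F : LState O.L → ENNReal} {Γ : ENNReal} {i : ℕ} {s : LState O.L}
    (hF : F { s with queue := s.queue ++ [i] } ≤ Γ + O.Psi s.inner)
    (hΓ : P.qmax ≤ s.queue.length + 1 → 1 ≤ Γ) : wp (lInsert P i s) F ≤ Γ + O.Psi s.inner := by
  unfold lInsert
  split_ifs with h
  · rw [wp_throw_queue]
    exact (hΓ (by simpa using h)).trans le_self_add
  · rw [wp_pure]
    exact hF

/-- Aborts inside the position map are already covered by the growth `ν` of its own potential. -/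
theorem wp_acc_bind_le {F : LState O.L → ENNReal} {Γ : ENNReal} {i : ℕ} {l : O.L}
    {k : O.L → Comp (LState O.L)} (h : ∀ l', wp (k l') F ≤ Γ + O.Psi l') :
    wp (O.acc i l >>= k) F ≤ Γ + (O.Psi l + ν) := by
  rw [wp_bind]
  exact (wp_mono _ h).trans ((wp_add_const_le _ _ _).trans (add_le_add_right (O.step i l) _))

theorem wp_lOverflow?_le {F : LState O.L → ENNReal} {Γ : ENNReal} (o : Option (Block Unit))
    {s : LState O.L}
    (hF : ∀ s', s'.tree = s.tree → s'.queue.length = s.queue.length + o.toList.length →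
      F s' ≤ Γ + O.Psi s'.inner)
    (hΓ : P.qmax ≤ s.queue.length + o.toList.length → 1 ≤ Γ) :
    wp (lOverflow? P O.acc o s) F ≤ Γ + (O.Psi s.inner + ν * o.toList.length) := by
  cases o with
  | none =>
    unfold lOverflow?
    rw [wp_pure]
    simpa using hF s rfl (by simp)
  | some b =>
    unfold lOverflow? lOverflow
    simp only [Option.toList_some, List.length_singleton, Nat.cast_one, mul_one] at hF hΓ ⊢
    refine wp_acc_bind_le fun l' => ?_
    refine wp_lInsert_le (hF _ rfl (by simp)) hΓ

/-- `Y` and `Q` are bounds for the final loads and queue length fixed in advance, so monotonicity of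
`G` is used only at the leaf. An abort on the way is covered because then `Q ≥ P.qmax`. -/
theorem wp_lFlushFrom_le (hG : Admissible P.qmax G) {p : List Bool} (hp : p.length = P.depth N) :
    ∀ (k i : ℕ) (_ : i + k = p.length) (carry : Option (Block Unit)) (s : LState O.L)
      (Y : List Bool → ℕ) (Q : ℕ),
      (∀ c, target p i (place s.tree (p.take i) carry) c ≤ Y c) →
      s.queue.length + ∑ t ∈ Finset.Ico i p.length,
        kids P.ℓ (load (place s.tree (p.take i) carry)) (p.take t) ≤ Q →
      wp (lFlushFrom P O.acc p k i carry s) (potential P N O G) ≤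
        G Y Q + (O.Psi s.inner + ν * treeSize (P.depth N) (place s.tree (p.take i) carry))
  | 0, i, hi, carry, s, Y, Q, hY, hQ => by
    unfold lFlushFrom
    dsimp only
    split_ifs
    · rw [wp_throw_leaf]
      exact zero_le
    · rw [wp_pure]
      unfold potential
      refine add_le_add (hG.mono _ _ _ _ (fun c => ?_) ((Nat.le_add_right _ _).trans hQ)) le_rfl
      have := hY c
      rw [add_zero] at hi
      rwa [hi, target_length, ← hi] at this
  | k + 1, i, hi, carry, s, Y, Q, hY, hQ => by
    have hlt : i < p.length := by omega
    set T := place s.tree (p.take i) carry with hT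
    unfold lFlushFrom
    dsimp only
    set bs := carry.toList ++ s.tree (p.take i) with hbs
    have hTu : T (p.take i) = bs := by simp [hT, place, hbs]
    set next := pullBlock P p i bs with hnext
    set bs₁ := remove next bs with hbs₁
    set o₀ := spillBlock P (p.take i ++ [false]) bs₁ with ho₀
    set o₁ := spillBlock P (p.take i ++ [true]) bs₁ with ho₁
    set bs₂ := remove o₁ (remove o₀ bs₁) with hbs₂
    have hupd : Function.update s.tree (p.take i) bs₂ = Function.update T (p.take i) bs₂ := by
      simp [hT, place]
    rw [hupd]
    set T' := place (Function.update T (p.take i) bs₂) (p.take (i + 1)) next with hT'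
    have hmem : ∀ b ∈ next, b ∈ bs := fun b hb => (mem_of_pullBlock hb).1
    have hcnt1 : ∀ c, cnt c bs₁ + cnt c next.toList ≤ cnt c (T (p.take i)) := by
      intro c
      rw [hTu]
      exact cnt_remove_add c hmem
    have hcnt : ∀ c, cnt c bs₂ + cnt c next.toList ≤ cnt c (T (p.take i)) := by
      intro c
      have h1 : cnt c bs₂ ≤ cnt c bs₁ := (cnt_remove_le _ _ _).trans (cnt_remove_le _ _ _)
      have := hcnt1 c
      omega
    have hload : load T' ≤ load T := fun c => load_flushStep_le hlt c (hcnt c)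
    have hsp : ∀ x, (spillBlock P (p.take i ++ [x]) bs₁).toList.length ≤
        if P.ℓ ≤ 2 * load T (p.take i ++ [x]) then 1 else 0 := by
      intro x
      refine spillBlock_length_le hlt.le x fun c => ?_
      have := hcnt1 c
      omega
    have hkids : o₀.toList.length + o₁.toList.length ≤ kids P.ℓ (load T) (p.take i) :=
      add_le_add (hsp false) (hsp true)
    have hsum : s.queue.length + (o₀.toList.length + o₁.toList.length) +
        ∑ t ∈ Finset.Ico (i + 1) p.length, kids P.ℓ (load T') (p.take t) ≤ Q := by
      rw [Finset.sum_eq_sum_Ico_succ_bot hlt] at hQ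
      have : ∑ t ∈ Finset.Ico (i + 1) p.length, kids P.ℓ (load T') (p.take t) ≤
          ∑ t ∈ Finset.Ico (i + 1) p.length, kids P.ℓ (load T) (p.take t) :=
        Finset.sum_le_sum fun t _ => kids_mono hload _
      omega
    -- Each overflowing block leaves the tree and thereby frees the `ν` that pays for its access to
    -- the position map.
    have hsize : treeSize (P.depth N) T' + o₀.toList.length + o₁.toList.length ≤
        treeSize (P.depth N) T := by
      have hm₀ : ∀ b ∈ o₀, b ∈ bs₁ := fun b hb => (mem_of_spillBlock hb).1
      have hm₁ : ∀ b ∈ o₁, b ∈ bs₁ := fun b hb => (mem_of_spillBlock hb).1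
      have hne : ∀ b ∈ o₀, ∀ b' ∈ o₁, b ≠ b' := by
        rintro b hb b' hb' rfl
        cases eq_of_append_singleton_prefix (mem_of_spillBlock hb).2.1 (mem_of_spillBlock hb').2.1
      have h1 : bs₂.length + o₀.toList.length + o₁.toList.length ≤ bs₁.length :=
        length_remove_remove_add hm₀ hm₁ hne
      have h2 : bs₁.length + next.toList.length ≤ bs.length := length_remove_add hmem
      have h3 := treeSize_place (d := P.depth N) (Function.update T (p.take i) bs₂)
        (v := p.take (i + 1)) (by rw [List.length_take]; omega) next
      have h4 := treeSize_update (d := P.depth N) T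
        (v := p.take i) (by rw [List.length_take]; omega) bs₂
      rw [hTu] at h4
      rw [hT', h3]
      omega
    have hsize' : (treeSize (P.depth N) T' : ENNReal) + o₀.toList.length + o₁.toList.length ≤
        treeSize (P.depth N) T := by exact_mod_cast hsize
    have hΓ : P.qmax ≤ s.queue.length + (o₀.toList.length + o₁.toList.length) →
        1 ≤ G Y Q := fun h => hG.one_le _ _ (by omega)
    rw [wp_bind]
    refine (wp_lOverflow?_le (Γ := G Y Q + ν * (treeSize (P.depth N) T' + o₁.toList.length)) o₀
      (fun s₁ ht₁ hq₁ => ?_) fun h => (hΓ (by dsimp only at h; omega)).trans le_self_add).trans ?_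
    · rw [wp_bind]
      dsimp only at ht₁ hq₁
      refine (wp_lOverflow?_le (Γ := G Y Q + ν * treeSize (P.depth N) T') o₁
        (fun s₂ ht₂ hq₂ => ?_) fun h => (hΓ (by omega)).trans le_self_add).trans ?_
      · have hTs : place s₂.tree (p.take (i + 1)) next = T' := by rw [ht₂, ht₁]
        have := wp_lFlushFrom_le hG hp k (i + 1) (by omega) next s₂ Y Q
          (by
            intro c
            rw [hTs]
            refine (target_flushStep_le hlt c (hcnt c) fun h1 h2 h3 => ?_).trans (hY c)
            rw [hTu] at h3
            exact cnt_pullBlock h1 h2 h3)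
          (by rw [hTs]; omega)
        rw [hTs] at this
        refine this.trans (le_of_eq ?_)
        ring
      · refine le_of_eq ?_
        ring
    · calc G Y Q + ν * (treeSize (P.depth N) T' + o₁.toList.length) +
          (O.Psi s.inner + ν * o₀.toList.length) =
          G Y Q + (O.Psi s.inner +
            ν * (treeSize (P.depth N) T' + o₀.toList.length + o₁.toList.length)) := by ring
        _ ≤ _ := by gcongr

theorem wp_lFlush_le (hG : Admissible P.qmax G) (s : LState O.L) :
    wp (lFlush P N O.acc s) (potential P N O G) ≤
      potential P N O (flushOp (P.depth N) P.ℓ G) s := by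
  unfold lFlush
  rw [wp_sample_bind]
  refine (expect_mono_support _ fun p hp => ?_).trans (le_of_eq (a :=
    expect (uniformLeaf (P.depth N)) fun p =>
      G (decLoad p (load s.tree)) (s.queue.length + overflows P.ℓ (load s.tree) p) +
        (O.Psi s.inner + ν * treeSize (P.depth N) s.tree)) ?_)
  · have hp := length_of_mem_uniformLeaf hp
    have hT : place s.tree (p.take 0) none = s.tree := by simp [place]
    have := wp_lFlushFrom_le (O := O) hG hp (P.depth N) 0 (by omega) none s
      (decLoad p (load s.tree)) (s.queue.length + overflows P.ℓ (load s.tree) p)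
      (by intro c; rw [hT, target_zero]) (by rw [hT]; simp [overflows])
    rwa [hT] at this
  · rw [expect_add, expect_const, expect_uniformLeaf]
    rfl

theorem wp_lFlushes_le (hG : Admissible P.qmax G) : ∀ (k : ℕ) (s : LState O.L),
    wp (lFlushes P N O.acc k s) (potential P N O G) ≤
      potential P N O ((flushOp (P.depth N) P.ℓ)^[k] G) s
  | 0, s => by
    unfold lFlushes
    rw [wp_pure]
    rfl
  | k + 1, s => by
    unfold lFlushes
    rw [wp_bind, Function.iterate_succ_apply']
    exact (wp_mono _ fun s' => wp_lFlushes_le hG k s').trans (wp_lFlush_le (hG.iterate k) s)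

/-- The root is a proper ancestor of all other nodes. The bound is not sharp at the root, whose load
is always zero although `incLoad` counts it. -/
theorem load_update_nil_le (tree : List Bool → List (Block Unit)) (b : Block Unit) :
    load (Function.update tree [] (b :: tree [])) ≤ incLoad b.pos (load tree) := by
  intro c
  simp only [load, incLoad]
  rcases Nat.eq_zero_or_pos c.length with h | h
  · simp [h]
  · obtain ⟨n, hn⟩ : ∃ n, c.length = n + 1 := ⟨c.length - 1, by omega⟩
    rw [hn, Finset.sum_range_succ', Finset.sum_range_succ']
    have h1 : ∑ j ∈ Finset.range n, cnt c (Function.update tree [] (b :: tree []) (c.take (j + 1))) =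
        ∑ j ∈ Finset.range n, cnt c (tree (c.take (j + 1))) := by
      refine Finset.sum_congr rfl fun j hj => ?_
      rw [Function.update_of_ne]
      intro he
      have := congrArg List.length he
      rw [List.length_take, List.length_nil] at this
      omega
    rw [h1]
    simp [cnt, List.countP_cons, List.isPrefixOf_iff_prefix, add_assoc]

/-- The extra `ν` is the prepayment for the block that enters the tree, should it overflow later. -/
theorem wp_lDequeue_le (hG : Admissible P.qmax G) (s : LState O.L) :
    wp (lDequeue P N O.acc s) (potential P N O G) ≤
      potential P N O (dequeueOp (P.depth N) P.ℓ G) s + ν := by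
  have hflush : ∀ s' : LState O.L,
      wp (sample numFlushes >>= fun k => lFlushes P N O.acc k s') (potential P N O G) ≤
        potential P N O (geomOp (P.depth N) P.ℓ G) s' := by
    intro s'
    rw [wp_sample_bind]
    refine (expect_mono _ fun k => wp_lFlushes_le hG k s').trans (le_of_eq ?_)
    unfold potential
    rw [expect_add, expect_const]
    rfl
  unfold lDequeue
  rw [wp_bind]
  refine (wp_mono _ hflush).trans ?_
  unfold lPutBack
  cases hq : s.queue with
  | nil =>
    dsimp only
    rw [wp_pure]
    unfold potential dequeueOp
    simp only [hq, List.length_nil, if_true]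
    exact le_self_add
  | cons i q =>
    dsimp only
    rw [wp_sample_bind]
    refine (expect_mono _ fun p => ?_).trans (le_of_eq (a :=
      expect (uniformLeaf (P.depth N)) fun p =>
        geomOp (P.depth N) P.ℓ G (incLoad p (load s.tree)) q.length +
          (O.Psi s.inner + ν * treeSize (P.depth N) s.tree + ν)) ?_)
    · split_ifs
      · rw [wp_throw_leaf]
        exact zero_le
      · rw [wp_pure]
        unfold potential
        refine add_le_add (hG.geomOp.mono _ _ _ _ (load_update_nil_le s.tree _) le_rfl) ?_
        have h := treeSize_update (d := P.depth N) s.tree (v := []) (by simp)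
          ((⟨i, p, fun _ => ()⟩ : Block Unit) :: s.tree [])
        have h' : treeSize (P.depth N) (Function.update s.tree []
          ((⟨i, p, fun _ => ()⟩ : Block Unit) :: s.tree [])) =
            treeSize (P.depth N) s.tree + 1 := by
          rw [List.length_cons] at h
          omega
        dsimp only
        rw [h']
        push_cast
        exact le_of_eq (by ring)
    · rw [expect_add, expect_const, expect_uniformLeaf]
      unfold potential dequeueOp
      simp only [hq, List.length_cons, Nat.add_eq_zero_iff, one_ne_zero, and_false, if_false,
        Nat.add_sub_cancel]
      ring

theorem load_filter_le (tree : List Bool → List (Block Unit)) (f : Block Unit → Bool) :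
    load (fun v => (tree v).filter f) ≤ load tree :=
  fun _ => Finset.sum_le_sum fun _ _ => (List.filter_sublist).countP_le

theorem treeSize_filter_le (d : ℕ) (tree : List Bool → List (Block Unit)) (f : Block Unit → Bool) :
    treeSize d (fun v => (tree v).filter f) ≤ treeSize d tree :=
  Finset.sum_le_sum fun _ _ => List.length_filter_le _ _

/-- Removing the fetched block can only lower loads, tree size and queue; `ν` pays for the access to
the position map. -/
theorem wp_lFetch_le (hG : Admissible P.qmax G) (i : ℕ) (s : LState O.L) :
    wp (lFetch P O.acc i s) (potential P N O G) ≤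
      potential P N O (fun X q => G X (q + 1)) s + ν := by
  unfold lFetch
  refine (wp_acc_bind_le (Γ := G (load s.tree) (s.queue.length + 1) +
    ν * treeSize (P.depth N) s.tree) fun l' => ?_).trans (le_of_eq ?_)
  · have hlen : (s.queue.filter fun j => decide (j ≠ i)).length ≤ s.queue.length :=
      List.length_filter_le _ _
    refine wp_lInsert_le ?_ fun h => ?_
    · unfold potential
      dsimp only
      have h1 : G (load fun v => (s.tree v).filter fun b => decide (b.idx ≠ i))
          ((s.queue.filter fun j => decide (j ≠ i)) ++ [i]).length ≤
          G (load s.tree) (s.queue.length + 1) := by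
        refine hG.mono _ _ _ _ (load_filter_le _ _) ?_
        rw [List.length_append, List.length_singleton]
        omega
      have h2 : (treeSize (P.depth N) (fun v => (s.tree v).filter fun b => decide (b.idx ≠ i)) :
          ENNReal) ≤ treeSize (P.depth N) s.tree := by
        exact_mod_cast treeSize_filter_le _ _ _
      calc _ ≤ G (load s.tree) (s.queue.length + 1) +
            (O.Psi l' + ν * treeSize (P.depth N) s.tree) := by gcongr
        _ = _ := by ring
    · dsimp only at h
      exact (hG.one_le _ _ (by omega)).trans le_self_add
  · unfold potential
    ring

/-- The term `3 * ν` consists of one access to the position map for `Fetch` and one prepayment for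
each of the two `Dequeue`s. -/
theorem wp_lAccess_le {G₀ G₁ G₂ : (List Bool → ℕ) → ℕ → ENNReal} {ν' : ENNReal}
    (h₀ : Admissible P.qmax G₀) (h₁ : Admissible P.qmax G₁) (h₂ : Admissible P.qmax G₂)
    (h01 : ∀ X q, dequeueOp (P.depth N) P.ℓ G₀ X q ≤ G₁ X q)
    (h12 : ∀ X q, dequeueOp (P.depth N) P.ℓ G₁ X q ≤ G₂ X q)
    (h20 : ∀ X q, G₂ X (q + 1) ≤ G₀ X q + ν') (r : ℕ) (s : LState O.L) :
    wp (lAccess P N O.acc r s) (potential P N O G₀) ≤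
      potential P N O G₀ s + (ν' + 3 * ν) := by
  have hstep : ∀ {G G' : (List Bool → ℕ) → ℕ → ENNReal}, Admissible P.qmax G →
      (∀ X q, dequeueOp (P.depth N) P.ℓ G X q ≤ G' X q) → ∀ s : LState O.L,
      wp (lDequeue P N O.acc s) (potential P N O G) ≤ ν + potential P N O G' s := by
    intro G G' hG hGG' s
    refine (wp_lDequeue_le hG s).trans ?_
    rw [add_comm]
    unfold potential
    gcongr
    exact hGG' _ _
  unfold lAccess
  rw [wp_bind]
  have hA : ∀ s₁ : LState O.L, wp (lDequeue P N O.acc s₁ >>= fun s₂ => lDequeue P N O.acc s₂)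
      (potential P N O G₀) ≤ (ν + ν) + potential P N O G₂ s₁ := by
    intro s₁
    rw [wp_bind]
    refine (wp_mono _ (hstep h₀ h01)).trans ((wp_add_const_le _ _ _).trans ?_)
    rw [add_assoc]
    exact add_le_add_right (hstep h₁ h12 s₁) _
  refine (wp_mono _ hA).trans ((wp_add_const_le _ _ _).trans
    ((add_le_add_right (wp_lFetch_le h₂ _ s) _).trans ?_))
  unfold potential
  calc _ ≤ ν + ν + (G₀ (load s.tree) s.queue.length + ν' +
        (O.Psi s.inner + ν * treeSize (P.depth N) s.tree) + ν) := by
        gcongr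
        exact h20 _ _
    _ = _ := by ring

end WP

/-- Abstract potentials that witness that `AbortQueue` has probability at most `ν` per access in a
tree of depth `d`. -/
def Bounded (d ℓ qmax : ℕ) (ν : ENNReal) : Prop :=
  ∃ G₀ G₁ G₂ : (List Bool → ℕ) → ℕ → ENNReal,
    Admissible qmax G₀ ∧ Admissible qmax G₁ ∧ Admissible qmax G₂ ∧
    (∀ X q, dequeueOp d ℓ G₀ X q ≤ G₁ X q) ∧ (∀ X q, dequeueOp d ℓ G₁ X q ≤ G₂ X q) ∧
    (∀ X q, G₂ X (q + 1) ≤ G₀ X q + ν) ∧ G₀ (fun _ => 0) 0 ≤ ν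

theorem exists_obl_oramMem {V : Type} {P : Params} {N : ℕ} {M : Mem (Option (List Bool))}
    {ν ν' : ENNReal} (hα : 0 < P.α) (v₀ : V) (hM : Nonempty (Obl M none ν))
    (h : Bounded (P.depth N) P.ℓ P.qmax ν') : Nonempty (Obl (oramMem P N M v₀) v₀ (ν' + 3 * ν)) := by
  obtain ⟨O⟩ := hM
  obtain ⟨G₀, G₁, G₂, h₀, h₁, h₂, h01, h12, h20, h00⟩ := h
  refine ⟨oramObl P N O v₀ hα (potential P N O G₀) _ (wp_lAccess_le h₀ h₁ h₂ h01 h12 h20) ?_⟩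
  unfold potential
  have hl : load (fun _ => ([] : List (Block Unit))) = fun _ => 0 := by
    funext c
    simp [load, cnt]
  have ht : treeSize (P.depth N) (fun _ => ([] : List (Block Unit))) = 0 := by simp [treeSize]
  dsimp only
  rw [hl, ht, List.length_nil, Nat.cast_zero, mul_zero, add_zero]
  refine add_le_add h00 (O.Psi_start.trans ?_)
  calc ν = 1 * ν := (one_mul _).symm
    _ ≤ 3 * ν := by gcongr; norm_num

theorem Obl.mono {V : Type} {M : Mem V} {v₀ : V} {ν ν' : ENNReal} (h : Nonempty (Obl M v₀ ν))
    (hν : ν ≤ ν') : Nonempty (Obl M v₀ ν') := by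
  obtain ⟨O⟩ := h
  exact ⟨{ O with
    step := fun r l => (O.step r l).trans (add_le_add_right hν _)
    Psi_start := O.Psi_start.trans hν }⟩

/-- The bound for a position map with `R` levels of recursion. -/
def posBound (ν : ENNReal) : ℕ → ENNReal
  | 0 => 0
  | R + 1 => ν + 3 * posBound ν R

/-- The added `ν` strengthens the statement so that the recursion becomes geometric with ratio `3`.
-/
theorem posBound_add_le (ν : ENNReal) : ∀ R, posBound ν R + ν ≤ 3 ^ R * ν
  | 0 => by simp [posBound]
  | R + 1 => by
    have ih := posBound_add_le ν R
    calc posBound ν (R + 1) + ν = 3 * posBound ν R + 2 * ν := by rw [posBound]; ring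
      _ ≤ 3 * posBound ν R + 3 * ν := by gcongr; norm_num
      _ = 3 * (posBound ν R + ν) := by ring
      _ ≤ 3 * (3 ^ R * ν) := by gcongr
      _ = 3 ^ (R + 1) * ν := by ring

theorem ceilDiv_le_self' {α n N : ℕ} (hα : 0 < α) (hN : N ≤ n) : N ⌈/⌉ α ≤ n := by
  refine le_trans ?_ hN
  rw [ceilDiv_le_iff_le_mul hα]
  exact Nat.le_mul_of_pos_left N hα

theorem exists_obl_posMem {P : Params} (hα : 0 < P.α) {ν : ENNReal}
    (h : ∀ N ≤ P.n, Bounded (P.depth N) P.ℓ P.qmax ν) : ∀ (R N : ℕ), N ≤ P.n →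
    Nonempty (Obl (posMem P R N) none (posBound ν R))
  | 0, _, _ => ⟨arrayObl none⟩
  | R + 1, N, hN => exists_obl_oramMem hα _
      (exists_obl_posMem hα h R _ (ceilDiv_le_self' hα hN)) (h N hN)

theorem exists_obl_compiledMem {P : Params} (hα : 0 < P.α) {ν : ENNReal}
    (h : ∀ N ≤ P.n, Bounded (P.depth N) P.ℓ P.qmax ν) (R : ℕ) :
    Nonempty (Obl (compiledMem P R) (zeroWord P.n) (3 ^ (R + 1) * ν)) := by
  refine Obl.mono (exists_obl_oramMem hα _
    (exists_obl_posMem hα h R _ (ceilDiv_le_self' hα le_rfl)) (h P.n le_rfl)) ?_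
  exact le_self_add.trans (posBound_add_le ν (R + 1))

end ORAM
end

noncomputable section
namespace ORAM

/-! ### Averages over levels -/

/-- The average over the nodes at depth `k`. -/
def levelAvg (k : ℕ) (f : List Bool → ℝ) : ℝ := (∑ c ∈ level k, f c) / 2 ^ k

theorem sum_level_succ {A : Type*} [AddCommMonoid A] (k : ℕ) (f : List Bool → A) :
    ∑ c ∈ level (k + 1), f c = ∑ u ∈ level k, (f (u ++ [false]) + f (u ++ [true])) := by
  have h : level (k + 1) = (level k ×ˢ (Finset.univ : Finset Bool)).image fun x => x.1 ++ [x.2] := by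
    ext c
    simp only [mem_level, Finset.mem_image, Finset.mem_product, Finset.mem_univ, and_true,
      Prod.exists]
    constructor
    · intro hc
      have hne : c ≠ [] := by
        rintro rfl
        simp at hc
      exact ⟨c.dropLast, c.getLast hne, by simp [hc], List.dropLast_append_getLast hne⟩
    · rintro ⟨u, x, hu, rfl⟩
      simp [hu]
  rw [h, Finset.sum_image, Finset.sum_product]
  · refine Finset.sum_congr rfl fun u _ => ?_
    simp [add_comm]
  · rintro ⟨u, x⟩ _ ⟨v, y⟩ _ he
    have := List.append_inj' he rfl
    simpa using this

/-- The ancestor at depth `k` of a uniform leaf is uniform. It reduces averages over paths to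
averages over one level. -/
theorem levelAvg_take {k d : ℕ} (h : k ≤ d) (f : List Bool → ℝ) :
    (levelAvg d fun p => f (p.take k)) = levelAvg k f := by
  induction d, h using Nat.le_induction with
  | base =>
    unfold levelAvg
    congr 1
    refine Finset.sum_congr rfl fun p hp => ?_
    rw [mem_level] at hp
    dsimp only
    rw [List.take_of_length_le hp.le]
  | succ d hkd ih =>
    rw [← ih]
    unfold levelAvg
    rw [sum_level_succ]
    have : ∑ u ∈ level d, (f ((u ++ [false]).take k) + f ((u ++ [true]).take k)) =
        2 * ∑ u ∈ level d, f (u.take k) := by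
      rw [Finset.mul_sum]
      refine Finset.sum_congr rfl fun u hu => ?_
      rw [mem_level] at hu
      rw [List.take_append_of_le_length (by omega), List.take_append_of_le_length (by omega)]
      ring
    rw [this, pow_succ]
    field_simp

theorem levelAvg_mono (k : ℕ) {f g : List Bool → ℝ} (h : ∀ c ∈ level k, f c ≤ g c) :
    levelAvg k f ≤ levelAvg k g := by
  unfold levelAvg
  gcongr with c hc
  exact h c hc

theorem levelAvg_const (k : ℕ) (x : ℝ) : (levelAvg k fun _ => x) = x := by
  unfold levelAvg
  rw [Finset.sum_const, card_level, nsmul_eq_mul]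
  push_cast
  field_simp

theorem levelAvg_add (k : ℕ) (f g : List Bool → ℝ) :
    (levelAvg k fun c => f c + g c) = levelAvg k f + levelAvg k g := by
  unfold levelAvg
  rw [Finset.sum_add_distrib, add_div]

theorem levelAvg_mul_left (k : ℕ) (x : ℝ) (f : List Bool → ℝ) :
    (levelAvg k fun c => x * f c) = x * levelAvg k f := by
  unfold levelAvg
  rw [← Finset.mul_sum, mul_div_assoc]

theorem levelAvg_sum {ι : Type*} (k : ℕ) (s : Finset ι) (f : ι → List Bool → ℝ) :
    (levelAvg k fun c => ∑ i ∈ s, f i c) = ∑ i ∈ s, levelAvg k (f i) := by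
  unfold levelAvg
  rw [Finset.sum_comm, Finset.sum_div]

theorem levelAvg_nonneg (k : ℕ) {f : List Bool → ℝ} (h : ∀ c ∈ level k, 0 ≤ f c) :
    0 ≤ levelAvg k f :=
  div_nonneg (Finset.sum_nonneg h) (by positivity)

theorem leafAvg_ofReal (d : ℕ) {f : List Bool → ℝ} (h : ∀ p ∈ level d, 0 ≤ f p) :
    (leafAvg d fun p => ENNReal.ofReal (f p)) = ENNReal.ofReal (levelAvg d f) := by
  unfold leafAvg levelAvg
  rw [ENNReal.ofReal_div_of_pos (by positivity), ENNReal.ofReal_sum_of_nonneg h,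
    ENNReal.ofReal_pow (by norm_num)]
  norm_num

/-! ### The potentials of a level -/

/-- The weight of a node with load `x`. -/
def wt (b : ℝ) (x : ℕ) : ℝ := 1 + b * (11 / 10) ^ x

/-- The relative weight of a node with load `x`, a number between `0` and `1`. -/
def relWt (b : ℝ) (x : ℕ) : ℝ := b * (11 / 10) ^ x / wt b x

/-- The product of the weights of the nodes at depth `k`. -/
def levelPot (b : ℝ) (k : ℕ) (X : List Bool → ℕ) : ℝ := ∏ c ∈ level k, wt b (X c)

/-- The average relative weight of the nodes at depth `k`. -/
def meanWt (b : ℝ) (k : ℕ) (X : List Bool → ℕ) : ℝ := levelAvg k fun c => relWt b (X c)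

/-- The potential of a level while paths are being flushed. -/
def flushPot (b : ℝ) (k : ℕ) (X : List Bool → ℕ) : ℝ :=
  levelPot b k X * (1 - 12 / 100 * meanWt b k X + b / 4)

section Weights

variable {b : ℝ}

theorem one_le_wt (hb : 0 ≤ b) (x : ℕ) : 1 ≤ wt b x := by
  unfold wt
  have : 0 ≤ b * (11 / 10) ^ x := by positivity
  linarith

theorem wt_pos (hb : 0 ≤ b) (x : ℕ) : 0 < wt b x := lt_of_lt_of_le one_pos (one_le_wt hb x)

theorem relWt_nonneg (hb : 0 ≤ b) (x : ℕ) : 0 ≤ relWt b x :=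
  div_nonneg (by positivity) (wt_pos hb x).le

theorem relWt_le_one (hb : 0 ≤ b) (x : ℕ) : relWt b x ≤ 1 := by
  unfold relWt
  rw [div_le_one (wt_pos hb x)]
  unfold wt
  linarith

theorem wt_mono (hb : 0 ≤ b) {x y : ℕ} (h : x ≤ y) : wt b x ≤ wt b y := by
  unfold wt
  gcongr
  norm_num

theorem one_sub_inv_wt (hb : 0 ≤ b) (x : ℕ) : relWt b x = 1 - (wt b x)⁻¹ := by
  have := (wt_pos hb x).ne'
  unfold relWt
  field_simp
  unfold wt
  ring

theorem relWt_mono (hb : 0 ≤ b) {x y : ℕ} (h : x ≤ y) : relWt b x ≤ relWt b y := by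
  rw [one_sub_inv_wt hb, one_sub_inv_wt hb]
  have := inv_anti₀ (wt_pos hb x) (wt_mono hb h)
  linarith

/-- `relWt` is the share of the weight that grows by the factor `11/10`. -/
theorem wt_succ (hb : 0 ≤ b) (x : ℕ) : wt b (x + 1) = wt b x * (1 + 1 / 10 * relWt b x) := by
  have := (wt_pos hb x).ne'
  unfold relWt
  field_simp
  unfold wt
  ring

theorem relWt_succ_le (hb : 0 ≤ b) (x : ℕ) : relWt b (x + 1) ≤ 11 / 10 * relWt b x := by
  unfold relWt
  rw [← mul_div_assoc, (by ring : 11 / 10 * (b * (11 / 10 : ℝ) ^ x) = b * (11 / 10) ^ (x + 1))]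
  exact div_le_div_of_nonneg_left (by positivity) (wt_pos hb x) (wt_mono hb (Nat.le_succ x))

/-- The correction `b` covers an empty load, which cannot decrease: there `relWt b 0 ≤ b`. -/
theorem wt_pred_le (hb : 0 ≤ b) (x : ℕ) :
    wt b (x - 1) ≤ wt b x * (1 - 1 / 11 * (relWt b x - b)) := by
  have h := wt_pos hb x
  rcases Nat.eq_zero_or_pos x with rfl | hx
  · have : relWt b 0 ≤ b := by
      unfold relWt
      rw [div_le_iff₀ h]
      have := one_le_wt hb 0
      simp only [pow_zero, mul_one]
      nlinarith
    simp only [Nat.zero_sub]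
    nlinarith
  · obtain ⟨y, rfl⟩ : ∃ y, x = y + 1 := ⟨x - 1, by omega⟩
    have h1 : wt b y = wt b (y + 1) * (1 - 1 / 11 * relWt b (y + 1)) := by
      unfold relWt
      field_simp
      unfold wt
      ring
    rw [Nat.add_sub_cancel, h1]
    nlinarith

theorem relWt_pred_ge (hb : 0 ≤ b) (x : ℕ) : 10 / 11 * relWt b x ≤ relWt b (x - 1) := by
  rcases Nat.eq_zero_or_pos x with rfl | hx
  · have := relWt_nonneg hb 0
    simp only [Nat.zero_sub]
    linarith
  · obtain ⟨y, rfl⟩ : ∃ y, x = y + 1 := ⟨x - 1, by omega⟩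
    have := relWt_succ_le hb y
    rw [Nat.add_sub_cancel]
    linarith

variable {k d : ℕ} {X Y : List Bool → ℕ}

theorem one_le_levelPot (hb : 0 ≤ b) (k : ℕ) (X : List Bool → ℕ) : 1 ≤ levelPot b k X := by
  unfold levelPot
  rw [← Finset.prod_const_one (s := level k)]
  exact Finset.prod_le_prod (fun _ _ => zero_le_one) fun c _ => one_le_wt hb _

theorem levelPot_mono (hb : 0 ≤ b) (h : X ≤ Y) : levelPot b k X ≤ levelPot b k Y :=
  Finset.prod_le_prod (fun _ _ => (wt_pos hb _).le) fun c _ => wt_mono hb (h c)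

theorem meanWt_nonneg (hb : 0 ≤ b) (k : ℕ) (X : List Bool → ℕ) : 0 ≤ meanWt b k X :=
  levelAvg_nonneg k fun _ _ => relWt_nonneg hb _

theorem meanWt_le_one (hb : 0 ≤ b) (k : ℕ) (X : List Bool → ℕ) : meanWt b k X ≤ 1 := by
  rw [← levelAvg_const k 1]
  exact levelAvg_mono k fun _ _ => relWt_le_one hb _

theorem meanWt_mono (hb : 0 ≤ b) (h : X ≤ Y) : meanWt b k X ≤ meanWt b k Y :=
  levelAvg_mono k fun c _ => relWt_mono hb (h c)

theorem decLoad_le (p : List Bool) (X : List Bool → ℕ) : decLoad p X ≤ X :=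
  fun _ => Nat.sub_le _ _

theorem le_incLoad (p : List Bool) (X : List Bool → ℕ) : X ≤ incLoad p X :=
  fun _ => Nat.le_add_right _ _

theorem meanWt_incLoad_le (hb : 0 ≤ b) (k : ℕ) (p : List Bool) (X : List Bool → ℕ) :
    meanWt b k (incLoad p X) ≤ 11 / 10 * meanWt b k X := by
  unfold meanWt
  rw [← levelAvg_mul_left]
  refine levelAvg_mono k fun c _ => le_trans (relWt_mono hb ?_) (relWt_succ_le hb _)
  unfold incLoad
  split_ifs <;> omega

theorem le_meanWt_decLoad (hb : 0 ≤ b) (k : ℕ) (p : List Bool) (X : List Bool → ℕ) :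
    10 / 11 * meanWt b k X ≤ meanWt b k (decLoad p X) := by
  unfold meanWt
  rw [← levelAvg_mul_left]
  refine levelAvg_mono k fun c _ => le_trans (relWt_pred_ge hb _) (relWt_mono hb ?_)
  unfold decLoad
  split_ifs <;> omega

theorem prefix_iff_eq_take {c p : List Bool} (hc : c.length = k) : c <+: p ↔ c = p.take k := by
  rw [List.prefix_iff_eq_take, hc]

/-- A path meets each level in one node, so a put-back or a flush changes a single factor. -/
theorem levelPot_eq_of_eq (hb : 0 ≤ b) {c : List Bool} (hc : c ∈ level k)
    (h : ∀ c' ∈ level k, c' ≠ c → Y c' = X c') :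
    levelPot b k Y = levelPot b k X * (wt b (Y c) / wt b (X c)) := by
  have hX := (wt_pos hb (X c)).ne'
  unfold levelPot
  rw [← Finset.mul_prod_erase _ _ hc, ← Finset.mul_prod_erase _ (fun c => wt b (X c)) hc]
  have : ∏ x ∈ (level k).erase c, wt b (Y x) = ∏ x ∈ (level k).erase c, wt b (X x) :=
    Finset.prod_congr rfl fun x hx => by
      rw [h x (Finset.mem_of_mem_erase hx) (Finset.ne_of_mem_erase hx)]
  rw [this]
  field_simp

theorem take_mem_level {p : List Bool} (hp : p ∈ level d) (hk : k ≤ d) : p.take k ∈ level k := by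
  rw [mem_level] at hp ⊢
  rw [List.length_take]
  omega

theorem levelPot_incLoad (hb : 0 ≤ b) (hk : k ≤ d) {p : List Bool} (hp : p ∈ level d) :
    levelPot b k (incLoad p X) = levelPot b k X * (1 + 1 / 10 * relWt b (X (p.take k))) := by
  have hc := take_mem_level hp hk
  rw [levelPot_eq_of_eq (X := X) hb hc]
  · have h1 : incLoad p X (p.take k) = X (p.take k) + 1 := by
      simp [incLoad, List.take_prefix]
    have := (wt_pos hb (X (p.take k))).ne'
    rw [h1, wt_succ hb, mul_div_cancel_left₀ _ this]
  · intro c' hc' hne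
    rw [mem_level] at hc'
    simp [incLoad, prefix_iff_eq_take hc', hne]

theorem levelPot_decLoad_le (hb : 0 ≤ b) (hk : k ≤ d) {p : List Bool} (hp : p ∈ level d) :
    levelPot b k (decLoad p X) ≤
      levelPot b k X * (1 - 1 / 11 * (relWt b (X (p.take k)) - b)) := by
  have hc := take_mem_level hp hk
  have hpos : 0 < levelPot b k X := lt_of_lt_of_le one_pos (one_le_levelPot hb k X)
  rw [levelPot_eq_of_eq (X := X) hb hc]
  · have h1 : decLoad p X (p.take k) = X (p.take k) - 1 := by
      simp [decLoad, List.take_prefix]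
    rw [h1]
    gcongr
    rw [div_le_iff₀ (wt_pos hb _), mul_comm]
    exact wt_pred_le hb _
  · intro c' hc' hne
    rw [mem_level] at hc'
    simp [decLoad, prefix_iff_eq_take hc', hne]

theorem flushPot_pos (hb : 0 ≤ b) (k : ℕ) (X : List Bool → ℕ) : 0 < flushPot b k X := by
  have h1 := one_le_levelPot hb k X
  have h2 := meanWt_le_one hb k X
  unfold flushPot
  have : 0 < 1 - 12 / 100 * meanWt b k X + b / 4 := by linarith
  positivity

theorem flushPot_le (hb : 0 ≤ b) (k : ℕ) (X : List Bool → ℕ) :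
    flushPot b k X ≤ levelPot b k X * (1 - meanWt b k X / 50 + b / 2) := by
  have h1 := one_le_levelPot hb k X
  have h2 := meanWt_nonneg hb k X
  unfold flushPot
  gcongr <;> linarith

/-- The effect of a `Put-Back` on the potential of a level. -/
theorem levelAvg_flushPot_incLoad_le (hb : 0 ≤ b) (hk : k ≤ d) (X : List Bool → ℕ) :
    (levelAvg d fun p => flushPot b k (incLoad p X)) ≤
      levelPot b k X * (1 - meanWt b k X / 50 + b / 2) := by
  have hpot := one_le_levelPot hb k X
  have hm0 := meanWt_nonneg hb k X
  have hm1 := meanWt_le_one hb k X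
  have h1 : ∀ p ∈ level d, flushPot b k (incLoad p X) ≤
      levelPot b k X * (1 - 12 / 100 * meanWt b k X + b / 4) *
        (1 + 1 / 10 * relWt b (X (p.take k))) := by
    intro p hp
    have h2 := meanWt_mono (k := k) hb (le_incLoad p X)
    have h3 := relWt_nonneg hb (X (p.take k))
    unfold flushPot
    rw [levelPot_incLoad hb hk hp, mul_assoc, mul_assoc, mul_comm (1 - _ + _)]
    gcongr
  refine (levelAvg_mono d h1).trans ?_
  rw [levelAvg_mul_left, levelAvg_take hk fun c => 1 + 1 / 10 * relWt b (X c), levelAvg_add,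
    levelAvg_const, levelAvg_mul_left, mul_assoc]
  change levelPot b k X * (_ * (1 + 1 / 10 * meanWt b k X)) ≤ _
  gcongr
  -- With `m` the mean weight, the put-back gains `m / 10`, while the prefactor of `flushPot` has
  -- reserved `12/100 * m`; a decrease of `m / 50` remains.
  nlinarith

/-- The effect of a coin that is followed by a `Flush` with probability `2/3`. -/
theorem flushPot_step (hb : 0 ≤ b) (hb1 : b ≤ 1) (hk : k ≤ d) (X : List Bool → ℕ)
    {o : List Bool → ℝ} (ho : ∀ c, 1 ≤ o c)
    (hoa : (levelAvg k fun c => o c - 1) ≤ meanWt b k X / 200) :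
    1 / 3 * levelPot b k X +
      2 / 3 * (levelAvg d fun p => o (p.take k) * flushPot b k (decLoad p X)) ≤
      flushPot b k X := by
  have hpot := one_le_levelPot hb k X
  have hm0 := meanWt_nonneg hb k X
  have hm1 := meanWt_le_one hb k X
  -- Here `12/110 = 12/100 * 10/11`, since a flush lowers the mean weight by at most the factor
  -- `10/11`.
  have hA : 0 ≤ 1 - 12 / 110 * meanWt b k X + b / 4 := by linarith
  have h1 : ∀ p ∈ level d, o (p.take k) * flushPot b k (decLoad p X) ≤
      levelPot b k X * (1 - 12 / 110 * meanWt b k X + b / 4) *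
        ((1 + 1 / 11 * b) + -(1 / 11) * relWt b (X (p.take k)) + (o (p.take k) - 1)) := by
    intro p hp
    set c := p.take k
    have h2 := le_meanWt_decLoad hb k p X
    have h3 := levelPot_decLoad_le (X := X) hb hk hp
    have h4 : levelPot b k (decLoad p X) ≤ levelPot b k X := levelPot_mono hb (decLoad_le p X)
    have h5 := one_le_levelPot hb k (decLoad p X)
    have h6 := ho c
    have h7 : flushPot b k (decLoad p X) ≤
        levelPot b k (decLoad p X) * (1 - 12 / 110 * meanWt b k X + b / 4) := by
      unfold flushPot
      exact mul_le_mul_of_nonneg_left (by linarith) (by linarith)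
    have h8 : o c * levelPot b k (decLoad p X) ≤ levelPot b k X *
        ((1 + 1 / 11 * b) + -(1 / 11) * relWt b (X c) + (o c - 1)) := by
      have : (o c - 1) * levelPot b k (decLoad p X) ≤ (o c - 1) * levelPot b k X := by
        gcongr
      linarith
    calc o c * flushPot b k (decLoad p X)
        ≤ o c * (levelPot b k (decLoad p X) * (1 - 12 / 110 * meanWt b k X + b / 4)) := by gcongr
      _ = o c * levelPot b k (decLoad p X) * (1 - 12 / 110 * meanWt b k X + b / 4) := by ring
      _ ≤ levelPot b k X * ((1 + 1 / 11 * b) + -(1 / 11) * relWt b (X c) + (o c - 1)) *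
          (1 - 12 / 110 * meanWt b k X + b / 4) := by gcongr
      _ = _ := by ring
  have h9 : (levelAvg d fun p => o (p.take k) * flushPot b k (decLoad p X)) ≤
      levelPot b k X * (1 - 12 / 110 * meanWt b k X + b / 4) *
        ((1 + 1 / 11 * b) + -(1 / 11) * meanWt b k X + meanWt b k X / 200) := by
    refine (levelAvg_mono d h1).trans ?_
    rw [levelAvg_mul_left, levelAvg_take hk fun c =>
      (1 + 1 / 11 * b) + -(1 / 11) * relWt b (X c) + (o c - 1), levelAvg_add, levelAvg_add,
      levelAvg_const, levelAvg_mul_left]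
    exact mul_le_mul_of_nonneg_left (add_le_add le_rfl hoa) (mul_nonneg (by linarith) hA)
  -- To first order, the mean weight gains the coefficient `2/3 * (12/110 + 1/11 - 1/200) > 12/100`,
  -- and `b` has the coefficient `2/3 * (1/4 + 1/11) < 1/4`. The `1/200` is what the overflows may
  -- cost.
  have h10 : 1 / 3 + 2 / 3 * ((1 - 12 / 110 * meanWt b k X + b / 4) *
      ((1 + 1 / 11 * b) + -(1 / 11) * meanWt b k X + meanWt b k X / 200)) ≤
      1 - 12 / 100 * meanWt b k X + b / 4 := by
    nlinarith [mul_nonneg hb hm0, mul_nonneg hb (sub_nonneg.2 hb1),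
      mul_nonneg hm0 (sub_nonneg.2 hm1)]
  have h11 : flushPot b k X = levelPot b k X * (1 - 12 / 100 * meanWt b k X + b / 4) := rfl
  rw [h11]
  nlinarith

end Weights

end ORAM
end

noncomputable section
namespace ORAM

/-! ### Overflows and the number of flushes -/

/-- An overloaded child has `b * 1.1 ^ x ≥ 1`, hence relative weight at least `1/2`. A parent has
two children, so averaging over parents doubles the average over children; together this gives the
factor `4`. -/
theorem levelAvg_kids_le {b : ℝ} (hb : 0 ≤ b) {ℓ : ℕ}
    (hℓ : ∀ x : ℕ, ℓ ≤ 2 * x → 1 ≤ b * (11 / 10) ^ x) (t : ℕ) (X : List Bool → ℕ) :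
    (levelAvg (t + 1) fun c => (kids ℓ X (c.take t) : ℝ)) ≤ 4 * meanWt b (t + 1) X := by
  have hind : ∀ c, ((if ℓ ≤ 2 * X c then 1 else 0 : ℕ) : ℝ) ≤ 2 * relWt b (X c) := by
    intro c
    split_ifs with h
    · have h1 := hℓ _ h
      unfold relWt
      rw [← mul_div_assoc, le_div_iff₀ (wt_pos hb _)]
      unfold wt
      push_cast
      linarith
    · have := relWt_nonneg hb (X c)
      push_cast
      linarith
  rw [levelAvg_take (Nat.le_succ t) fun u => (kids ℓ X u : ℝ)]
  unfold meanWt levelAvg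
  rw [sum_level_succ, pow_succ, ← mul_div_assoc, div_le_div_iff₀ (by positivity) (by positivity)]
  have : ∑ u ∈ level t, (kids ℓ X u : ℝ) ≤
      2 * ∑ u ∈ level t, (relWt b (X (u ++ [false])) + relWt b (X (u ++ [true]))) := by
    rw [Finset.mul_sum]
    refine Finset.sum_le_sum fun u _ => ?_
    have h1 := hind (u ++ [false])
    have h2 := hind (u ++ [true])
    unfold kids
    push_cast at h1 h2 ⊢
    linarith
  have h2 : (0 : ℝ) < 2 ^ t := by positivity
  nlinarith

theorem kids_le_two (ℓ : ℕ) (X : List Bool → ℕ) (u : List Bool) : kids ℓ X u ≤ 2 := by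
  unfold kids
  split_ifs <;> omega

/-- The base `1601/1600` is close enough to `1` that an overflow costs at most `1/800` per child, so
that the total `4/800` stays within the surplus of the drift. -/
theorem levelAvg_pow_kids_le {b : ℝ} (hb : 0 ≤ b) {ℓ : ℕ}
    (hℓ : ∀ x : ℕ, ℓ ≤ 2 * x → 1 ≤ b * (11 / 10) ^ x) (t : ℕ) (X : List Bool → ℕ) :
    (levelAvg (t + 1) fun c => (1601 / 1600 : ℝ) ^ kids ℓ X (c.take t) - 1) ≤
      meanWt b (t + 1) X / 200 := by
  have h1 : ∀ k : ℕ, k ≤ 2 → (1601 / 1600 : ℝ) ^ k - 1 ≤ 1 / 800 * k := by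
    intro k hk
    interval_cases k <;> norm_num
  refine (levelAvg_mono (t + 1) fun c _ => h1 _ (kids_le_two ℓ X (c.take t))).trans ?_
  rw [levelAvg_mul_left]
  have := levelAvg_kids_le hb hℓ t X
  linarith

theorem expect_numFlushes (f : ℕ → ENNReal) :
    expect numFlushes f = ∑' k, (2 / 3) ^ k * (1 / 3) * f k := rfl

theorem leafAvg_mul_left (d : ℕ) (x : ENNReal) (f : List Bool → ENNReal) :
    (leafAvg d fun p => x * f p) = x * leafAvg d f := by
  unfold leafAvg
  rw [← Finset.mul_sum, mul_div_assoc]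

theorem leafAvg_sum {ι : Type*} (d : ℕ) (s : Finset ι) (f : ι → List Bool → ENNReal) :
    (leafAvg d fun p => ∑ i ∈ s, f i p) = ∑ i ∈ s, leafAvg d (f i) := by
  unfold leafAvg
  simp_rw [ENNReal.div_eq_inv_mul]
  rw [Finset.sum_comm, Finset.mul_sum]

/-- A function that decreases on average, when a coin decides between stopping and a `Flush`, bounds
the effect of a geometrically distributed number of `Flush`es. -/
theorem geomOp_le {d ℓ : ℕ} {Good : (List Bool → ℕ) → Prop}
    (hdec : ∀ X p, Good X → Good (decLoad p X)) {G H : (List Bool → ℕ) → ℕ → ENNReal}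
    (h : ∀ X q, Good X → 1 / 3 * G X q + 2 / 3 * flushOp d ℓ H X q ≤ H X q)
    {X : List Bool → ℕ} (hX : Good X) (q : ℕ) : geomOp d ℓ G X q ≤ H X q := by
  -- Truncating the number of flushes permits an induction that splits off the first coin.
  have key : ∀ n X q, Good X →
      ∑ k ∈ Finset.range n, (2 / 3) ^ k * (1 / 3) * (flushOp d ℓ)^[k] G X q ≤ H X q := by
    intro n
    induction n with
    | zero => intro X q _; simp
    | succ n ih =>
      intro X q hX
      refine le_trans ?_ (h X q hX)
      rw [Finset.sum_range_succ', add_comm]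
      simp only [Function.iterate_succ_apply']
      refine add_le_add (le_of_eq (by simp)) ?_
      have h1 : ∑ k ∈ Finset.range n,
          (2 / 3) ^ (k + 1) * (1 / 3) * flushOp d ℓ ((flushOp d ℓ)^[k] G) X q =
          2 / 3 * leafAvg d fun p => ∑ k ∈ Finset.range n, (2 / 3) ^ k * (1 / 3) *
            (flushOp d ℓ)^[k] G (decLoad p X) (q + overflows ℓ X p) := by
        rw [leafAvg_sum, Finset.mul_sum]
        refine Finset.sum_congr rfl fun k _ => ?_
        rw [leafAvg_mul_left, pow_succ]
        unfold flushOp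
        ring
      rw [h1]
      gcongr
      exact leafAvg_mono d fun p _ => ih _ _ (hdec X p hX)
  unfold geomOp
  rw [expect_numFlushes]
  exact ENNReal.tsum_le_of_sum_range_le fun n => key n X q hX

theorem geomOp_le_one {d ℓ : ℕ} {G : (List Bool → ℕ) → ℕ → ENNReal} (h : ∀ X q, G X q ≤ 1)
    (X : List Bool → ℕ) (q : ℕ) : geomOp d ℓ G X q ≤ 1 := by
  have h1 : ∀ k X q, (flushOp d ℓ)^[k] G X q ≤ 1 := by
    intro k
    induction k with
    | zero => exact h
    | succ k ih =>
      intro X q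
      rw [Function.iterate_succ_apply']
      rw [← leafAvg_const d 1]
      exact leafAvg_mono d fun p _ => ih _ _
  rw [← expect_const numFlushes 1]
  exact expect_mono _ fun k => h1 k X q

theorem dequeueOp_le_one {d ℓ : ℕ} {G : (List Bool → ℕ) → ℕ → ENNReal} (h : ∀ X q, G X q ≤ 1)
    (X : List Bool → ℕ) (q : ℕ) : dequeueOp d ℓ G X q ≤ 1 := by
  unfold dequeueOp
  split_ifs
  · exact geomOp_le_one h X 0
  · rw [← leafAvg_const d 1]
    exact leafAvg_mono d fun p _ => geomOp_le_one h _ _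

/-! ### The weighted inequality between the means -/

/-- The weights `1 / (d + 1)` are completed by one spare factor `1`, which also covers `d = 0`. The
factors of different levels depend on the same path; the sum on the right can be averaged level by
level. -/
theorem prod_rpow_le {d : ℕ} {x : ℕ → ℝ} (hx : ∀ t < d, 0 ≤ x t) :
    ∏ t ∈ Finset.range d, x t ^ (1 / ((d : ℝ) + 1)) ≤
      1 + 1 / ((d : ℝ) + 1) * ∑ t ∈ Finset.range d, (x t - 1) := by
  have hm : (0 : ℝ) < d + 1 := by positivity
  have h := Real.geom_mean_le_arith_mean_weighted (Finset.range (d + 1))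
    (fun _ => 1 / ((d : ℝ) + 1)) (fun t => if t < d then x t else 1)
    (fun _ _ => by positivity) (by rw [Finset.sum_const]; simp; field_simp)
    (fun t _ => by split_ifs with h; exacts [hx t h, zero_le_one])
  rw [Finset.prod_range_succ, Finset.sum_range_succ] at h
  simp only [lt_irrefl, if_false, Real.one_rpow, mul_one] at h
  have h1 : ∀ {A : Type} [CommMonoid A] (f : ℝ → A), ∏ t ∈ Finset.range d, f (if t < d then x t else 1) =
      ∏ t ∈ Finset.range d, f (x t) := fun f =>
    Finset.prod_congr rfl fun t ht => by rw [if_pos (Finset.mem_range.1 ht)]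
  rw [h1 fun y => y ^ (1 / ((d : ℝ) + 1))] at h
  refine h.trans (le_of_eq ?_)
  rw [← Finset.mul_sum, Finset.sum_sub_distrib, Finset.sum_congr rfl fun t ht =>
    if_pos (Finset.mem_range.1 ht)]
  simp
  field_simp
  ring

end ORAM
end

noncomputable section
namespace ORAM

/-! ### Exponential sums of the loads of a level -/

/-- The exponential sum of the loads of the nodes at depth `k`. -/
def expSum (k : ℕ) (X : List Bool → ℕ) : ℝ := ∑ c ∈ level k, (11 / 10 : ℝ) ^ X c

/-- The analogue of `flushPot` for `expSum`. -/
def expFlush (k : ℕ) (X : List Bool → ℕ) : ℝ := (1 + 2 / (11 * 2 ^ k))⁻¹ * expSum k X + 2 / 11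

section ExpSum

variable {k d : ℕ} {X Y : List Bool → ℕ}

theorem expSum_nonneg (k : ℕ) (X : List Bool → ℕ) : 0 ≤ expSum k X :=
  Finset.sum_nonneg fun _ _ => by positivity

theorem expSum_mono (h : X ≤ Y) : expSum k X ≤ expSum k Y :=
  Finset.sum_le_sum fun c _ => pow_le_pow_right₀ (by norm_num) (h c)

theorem expFlush_nonneg (k : ℕ) (X : List Bool → ℕ) : 0 ≤ expFlush k X := by
  have := expSum_nonneg k X
  unfold expFlush
  positivity

theorem expFlush_le (k : ℕ) (X : List Bool → ℕ) : expFlush k X ≤ expSum k X + 1 := by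
  have h := expSum_nonneg k X
  have h1 : (1 + 2 / (11 * 2 ^ k) : ℝ)⁻¹ ≤ 1 := inv_le_one_of_one_le₀ (by
    have : (0 : ℝ) ≤ 2 / (11 * 2 ^ k) := by positivity
    linarith)
  unfold expFlush
  nlinarith

theorem expSum_eq_of_eq {c : List Bool} (hc : c ∈ level k)
    (h : ∀ c' ∈ level k, c' ≠ c → Y c' = X c') :
    expSum k Y = expSum k X + ((11 / 10) ^ Y c - (11 / 10) ^ X c) := by
  unfold expSum
  rw [← Finset.add_sum_erase _ _ hc, ← Finset.add_sum_erase _ (fun c => (11 / 10 : ℝ) ^ X c) hc]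
  have : ∑ x ∈ (level k).erase c, (11 / 10 : ℝ) ^ Y x = ∑ x ∈ (level k).erase c, (11 / 10) ^ X x :=
    Finset.sum_congr rfl fun x hx => by
      rw [h x (Finset.mem_of_mem_erase hx) (Finset.ne_of_mem_erase hx)]
  rw [this]
  ring

theorem expSum_incLoad (hk : k ≤ d) {p : List Bool} (hp : p ∈ level d) :
    expSum k (incLoad p X) = expSum k X + 1 / 10 * (11 / 10) ^ X (p.take k) := by
  rw [expSum_eq_of_eq (X := X) (take_mem_level hp hk)]
  · have h1 : incLoad p X (p.take k) = X (p.take k) + 1 := by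
      simp [incLoad, List.take_prefix]
    rw [h1]
    ring
  · intro c' hc' hne
    rw [mem_level] at hc'
    simp [incLoad, prefix_iff_eq_take hc', hne]

theorem expSum_decLoad_le (hk : k ≤ d) {p : List Bool} (hp : p ∈ level d) :
    expSum k (decLoad p X) ≤ expSum k X + (1 / 11 + -(1 / 11) * (11 / 10) ^ X (p.take k)) := by
  rw [expSum_eq_of_eq (X := X) (take_mem_level hp hk)]
  · have h1 : decLoad p X (p.take k) = X (p.take k) - 1 := by
      simp [decLoad, List.take_prefix]
    rw [h1]
    cases X (p.take k) with
    | zero => norm_num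
    | succ x =>
      rw [Nat.add_sub_cancel, pow_succ]
      linarith
  · intro c' hc' hne
    rw [mem_level] at hc'
    simp [decLoad, prefix_iff_eq_take hc', hne]

/-- The prefactor of `expFlush` absorbs the growth by the factor `1 + 1 / (10 * 2 ^ k)` because
`1/10 ≤ 2/11`. -/
theorem levelAvg_expFlush_incLoad_le (hk : k ≤ d) (X : List Bool → ℕ) :
    (levelAvg d fun p => expFlush k (incLoad p X)) ≤ expSum k X + 1 := by
  have h0 := expSum_nonneg k X
  have hr : (0 : ℝ) < 2 ^ k := by positivity
  have h1 : (levelAvg d fun p => expFlush k (incLoad p X)) =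
      (1 + 2 / (11 * 2 ^ k))⁻¹ * (expSum k X + 1 / 10 * (expSum k X / 2 ^ k)) + 2 / 11 := by
    have : (levelAvg d fun p => expFlush k (incLoad p X)) = levelAvg d fun p =>
        (1 + 2 / (11 * 2 ^ k))⁻¹ * (expSum k X + 1 / 10 * (11 / 10) ^ X (p.take k)) + 2 / 11 := by
      unfold levelAvg expFlush
      congr 1
      exact Finset.sum_congr rfl fun p hp => by
        dsimp only
        rw [expSum_incLoad hk hp]
    rw [this, levelAvg_add, levelAvg_mul_left, levelAvg_add, levelAvg_const, levelAvg_const,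
      levelAvg_mul_left, levelAvg_take hk fun c => (11 / 10 : ℝ) ^ X c]
    rfl
  have h2 : (1 + 2 / (11 * 2 ^ k) : ℝ)⁻¹ * (expSum k X + 1 / 10 * (expSum k X / 2 ^ k)) ≤
      expSum k X := by
    rw [inv_mul_le_iff₀ (by positivity)]
    have : expSum k X / 2 ^ k ≥ 0 := by positivity
    have h3 : (1 + 2 / (11 * 2 ^ k)) * expSum k X = expSum k X + 2 / 11 * (expSum k X / 2 ^ k) := by
      field_simp
    rw [h3]
    linarith
  linarith

/-- Stopping loses the prefactor, a cost `1/3 * 2/11` per unit of `u * expSum / 2 ^ k`; a flush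
gains `2/3 * 1/11` of the same quantity. These cancel exactly, and the additive `2/11` covers empty
loads. -/
theorem expFlush_step (hk : k ≤ d) (X : List Bool → ℕ) :
    1 / 3 * expSum k X + 2 / 3 * (levelAvg d fun p => expFlush k (decLoad p X)) ≤
      expFlush k X := by
  have h0 := expSum_nonneg k X
  have hr : (0 : ℝ) < 2 ^ k := by positivity
  set u : ℝ := (1 + 2 / (11 * 2 ^ k))⁻¹ with hu
  have hu0 : 0 ≤ u := by positivity
  have hu1 : u ≤ 1 := inv_le_one_of_one_le₀ (by
    have : (0 : ℝ) ≤ 2 / (11 * 2 ^ k) := by positivity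
    linarith)
  have h1 : (levelAvg d fun p => expFlush k (decLoad p X)) ≤
      u * (expSum k X + (1 / 11 + -(1 / 11) * (expSum k X / 2 ^ k))) + 2 / 11 := by
    refine (levelAvg_mono d fun p hp => ?_ : _ ≤ levelAvg d fun p =>
      u * (expSum k X + (1 / 11 + -(1 / 11) * (11 / 10) ^ X (p.take k))) + 2 / 11).trans ?_
    · unfold expFlush
      have := mul_le_mul_of_nonneg_left (expSum_decLoad_le (X := X) hk hp) hu0
      linarith
    · rw [levelAvg_add, levelAvg_mul_left, levelAvg_add, levelAvg_add, levelAvg_const,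
        levelAvg_const, levelAvg_const, levelAvg_mul_left,
        levelAvg_take hk fun c => (11 / 10 : ℝ) ^ X c]
      exact le_rfl
  have h2 : expSum k X = u * expSum k X + 2 / 11 * (u * (expSum k X / 2 ^ k)) := by
    have : u * (1 + 2 / (11 * 2 ^ k)) = 1 := by
      rw [hu]
      exact inv_mul_cancel₀ (by positivity)
    calc expSum k X = u * (1 + 2 / (11 * 2 ^ k)) * expSum k X := by rw [this, one_mul]
      _ = _ := by field_simp
  have h3 : expFlush k X = u * expSum k X + 2 / 11 := rfl
  rw [h3]
  nlinarith

end ExpSum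

/-! ### Logarithms of the potentials -/

section Log

variable {b M : ℝ} {k d : ℕ} {X : List Bool → ℕ}

theorem relWt_le_log_wt (hb : 0 ≤ b) (x : ℕ) : relWt b x ≤ Real.log (wt b x) := by
  have h := Real.one_sub_inv_le_log_of_pos (wt_pos hb x)
  rwa [← one_sub_inv_wt hb] at h

/-- For a weight `w`, `log w ≤ w - 1` gives `log w ≤ (1 - 1 / w) * (1 + log w)`, and the cap on the
load bounds `log w` by `1 + M`. -/
theorem log_wt_le (hb : 0 ≤ b) (hb1 : b ≤ 1) (hM : 0 ≤ M) {x : ℕ}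
    (hx : (11 / 10 : ℝ) ^ x ≤ Real.exp M) : Real.log (wt b x) ≤ (2 + M) * relWt b x := by
  have hw := wt_pos hb x
  have h1 : Real.log (wt b x) ≤ 1 + M := by
    rw [Real.log_le_iff_le_exp hw, Real.exp_add]
    have h2 := Real.add_one_le_exp 1
    have h3 := Real.one_le_exp hM
    have h4 : b * (11 / 10) ^ x ≤ 1 * Real.exp M := by gcongr
    unfold wt
    nlinarith
  have h2 := Real.log_le_sub_one_of_pos hw
  have h3 : Real.log (wt b x) ≤ relWt b x * (1 + Real.log (wt b x)) := by
    rw [one_sub_inv_wt hb]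
    have : (wt b x)⁻¹ * (1 + Real.log (wt b x)) ≤ 1 := by
      rw [inv_mul_le_iff₀ hw]
      linarith
    linarith
  have := relWt_nonneg hb x
  nlinarith

theorem log_levelPot (hb : 0 ≤ b) (k : ℕ) (X : List Bool → ℕ) :
    Real.log (levelPot b k X) = ∑ c ∈ level k, Real.log (wt b (X c)) :=
  Real.log_prod fun _ _ => (wt_pos hb _).ne'

theorem sum_relWt (b : ℝ) (k : ℕ) (X : List Bool → ℕ) :
    ∑ c ∈ level k, relWt b (X c) = 2 ^ k * meanWt b k X := by
  unfold meanWt levelAvg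
  field_simp

theorem meanWt_le_log_levelPot (hb : 0 ≤ b) (k : ℕ) (X : List Bool → ℕ) :
    2 ^ k * meanWt b k X ≤ Real.log (levelPot b k X) := by
  rw [log_levelPot hb, ← sum_relWt]
  exact Finset.sum_le_sum fun c _ => relWt_le_log_wt hb _

theorem log_levelPot_le (hb : 0 ≤ b) (hb1 : b ≤ 1) (hM : 0 ≤ M)
    (hX : ∀ c ∈ level k, (11 / 10 : ℝ) ^ X c ≤ Real.exp M) :
    Real.log (levelPot b k X) ≤ (2 + M) * (2 ^ k * meanWt b k X) := by
  rw [log_levelPot hb, ← sum_relWt, Finset.mul_sum]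
  exact Finset.sum_le_sum fun c hc => log_wt_le hb hb1 hM (hX c hc)

/-- The logarithm of the bound for the potential at depth `k`. -/
def potBound (b M : ℝ) (k : ℕ) : ℝ := (2 + M) * (25 * b * 2 ^ k) + M

/-- If the mean weight is at least `25 * b`, its decrease `/ 50` beats the increase `b / 2`.
Otherwise the potential itself is so small that after scaling by `exp (-potBound)` it is at most
`exp (-M)`. -/
theorem levelPot_mul_le (hb : 0 ≤ b) (hb1 : b ≤ 1) (hM : 0 ≤ M)
    (hX : ∀ c ∈ level k, (11 / 10 : ℝ) ^ X c ≤ Real.exp M) :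
    Real.exp (-potBound b M k) * (levelPot b k X * (1 - meanWt b k X / 50 + b / 2)) ≤
      Real.exp (-potBound b M k) * levelPot b k X + 2 * Real.exp (-M) := by
  have hpos := one_le_levelPot hb k X
  have hm := meanWt_nonneg hb k X
  rcases le_total (25 * b) (meanWt b k X) with h | h
  · have h1 : levelPot b k X * (1 - meanWt b k X / 50 + b / 2) ≤ levelPot b k X :=
      mul_le_of_le_one_right (by linarith) (by linarith)
    have h2 := mul_le_mul_of_nonneg_left h1 (Real.exp_nonneg (-potBound b M k))
    have := Real.exp_nonneg (-M)
    linarith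
  · have h1 : levelPot b k X ≤ Real.exp ((2 + M) * (25 * b * 2 ^ k)) := by
      rw [← Real.log_le_iff_le_exp (by linarith)]
      refine (log_levelPot_le hb hb1 hM hX).trans ?_
      rw [mul_comm (25 * b)]
      gcongr
    have h2 : Real.exp (-potBound b M k) * levelPot b k X ≤ Real.exp (-M) := by
      calc _ ≤ Real.exp (-potBound b M k) * Real.exp ((2 + M) * (25 * b * 2 ^ k)) := by gcongr
        _ = Real.exp (-M) := by
          rw [← Real.exp_add]
          unfold potBound
          congr 1
          ring
    have h3 : levelPot b k X * (1 - meanWt b k X / 50 + b / 2) ≤ levelPot b k X * 2 := by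
      gcongr
      linarith
    have h4 := mul_le_mul_of_nonneg_left h3 (Real.exp_nonneg (-potBound b M k))
    have := mul_nonneg (Real.exp_nonneg (-potBound b M k)) (by linarith : 0 ≤ levelPot b k X)
    linarith

end Log

end ORAM
end

noncomputable section
namespace ORAM

/-! ### The potential of a tree with its queue -/

/-- The constants on which the potential of a tree of depth `d` depends. -/
structure Scale where
  d : ℕ
  ℓ : ℕ
  qmax : ℕ
  b : ℝ
  M : ℝ
  D : ℝ

namespace Scale

variable (A : Scale)

/-- The price of an element of the queue, before it is divided by the number of levels. -/
def price : ℝ := Real.log (1601 / 1600)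

/-- The bound for the average relative weight of a level with more than `D` nodes. -/
def wtBound : ℝ := 11 / 10 * ((2 + A.M) * (25 * A.b) + A.M / A.D)

/-- The factor by which a `Dequeue` changes the potential of the queue. -/
def rate : ℝ := Real.exp (-(price / (A.d + 1))) * ((1 + A.wtBound) * (1 + A.b / 2))

/-- The bound for the potential of an empty queue. -/
def idle : ℝ := 2 * Real.exp (price * (2 - A.qmax) / (A.d + 1) +
  ((2 + A.M) * (25 * A.b * A.D) + A.M + 1))

/-- The potential of a level with at most `D` nodes. -/
def low (t : ℕ) (X : List Bool → ℕ) : ℝ :=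
  if (2 : ℝ) ^ (t + 1) ≤ A.D then levelPot A.b (t + 1) X else 1

/-- The potential of a level with at most `D` nodes while paths are being flushed. -/
def lowFlush (t : ℕ) (X : List Bool → ℕ) : ℝ :=
  if (2 : ℝ) ^ (t + 1) ≤ A.D then flushPot A.b (t + 1) X else 1

/-- The potential of the queue. -/
def queuePot (X : List Bool → ℕ) (q : ℕ) : ℝ :=
  Real.exp (price * (q + 2 - A.qmax) / (A.d + 1)) *
    ∏ t ∈ Finset.range A.d, A.low t X ^ (1 / ((A.d : ℝ) + 1))

/-- The potential of the queue while paths are being flushed. -/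
def queueFlush (X : List Bool → ℕ) (q : ℕ) : ℝ :=
  (1 + A.wtBound) * (Real.exp (price * (q + 2 - A.qmax) / (A.d + 1)) *
    ∏ t ∈ Finset.range A.d, A.lowFlush t X ^ (1 / ((A.d : ℝ) + 1)))

/-- The potential of the tree; it is small unless the loads are exceptionally large. -/
def treePot (X : List Bool → ℕ) : ℝ :=
  ∑ t ∈ Finset.range A.d, (Real.exp (-A.M) * expSum (t + 1) X +
    Real.exp (-potBound A.b A.M (t + 1)) * levelPot A.b (t + 1) X)

/-- The potential of the tree while paths are being flushed. -/
def treeFlush (X : List Bool → ℕ) : ℝ :=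
  ∑ t ∈ Finset.range A.d, (Real.exp (-A.M) * expFlush (t + 1) X +
    Real.exp (-potBound A.b A.M (t + 1)) * flushPot A.b (t + 1) X)

/-- The loads of the large levels are unexceptional. -/
def Good (X : List Bool → ℕ) : Prop :=
  ∀ t < A.d, A.D < 2 ^ (t + 1) → meanWt A.b (t + 1) X ≤ A.wtBound

/-- The conditions on the constants. -/
structure Valid : Prop where
  b_nonneg : 0 ≤ A.b
  b_le : A.b ≤ 1
  M_nonneg : 0 ≤ A.M
  D_pos : 0 < A.D
  load : ∀ x : ℕ, A.ℓ ≤ 2 * x → 1 ≤ A.b * (11 / 10) ^ x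
  wtBound_le : A.wtBound ≤ 1
  rate_le : Real.exp (price / (A.d + 1)) * A.rate ^ 2 ≤ 1

theorem price_nonneg : 0 ≤ price := Real.log_nonneg (by norm_num)

theorem exp_price_mul (k : ℕ) : Real.exp (price * k) = (1601 / 1600) ^ k := by
  rw [mul_comm, Real.exp_nat_mul, price, Real.exp_log (by norm_num)]

theorem levelAvg_treeFlush (g : List Bool → List Bool → ℕ) :
    (levelAvg A.d fun p => A.treeFlush (g p)) = ∑ t ∈ Finset.range A.d,
      (Real.exp (-A.M) * (levelAvg A.d fun p => expFlush (t + 1) (g p)) +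
        Real.exp (-potBound A.b A.M (t + 1)) *
          levelAvg A.d fun p => flushPot A.b (t + 1) (g p)) := by
  unfold treeFlush
  rw [levelAvg_sum]
  refine Finset.sum_congr rfl fun t _ => ?_
  rw [levelAvg_add, levelAvg_mul_left, levelAvg_mul_left]

variable {A} (hA : A.Valid) {X Y : List Bool → ℕ}
include hA

theorem wtBound_nonneg : 0 ≤ A.wtBound := by
  have h1 := hA.b_nonneg
  have h2 := hA.M_nonneg
  have h3 := hA.D_pos
  unfold wtBound
  positivity

theorem le_rate : Real.exp (-(price / (A.d + 1))) ≤ A.rate := by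
  have h1 := hA.b_nonneg
  have h2 := wtBound_nonneg hA
  unfold rate
  exact le_mul_of_one_le_right (Real.exp_nonneg _) (by nlinarith)

theorem rate_nonneg : 0 ≤ A.rate := (Real.exp_nonneg _).trans (le_rate hA)

theorem rate_le_one : A.rate ≤ 1 := by
  have h1 := hA.rate_le
  have h2 : 1 ≤ Real.exp (price / (A.d + 1)) :=
    Real.one_le_exp (div_nonneg price_nonneg (by positivity))
  nlinarith [rate_nonneg hA]

theorem one_le_low (t : ℕ) (X : List Bool → ℕ) : 1 ≤ A.low t X := by
  unfold low
  split_ifs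
  exacts [one_le_levelPot hA.b_nonneg _ _, le_rfl]

theorem lowFlush_pos (t : ℕ) (X : List Bool → ℕ) : 0 < A.lowFlush t X := by
  unfold lowFlush
  split_ifs
  exacts [flushPot_pos hA.b_nonneg _ _, one_pos]

/-! ### The potential of the tree -/

theorem treePot_mono (h : X ≤ Y) : A.treePot X ≤ A.treePot Y := by
  unfold treePot
  gcongr
  · exact expSum_mono h
  · exact levelPot_mono hA.b_nonneg h

theorem treePot_nonneg (X : List Bool → ℕ) : 0 ≤ A.treePot X :=
  Finset.sum_nonneg fun _ _ => add_nonneg (mul_nonneg (Real.exp_nonneg _) (expSum_nonneg _ _))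
    (mul_nonneg (Real.exp_nonneg _) (zero_le_one.trans (one_le_levelPot hA.b_nonneg _ _)))

theorem treeFlush_nonneg (X : List Bool → ℕ) : 0 ≤ A.treeFlush X :=
  Finset.sum_nonneg fun _ _ => add_nonneg (mul_nonneg (Real.exp_nonneg _) (expFlush_nonneg _ _))
    (mul_nonneg (Real.exp_nonneg _) (flushPot_pos hA.b_nonneg _ _).le)

/-- The queue plays no role in this potential, so the overflow factor is taken to be `1`. -/
theorem treeFlush_step (X : List Bool → ℕ) :
    1 / 3 * A.treePot X + 2 / 3 * (levelAvg A.d fun p => A.treeFlush (decLoad p X)) ≤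
      A.treeFlush X := by
  rw [levelAvg_treeFlush]
  unfold treePot treeFlush
  rw [Finset.mul_sum, Finset.mul_sum, ← Finset.sum_add_distrib]
  refine Finset.sum_le_sum fun t ht => ?_
  have htd : t + 1 ≤ A.d := Finset.mem_range.1 ht
  have h1 := mul_le_mul_of_nonneg_left (expFlush_step htd X) (Real.exp_nonneg (-A.M))
  have h2 := flushPot_step hA.b_nonneg hA.b_le htd X (o := fun _ => 1) (fun _ => le_rfl) (by
    have := meanWt_nonneg hA.b_nonneg (t + 1) X
    simp only [sub_self, levelAvg_const]
    positivity)
  simp only [one_mul] at h2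
  have h3 := mul_le_mul_of_nonneg_left h2 (Real.exp_nonneg (-potBound A.b A.M (t + 1)))
  linarith

section Small

variable (hX : A.treePot X < 1)
include hX

theorem term_lt {t : ℕ} (ht : t < A.d) : Real.exp (-A.M) * expSum (t + 1) X +
    Real.exp (-potBound A.b A.M (t + 1)) * levelPot A.b (t + 1) X < 1 :=
  lt_of_le_of_lt (Finset.single_le_sum (f := fun t => Real.exp (-A.M) * expSum (t + 1) X +
    Real.exp (-potBound A.b A.M (t + 1)) * levelPot A.b (t + 1) X) (fun _ _ => add_nonneg
      (mul_nonneg (Real.exp_nonneg _) (expSum_nonneg _ _)) (mul_nonneg (Real.exp_nonneg _)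
        (zero_le_one.trans (one_le_levelPot hA.b_nonneg _ _)))) (Finset.mem_range.2 ht)) hX

theorem pow_le_exp {t : ℕ} (ht : t < A.d) {c : List Bool} (hc : c ∈ level (t + 1)) :
    (11 / 10 : ℝ) ^ X c ≤ Real.exp A.M := by
  have h1 := term_lt hA hX ht
  have h2 : 0 ≤ Real.exp (-potBound A.b A.M (t + 1)) * levelPot A.b (t + 1) X :=
    mul_nonneg (Real.exp_nonneg _) (zero_le_one.trans (one_le_levelPot hA.b_nonneg _ _))
  have h3 : (11 / 10 : ℝ) ^ X c ≤ expSum (t + 1) X :=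
    Finset.single_le_sum (f := fun c => (11 / 10 : ℝ) ^ X c) (fun _ _ => by positivity) hc
  have h4 : Real.exp (-A.M) * expSum (t + 1) X ≤ 1 := by linarith
  rw [Real.exp_neg, inv_mul_le_iff₀ (Real.exp_pos _)] at h4
  linarith

theorem levelPot_le_exp {t : ℕ} (ht : t < A.d) :
    levelPot A.b (t + 1) X ≤ Real.exp (potBound A.b A.M (t + 1)) := by
  have h1 := term_lt hA hX ht
  have h2 : 0 ≤ Real.exp (-A.M) * expSum (t + 1) X :=
    mul_nonneg (Real.exp_nonneg _) (expSum_nonneg _ _)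
  have h4 : Real.exp (-potBound A.b A.M (t + 1)) * levelPot A.b (t + 1) X ≤ 1 := by linarith
  rw [Real.exp_neg, inv_mul_le_iff₀ (Real.exp_pos _)] at h4
  linarith

/-- Each level costs one `exp (-M)` for the exponential sum and two for the product of weights. -/
theorem treeFlush_le : A.treeFlush X ≤ A.treePot X + 3 * A.d * Real.exp (-A.M) := by
  have h : ∀ t ∈ Finset.range A.d, Real.exp (-A.M) * expFlush (t + 1) X +
      Real.exp (-potBound A.b A.M (t + 1)) * flushPot A.b (t + 1) X ≤
      (Real.exp (-A.M) * expSum (t + 1) X +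
        Real.exp (-potBound A.b A.M (t + 1)) * levelPot A.b (t + 1) X) + 3 * Real.exp (-A.M) := by
    intro t ht
    have htd := Finset.mem_range.1 ht
    have h1 := mul_le_mul_of_nonneg_left (expFlush_le (t + 1) X) (Real.exp_nonneg (-A.M))
    have h2 := mul_le_mul_of_nonneg_left (flushPot_le hA.b_nonneg (t + 1) X)
      (Real.exp_nonneg (-potBound A.b A.M (t + 1)))
    have h3 := levelPot_mul_le hA.b_nonneg hA.b_le hA.M_nonneg fun c hc => pow_le_exp hA hX htd hc
    linarith
  refine (Finset.sum_le_sum h).trans (le_of_eq ?_)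
  rw [Finset.sum_add_distrib, Finset.sum_const, Finset.card_range, nsmul_eq_mul]
  unfold treePot
  ring

theorem levelAvg_treeFlush_incLoad_le :
    (levelAvg A.d fun p => A.treeFlush (incLoad p X)) ≤
      A.treePot X + 3 * A.d * Real.exp (-A.M) := by
  rw [levelAvg_treeFlush]
  have h : ∀ t ∈ Finset.range A.d,
      Real.exp (-A.M) * (levelAvg A.d fun p => expFlush (t + 1) (incLoad p X)) +
      Real.exp (-potBound A.b A.M (t + 1)) *
        (levelAvg A.d fun p => flushPot A.b (t + 1) (incLoad p X)) ≤
      (Real.exp (-A.M) * expSum (t + 1) X +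
        Real.exp (-potBound A.b A.M (t + 1)) * levelPot A.b (t + 1) X) + 3 * Real.exp (-A.M) := by
    intro t ht
    have htd : t + 1 ≤ A.d := Finset.mem_range.1 ht
    have h1 := mul_le_mul_of_nonneg_left (levelAvg_expFlush_incLoad_le htd X)
      (Real.exp_nonneg (-A.M))
    have h2 := mul_le_mul_of_nonneg_left (levelAvg_flushPot_incLoad_le hA.b_nonneg htd X)
      (Real.exp_nonneg (-potBound A.b A.M (t + 1)))
    have h3 := levelPot_mul_le hA.b_nonneg hA.b_le hA.M_nonneg fun c hc => pow_le_exp hA hX htd hc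
    linarith
  refine (Finset.sum_le_sum h).trans (le_of_eq ?_)
  rw [Finset.sum_add_distrib, Finset.sum_const, Finset.card_range, nsmul_eq_mul]
  unfold treePot
  ring

/-- The logarithm of a level potential is at least the number of nodes times the mean weight, so a
bound on it forces a small mean once the level has more than `D` nodes. The factor `11/10` is kept
in reserve for one put-back. -/
theorem meanWt_le_wtBound {t : ℕ} (ht : t < A.d) (hD : A.D < 2 ^ (t + 1)) :
    11 / 10 * meanWt A.b (t + 1) X ≤ A.wtBound := by
  have h1 := meanWt_le_log_levelPot hA.b_nonneg (t + 1) X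
  have h2 := (Real.log_le_iff_le_exp (lt_of_lt_of_le one_pos
    (one_le_levelPot hA.b_nonneg (t + 1) X))).2 (levelPot_le_exp hA hX ht)
  have hD0 := hA.D_pos
  have h3 : A.M / 2 ^ (t + 1) ≤ A.M / A.D := div_le_div_of_nonneg_left hA.M_nonneg hD0 hD.le
  have h4 : meanWt A.b (t + 1) X ≤ potBound A.b A.M (t + 1) / 2 ^ (t + 1) := by
    rw [le_div_iff₀ (by positivity)]
    linarith
  have h5 : potBound A.b A.M (t + 1) / 2 ^ (t + 1) =
      (2 + A.M) * (25 * A.b) + A.M / 2 ^ (t + 1) := by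
    unfold potBound
    field_simp
  unfold wtBound
  linarith

theorem good_incLoad (p : List Bool) : A.Good (incLoad p X) := fun _ ht hD =>
  (meanWt_incLoad_le hA.b_nonneg _ p X).trans (meanWt_le_wtBound hA hX ht hD)

theorem good_of_treePot_lt : A.Good X := fun t ht hD => by
  have h1 := meanWt_le_wtBound hA hX ht hD
  have h2 := meanWt_nonneg hA.b_nonneg (t + 1) X
  linarith

end Small

theorem good_decLoad (p : List Bool) (hX : A.Good X) : A.Good (decLoad p X) := fun t ht hD =>
  (meanWt_mono hA.b_nonneg (decLoad_le p X)).trans (hX t ht hD)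

end Scale

end ORAM
end

noncomputable section
namespace ORAM
namespace Scale

variable {A : Scale}

theorem queuePot_succ (X : List Bool → ℕ) (q : ℕ) :
    A.queuePot X (q + 1) = Real.exp (price / (A.d + 1)) * A.queuePot X q := by
  unfold queuePot
  rw [← mul_assoc, ← Real.exp_add]
  congr 2
  push_cast
  ring

variable (hA : A.Valid) {X Y : List Bool → ℕ}
include hA

/-! ### The potential of the queue -/

theorem prod_low_pos (X : List Bool → ℕ) :
    0 < ∏ t ∈ Finset.range A.d, A.low t X ^ (1 / ((A.d : ℝ) + 1)) :=
  Finset.prod_pos fun t _ => Real.rpow_pos_of_pos (one_pos.trans_le (one_le_low hA t X)) _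

theorem prod_lowFlush_pos (X : List Bool → ℕ) :
    0 < ∏ t ∈ Finset.range A.d, A.lowFlush t X ^ (1 / ((A.d : ℝ) + 1)) :=
  Finset.prod_pos fun t _ => Real.rpow_pos_of_pos (lowFlush_pos hA t X) _

theorem queuePot_nonneg (X : List Bool → ℕ) (q : ℕ) : 0 ≤ A.queuePot X q :=
  mul_nonneg (Real.exp_nonneg _) (prod_low_pos hA X).le

theorem queueFlush_pos (X : List Bool → ℕ) (q : ℕ) : 0 < A.queueFlush X q :=
  mul_pos (by linarith [wtBound_nonneg hA])
    (mul_pos (Real.exp_pos _) (prod_lowFlush_pos hA X))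

theorem low_mono (t : ℕ) (h : X ≤ Y) : A.low t X ≤ A.low t Y := by
  unfold low
  split_ifs
  exacts [levelPot_mono hA.b_nonneg h, le_rfl]

theorem queuePot_mono (h : X ≤ Y) {q r : ℕ} (hq : q ≤ r) : A.queuePot X q ≤ A.queuePot Y r := by
  have hp := price_nonneg
  have hprod : ∏ t ∈ Finset.range A.d, A.low t X ^ (1 / ((A.d : ℝ) + 1)) ≤
      ∏ t ∈ Finset.range A.d, A.low t Y ^ (1 / ((A.d : ℝ) + 1)) :=
    Finset.prod_le_prod (fun t _ => Real.rpow_nonneg (zero_le_one.trans (one_le_low hA t X)) _)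
      fun t _ => Real.rpow_le_rpow (zero_le_one.trans (one_le_low hA t X)) (low_mono hA t h)
        (by positivity)
  have hq' : (q : ℝ) ≤ r := by exact_mod_cast hq
  have hexp : Real.exp (price * (q + 2 - A.qmax) / (A.d + 1)) ≤
      Real.exp (price * (r + 2 - A.qmax) / (A.d + 1)) := by gcongr
  exact mul_le_mul hexp hprod (prod_low_pos hA X).le (Real.exp_nonneg _)

/-- The summand `2` in the exponent of `queuePot` yields this margin, so that the potential is still
at least `1` at `qmax` after it has been scaled for two `Dequeue`s. -/
theorem exp_le_queuePot (X : List Bool → ℕ) {q : ℕ} (hq : A.qmax ≤ q) :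
    Real.exp (price / (A.d + 1)) ^ 2 ≤ A.queuePot X q := by
  have hp := price_nonneg
  have hq' : (A.qmax : ℝ) ≤ q := by exact_mod_cast hq
  have h1 : Real.exp (price / (A.d + 1)) ^ 2 ≤
      Real.exp (price * (q + 2 - A.qmax) / (A.d + 1)) := by
    rw [← Real.exp_nat_mul, ← mul_div_assoc, mul_comm _ price]
    push_cast
    gcongr
    linarith
  have h2 : 1 ≤ ∏ t ∈ Finset.range A.d, A.low t X ^ (1 / ((A.d : ℝ) + 1)) := by
    rw [← Finset.prod_const_one (s := Finset.range A.d)]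
    exact Finset.prod_le_prod (fun _ _ => zero_le_one) fun t _ =>
      Real.one_le_rpow (one_le_low hA t X) (by positivity)
  exact h1.trans (le_mul_of_one_le_right (Real.exp_nonneg _) h2)

/-- The level inequality behind `queueFlush_step`. -/
theorem lowFlush_step (hX : A.Good X) {t : ℕ} (ht : t < A.d) :
    1 / 3 * (1 + A.wtBound)⁻¹ * (A.low t X / A.lowFlush t X) +
      2 / 3 * (levelAvg A.d fun p => (1601 / 1600) ^ kids A.ℓ X (p.take t) *
        A.lowFlush t (decLoad p X) / A.lowFlush t X) ≤ 1 := by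
  have hY := wtBound_nonneg hA
  have hY1 := hA.wtBound_le
  have hov := levelAvg_pow_kids_le hA.b_nonneg hA.load t X
  have htake : ∀ p : List Bool, p.take t = (p.take (t + 1)).take t := fun p => by
    rw [List.take_take, min_eq_left (Nat.le_succ t)]
  -- In levels with more than `D` nodes no level potential pays for overflows. The factor `1 +
  -- wtBound`, given up when the flushes stop, pays instead: `1/3 * w / 2` exceeds `2/3 * w / 200`.
  have hinv : (1 + A.wtBound)⁻¹ ≤ 1 - A.wtBound / 2 := by
    rw [inv_le_iff_one_le_mul₀ (by linarith)]
    nlinarith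
  by_cases hD : (2 : ℝ) ^ (t + 1) ≤ A.D
  · have hF := flushPot_pos hA.b_nonneg (t + 1) X
    have hP := one_le_levelPot hA.b_nonneg (t + 1) X
    have h := flushPot_step hA.b_nonneg hA.b_le (show t + 1 ≤ A.d from ht) X
      (o := fun c => (1601 / 1600) ^ kids A.ℓ X (c.take t))
      (fun c => one_le_pow₀ (by norm_num)) hov
    simp only [← htake] at h
    unfold low lowFlush
    simp only [if_pos hD]
    have h1 : (levelAvg A.d fun p => (1601 / 1600) ^ kids A.ℓ X (p.take t) *
        flushPot A.b (t + 1) (decLoad p X) / flushPot A.b (t + 1) X) =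
        (flushPot A.b (t + 1) X)⁻¹ * levelAvg A.d fun p =>
          (1601 / 1600) ^ kids A.ℓ X (p.take t) * flushPot A.b (t + 1) (decLoad p X) := by
      rw [← levelAvg_mul_left]
      congr 1
      funext p
      rw [div_eq_inv_mul]
    rw [h1]
    have h2 : (1 + A.wtBound)⁻¹ * (levelPot A.b (t + 1) X / flushPot A.b (t + 1) X) ≤
        1 * (levelPot A.b (t + 1) X / flushPot A.b (t + 1) X) :=
      mul_le_mul_of_nonneg_right (by linarith) (by positivity)
    have h3 : (flushPot A.b (t + 1) X)⁻¹ * flushPot A.b (t + 1) X = 1 := inv_mul_cancel₀ hF.ne'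
    have h4 := mul_le_mul_of_nonneg_left h (inv_nonneg.2 hF.le)
    rw [h3] at h4
    rw [div_eq_inv_mul (levelPot A.b (t + 1) X)] at h2 ⊢
    linarith
  · have hgood := hX t ht (not_le.1 hD)
    unfold low lowFlush
    simp only [if_neg hD, mul_one, div_one]
    have h1 : (levelAvg A.d fun p => (1601 / 1600 : ℝ) ^ kids A.ℓ X (p.take t)) =
        (levelAvg (t + 1) fun c => (1601 / 1600 : ℝ) ^ kids A.ℓ X (c.take t) - 1) + 1 := by
      rw [← levelAvg_take (Nat.succ_le_of_lt ht), ← levelAvg_const A.d 1, ← levelAvg_add]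
      simp only [levelAvg_const, ← htake]
      congr 1
      funext p
      ring
    rw [h1]
    linarith

/-- As `price` is divided by `d + 1`, the growth of the queue joins the level ratios in one
geometric mean over the levels. -/
theorem queueFlush_overflow {p : List Bool} (hp : p ∈ level A.d) (q : ℕ) :
    A.queueFlush (decLoad p X) (q + overflows A.ℓ X p) = A.queueFlush X q *
      ∏ t ∈ Finset.range A.d, ((1601 / 1600) ^ kids A.ℓ X (p.take t) *
        A.lowFlush t (decLoad p X) / A.lowFlush t X) ^ (1 / ((A.d : ℝ) + 1)) := by
  have h1 : ∏ t ∈ Finset.range A.d, ((1601 / 1600) ^ kids A.ℓ X (p.take t) *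
        A.lowFlush t (decLoad p X) / A.lowFlush t X) ^ (1 / ((A.d : ℝ) + 1)) =
      (∏ t ∈ Finset.range A.d, ((1601 / 1600) ^ kids A.ℓ X (p.take t)) ^ (1 / ((A.d : ℝ) + 1))) *
      (∏ t ∈ Finset.range A.d, A.lowFlush t (decLoad p X) ^ (1 / ((A.d : ℝ) + 1))) /
      ∏ t ∈ Finset.range A.d, A.lowFlush t X ^ (1 / ((A.d : ℝ) + 1)) := by
    rw [← Finset.prod_mul_distrib, ← Finset.prod_div_distrib]
    refine Finset.prod_congr rfl fun t _ => ?_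
    have h2 := (lowFlush_pos hA t X).le
    have h3 := (lowFlush_pos hA t (decLoad p X)).le
    rw [Real.div_rpow (by positivity) h2, Real.mul_rpow (by positivity) h3]
  have h2 : ∏ t ∈ Finset.range A.d, ((1601 / 1600 : ℝ) ^ kids A.ℓ X (p.take t)) ^
      (1 / ((A.d : ℝ) + 1)) = Real.exp (price * overflows A.ℓ X p / (A.d + 1)) := by
    rw [Real.finsetProd_rpow _ _ fun t _ => by positivity, Finset.prod_pow_eq_pow_sum,
      ← exp_price_mul, ← Real.exp_mul]
    unfold overflows
    rw [mem_level.1 hp, mul_one_div]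
  have h3 := (prod_lowFlush_pos hA X).ne'
  rw [h1, h2]
  unfold queueFlush
  have h4 : Real.exp (price * ((q + overflows A.ℓ X p : ℕ) + 2 - A.qmax) / (A.d + 1)) =
      Real.exp (price * (q + 2 - A.qmax) / (A.d + 1)) *
        Real.exp (price * overflows A.ℓ X p / (A.d + 1)) := by
    rw [← Real.exp_add]
    congr 1
    push_cast
    ring
  rw [h4]
  field_simp

theorem queuePot_eq (X : List Bool → ℕ) (q : ℕ) :
    A.queuePot X q = A.queueFlush X q * ((1 + A.wtBound)⁻¹ *
      ∏ t ∈ Finset.range A.d, (A.low t X / A.lowFlush t X) ^ (1 / ((A.d : ℝ) + 1))) := by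
  have h1 : ∏ t ∈ Finset.range A.d, (A.low t X / A.lowFlush t X) ^ (1 / ((A.d : ℝ) + 1)) =
      (∏ t ∈ Finset.range A.d, A.low t X ^ (1 / ((A.d : ℝ) + 1))) /
      ∏ t ∈ Finset.range A.d, A.lowFlush t X ^ (1 / ((A.d : ℝ) + 1)) := by
    rw [← Finset.prod_div_distrib]
    exact Finset.prod_congr rfl fun t _ => Real.div_rpow
      (zero_le_one.trans (one_le_low hA t X)) (lowFlush_pos hA t X).le _
  have h3 := (prod_lowFlush_pos hA X).ne'
  have h4 : 1 + A.wtBound ≠ 0 := by linarith [wtBound_nonneg hA]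
  rw [h1]
  unfold queuePot queueFlush
  field_simp

/-- Both outcomes of the coin are bounded by the arithmetic mean, and then `lowFlush_step` is summed
over the levels. -/
theorem queueFlush_step (hX : A.Good X) (q : ℕ) :
    1 / 3 * A.queuePot X q +
      2 / 3 * (levelAvg A.d fun p => A.queueFlush (decLoad p X) (q + overflows A.ℓ X p)) ≤
      A.queueFlush X q := by
  have hQ := queueFlush_pos hA X q
  have hY := wtBound_nonneg hA
  have hm : (0 : ℝ) < A.d + 1 := by positivity
  set θ := (1 + A.wtBound)⁻¹ with hθ
  have hθ0 : 0 ≤ θ := by positivity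
  have hθ1 : θ ≤ 1 := inv_le_one_of_one_le₀ (by linarith)
  set x : ℕ → List Bool → ℝ := fun t p => (1601 / 1600) ^ kids A.ℓ X (p.take t) *
    A.lowFlush t (decLoad p X) / A.lowFlush t X with hx
  have h1 : (levelAvg A.d fun p => A.queueFlush (decLoad p X) (q + overflows A.ℓ X p)) ≤
      A.queueFlush X q * (1 + 1 / ((A.d : ℝ) + 1) *
        ∑ t ∈ Finset.range A.d, (levelAvg A.d (x t) - 1)) := by
    refine (levelAvg_mono A.d fun p hp => ?_ : _ ≤ levelAvg A.d fun p => A.queueFlush X q *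
      (1 + 1 / ((A.d : ℝ) + 1) * ∑ t ∈ Finset.range A.d, (x t p + -1))).trans (le_of_eq ?_)
    · rw [queueFlush_overflow hA hp]
      refine mul_le_mul_of_nonneg_left ?_ hQ.le
      refine prod_rpow_le fun t _ => ?_
      have h2 := (lowFlush_pos hA t X).le
      have h3 := (lowFlush_pos hA t (decLoad p X)).le
      positivity
    · rw [levelAvg_mul_left, levelAvg_add, levelAvg_const, levelAvg_mul_left, levelAvg_sum]
      congr 3
      refine Finset.sum_congr rfl fun t _ => ?_
      rw [levelAvg_add, levelAvg_const, sub_eq_add_neg]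
  have h2 : A.queuePot X q ≤ A.queueFlush X q * (θ * (1 + 1 / ((A.d : ℝ) + 1) *
      ∑ t ∈ Finset.range A.d, (A.low t X / A.lowFlush t X - 1))) := by
    rw [queuePot_eq hA]
    gcongr
    exact prod_rpow_le fun t _ =>
      div_nonneg (zero_le_one.trans (one_le_low hA t X)) (lowFlush_pos hA t X).le
  have h3 : 1 / 3 * (θ * (1 + 1 / ((A.d : ℝ) + 1) *
        ∑ t ∈ Finset.range A.d, (A.low t X / A.lowFlush t X - 1))) +
      2 / 3 * (1 + 1 / ((A.d : ℝ) + 1) * ∑ t ∈ Finset.range A.d, (levelAvg A.d (x t) - 1)) ≤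
      1 := by
    -- Each level contributes at most `1/3 - θ/3`, which is the slack left by the spare factor: `θ/3
    -- + 2/3 + (1/3 - θ/3) = 1`.
    have h4 : ∑ t ∈ Finset.range A.d, (1 / 3 * θ * (A.low t X / A.lowFlush t X - 1) +
        2 / 3 * (levelAvg A.d (x t) - 1)) ≤ ∑ t ∈ Finset.range A.d, (1 / 3 - 1 / 3 * θ) := by
      refine Finset.sum_le_sum fun t ht => ?_
      have := lowFlush_step hA hX (Finset.mem_range.1 ht)
      linarith
    rw [Finset.sum_add_distrib, ← Finset.mul_sum, ← Finset.mul_sum, Finset.sum_const,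
      Finset.card_range, nsmul_eq_mul] at h4
    have h5 : 1 / ((A.d : ℝ) + 1) * (A.d * (1 / 3 - 1 / 3 * θ)) ≤ 1 / 3 - 1 / 3 * θ := by
      rw [one_div, inv_mul_le_iff₀ hm]
      nlinarith
    have h6 := mul_le_mul_of_nonneg_left h4 (by positivity : 0 ≤ 1 / ((A.d : ℝ) + 1))
    linarith
  have h7 := mul_le_mul_of_nonneg_left h3 hQ.le
  linarith

/-- The three factors of `rate` are the element leaving the queue, the allowance `1 + wtBound` for
overflows in large levels, and the growth `1 + b / 2` of the small levels. -/
theorem levelAvg_queueFlush_incLoad_le (X : List Bool → ℕ) (q : ℕ) :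
    (levelAvg A.d fun p => A.queueFlush (incLoad p X) q) ≤ A.rate * A.queuePot X (q + 1) := by
  have hY := wtBound_nonneg hA
  have hb := hA.b_nonneg
  have hm : (0 : ℝ) < A.d + 1 := by positivity
  set x : ℕ → List Bool → ℝ := fun t p => A.lowFlush t (incLoad p X) / A.low t X with hx
  have hx1 : ∀ t < A.d, levelAvg A.d (x t) ≤ 1 + A.b / 2 := by
    intro t ht
    by_cases hD : (2 : ℝ) ^ (t + 1) ≤ A.D
    · simp only [hx, low, lowFlush, if_pos hD, div_eq_inv_mul]
      have h1 := one_le_levelPot hb (t + 1) X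
      rw [levelAvg_mul_left, inv_mul_le_iff₀ (by linarith)]
      refine (levelAvg_flushPot_incLoad_le hb (Nat.succ_le_of_lt ht) X).trans ?_
      have := meanWt_nonneg hb (t + 1) X
      gcongr <;> linarith
    · simp only [hx, low, lowFlush, if_neg hD, div_one, levelAvg_const]
      linarith
  have hprod : ∀ p, ∏ t ∈ Finset.range A.d, A.lowFlush t (incLoad p X) ^ (1 / ((A.d : ℝ) + 1)) =
      (∏ t ∈ Finset.range A.d, A.low t X ^ (1 / ((A.d : ℝ) + 1))) *
        ∏ t ∈ Finset.range A.d, x t p ^ (1 / ((A.d : ℝ) + 1)) := by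
    intro p
    rw [← Finset.prod_mul_distrib]
    refine Finset.prod_congr rfl fun t _ => ?_
    have h1 := one_pos.trans_le (one_le_low hA t X)
    rw [← Real.mul_rpow h1.le (div_nonneg (lowFlush_pos hA t _).le h1.le)]
    congr 1
    field_simp
  have hexp : Real.exp (price * (q + 2 - A.qmax) / (A.d + 1)) =
      Real.exp (-(price / (A.d + 1))) *
        Real.exp (price * ((q + 1 : ℕ) + 2 - A.qmax) / (A.d + 1)) := by
    rw [← Real.exp_add]
    congr 1
    push_cast
    ring
  have h1 : (levelAvg A.d fun p => A.queueFlush (incLoad p X) q) =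
      (1 + A.wtBound) * Real.exp (-(price / (A.d + 1))) * A.queuePot X (q + 1) *
        levelAvg A.d fun p => ∏ t ∈ Finset.range A.d, x t p ^ (1 / ((A.d : ℝ) + 1)) := by
    rw [← levelAvg_mul_left]
    unfold queueFlush queuePot
    congr 1
    funext p
    rw [hprod, hexp]
    ring
  have h2 : (levelAvg A.d fun p => ∏ t ∈ Finset.range A.d, x t p ^ (1 / ((A.d : ℝ) + 1))) ≤
      1 + A.b / 2 := by
    refine (levelAvg_mono A.d fun p _ => prod_rpow_le fun t _ =>
      div_nonneg (lowFlush_pos hA t _).le (zero_le_one.trans (one_le_low hA t X))).trans ?_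
    rw [levelAvg_add, levelAvg_const, levelAvg_mul_left, levelAvg_sum]
    have h3 : ∑ t ∈ Finset.range A.d, (levelAvg A.d fun p => x t p - 1) ≤
        ∑ t ∈ Finset.range A.d, A.b / 2 := by
      refine Finset.sum_le_sum fun t ht => ?_
      have := hx1 t (Finset.mem_range.1 ht)
      simp only [sub_eq_add_neg]
      rw [levelAvg_add, levelAvg_const]
      linarith
    rw [Finset.sum_const, Finset.card_range, nsmul_eq_mul] at h3
    have h5 : 1 / ((A.d : ℝ) + 1) * (A.d * (A.b / 2)) ≤ A.b / 2 := by
      rw [one_div, inv_mul_le_iff₀ hm]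
      nlinarith
    have h6 := mul_le_mul_of_nonneg_left h3 (by positivity : 0 ≤ 1 / ((A.d : ℝ) + 1))
    linarith
  have hq := queuePot_nonneg hA X (q + 1)
  rw [h1]
  unfold rate
  have h7 := mul_le_mul_of_nonneg_left h2 (by positivity :
    0 ≤ (1 + A.wtBound) * Real.exp (-(price / (A.d + 1))) * A.queuePot X (q + 1))
  linarith

/-- This is why only levels with at most `D` nodes enter the queue potential: their logarithms are
bounded independently of `d`, and so is their geometric mean. -/
theorem queueFlush_zero_le (hX : A.treePot X < 1) : A.queueFlush X 0 ≤ A.idle := by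
  have hY := wtBound_nonneg hA
  have hY1 := hA.wtBound_le
  have hb := hA.b_nonneg
  have hM := hA.M_nonneg
  have hD0 := hA.D_pos
  set B := (2 + A.M) * (25 * A.b * A.D) + A.M + 1 with hB
  have hB0 : 0 ≤ B := by positivity
  have h1 : ∀ t ∈ Finset.range A.d, A.lowFlush t X ≤ Real.exp B := by
    intro t ht
    unfold lowFlush
    split_ifs with hD
    · have h2 := levelPot_le_exp hA hX (Finset.mem_range.1 ht)
      have h3 := flushPot_le hb (t + 1) X
      have h4 := one_le_levelPot hb (t + 1) X
      have h5 := meanWt_nonneg hb (t + 1) X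
      have h6 : levelPot A.b (t + 1) X * (1 - meanWt A.b (t + 1) X / 50 + A.b / 2) ≤
          Real.exp (potBound A.b A.M (t + 1)) * Real.exp 1 := by
        have := Real.add_one_le_exp 1
        have h7 := hA.b_le
        exact mul_le_mul h2 (by linarith) (by linarith [meanWt_le_one hb (t + 1) X])
          (Real.exp_nonneg _)
      refine h3.trans (h6.trans ?_)
      rw [← Real.exp_add]
      rw [hB]
      unfold potBound
      gcongr
    · exact Real.one_le_exp hB0
  have h2 : ∏ t ∈ Finset.range A.d, A.lowFlush t X ^ (1 / ((A.d : ℝ) + 1)) ≤ Real.exp B := by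
    refine (Finset.prod_le_prod (fun t _ => Real.rpow_nonneg (lowFlush_pos hA t X).le _)
      fun t ht => Real.rpow_le_rpow (lowFlush_pos hA t X).le (h1 t ht) (by positivity)).trans ?_
    rw [Finset.prod_const, Finset.card_range, ← Real.exp_mul, ← Real.exp_nat_mul]
    gcongr
    rw [mul_one_div, mul_div_assoc', div_le_iff₀ (by positivity)]
    nlinarith
  unfold queueFlush idle
  rw [Real.exp_add]
  have h3 : (0 : ℕ) + 2 - (A.qmax : ℝ) = 2 - A.qmax := by simp
  rw [h3]
  have h4 := prod_lowFlush_pos hA X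
  have h5 := mul_le_mul_of_nonneg_left h2
    (Real.exp_nonneg (price * (2 - A.qmax) / (A.d + 1)))
  exact mul_le_mul (by linarith) h5 (mul_nonneg (Real.exp_nonneg _) h4.le) zero_le_two

end Scale
end ORAM
end

/-! ### The total potential of one ORAM. -/

noncomputable section
namespace ORAM
namespace Scale

variable (A : Scale)

/-- The bound for the total potential added by two `Dequeue`s, and for the initial potential. -/
def err : ℝ := 2 * A.idle + 6 * A.d * 2 ^ A.d * Real.exp (-A.M)

/-- The truncated potential of loads and a queue, with the potential of the queue scaled by `a`. -/
def pot (a e : ℝ) (X : List Bool → ℕ) (q : ℕ) : ENNReal :=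
  min 1 (ENNReal.ofReal (a * A.queuePot X q + A.treePot X + e))

theorem idle_nonneg : 0 ≤ A.idle := mul_nonneg zero_le_two (Real.exp_nonneg _)

variable {A}

theorem third_add_le {x y : ENNReal} {r s : ℝ} (hx : x ≤ ENNReal.ofReal r)
    (hy : y ≤ ENNReal.ofReal s) (hr : 0 ≤ r) (hs : 0 ≤ s) :
    1 / 3 * x + 2 / 3 * y ≤ ENNReal.ofReal (1 / 3 * r + 2 / 3 * s) := by
  have h1 : (1 / 3 : ENNReal) = ENNReal.ofReal (1 / 3) := by
    rw [ENNReal.ofReal_div_of_pos (by norm_num)]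
    simp
  have h2 : (2 / 3 : ENNReal) = ENNReal.ofReal (2 / 3) := by
    rw [ENNReal.ofReal_div_of_pos (by norm_num)]
    simp
  rw [ENNReal.ofReal_add (by positivity) (by positivity), ENNReal.ofReal_mul (by norm_num),
    ENNReal.ofReal_mul (by norm_num), h1, h2]
  gcongr

variable (hA : A.Valid) {X Y : List Bool → ℕ}
include hA

/-- The scaling by `rate ^ 2` is compensated by the margin of two elements, as `rate ≥ exp (-(price
/ (d + 1)))`. -/
theorem admissible_pot {a e : ℝ} (ha : A.rate ^ 2 ≤ a) (he : 0 ≤ e) :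
    Admissible A.qmax (A.pot a e) := by
  have hr := rate_nonneg hA
  have ha0 : 0 ≤ a := (sq_nonneg _).trans ha
  constructor
  · intro X Y q r hX hq
    have h1 := queuePot_mono hA hX hq
    have h2 := treePot_mono hA hX
    unfold pot
    gcongr
  · intro X q hq
    have h1 := exp_le_queuePot hA X hq
    have h2 := treePot_nonneg hA X
    have h3 := le_rate hA
    have h4 : 1 ≤ A.rate * Real.exp (price / (A.d + 1)) := by
      have := mul_le_mul_of_nonneg_right h3 (Real.exp_nonneg (price / (A.d + 1)))
      rwa [← Real.exp_add, neg_add_cancel, Real.exp_zero] at this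
    have h5 : 1 ≤ a * A.queuePot X q := by
      calc (1 : ℝ) ≤ (A.rate * Real.exp (price / (A.d + 1))) ^ 2 := one_le_pow₀ h4
        _ = A.rate ^ 2 * Real.exp (price / (A.d + 1)) ^ 2 := by ring
        _ ≤ a * A.queuePot X q := by gcongr
    refine le_min le_rfl ?_
    rw [← ENNReal.ofReal_one]
    exact ENNReal.ofReal_le_ofReal (by linarith)

/-- For a nonempty queue the queue potential contracts by `rate`; for an empty queue it is at most
`idle`. The tree potential grows by `3 * d * exp (-M)` in either case. -/
theorem dequeueOp_pot_le {a e : ℝ} (ha : 0 ≤ a) (ha1 : a ≤ 1) (he : 0 ≤ e) (X : List Bool → ℕ)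
    (q : ℕ) : dequeueOp A.d A.ℓ (A.pot a e) X q ≤
      A.pot (a * A.rate) (e + (A.idle + 3 * A.d * Real.exp (-A.M))) X q := by
  have hidle := A.idle_nonneg
  have hM := Real.exp_nonneg (-A.M)
  have hQ : 0 ≤ a * A.rate * A.queuePot X q :=
    mul_nonneg (mul_nonneg ha (rate_nonneg hA)) (queuePot_nonneg hA X q)
  refine le_min (dequeueOp_le_one (fun X q => min_le_left _ _) X q) ?_
  -- Exceptional loads are harmless, because there the truncated potential is already `1`. Otherwise
  -- the large levels are `Good` even after a put-back, and flushes preserve this.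
  rcases le_or_gt 1 (A.treePot X) with hX | hX
  · refine (dequeueOp_le_one (fun X q => min_le_left _ _) X q).trans ?_
    rw [← ENNReal.ofReal_one]
    refine ENNReal.ofReal_le_ofReal ?_
    have : 0 ≤ 3 * A.d * Real.exp (-A.M) := by positivity
    linarith
  have hH : ∀ X q, 0 ≤ a * A.queueFlush X q + A.treeFlush X + e := fun X q => by
    have h1 := (queueFlush_pos hA X q).le
    have h2 := treeFlush_nonneg hA X
    positivity
  have hgeom : ∀ X q, A.Good X → geomOp A.d A.ℓ (A.pot a e) X q ≤
      ENNReal.ofReal (a * A.queueFlush X q + A.treeFlush X + e) := by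
    intro X q hX
    refine geomOp_le (Good := A.Good) (H := fun X q =>
      ENNReal.ofReal (a * A.queueFlush X q + A.treeFlush X + e))
      (fun X p => good_decLoad hA p) (fun X q hX => ?_) hX q
    have h1 : flushOp A.d A.ℓ (fun X q =>
        ENNReal.ofReal (a * A.queueFlush X q + A.treeFlush X + e)) X q =
        ENNReal.ofReal (a * (levelAvg A.d fun p =>
          A.queueFlush (decLoad p X) (q + overflows A.ℓ X p)) +
          (levelAvg A.d fun p => A.treeFlush (decLoad p X)) + e) := by
      unfold flushOp
      rw [leafAvg_ofReal A.d fun p _ => hH _ _, levelAvg_add, levelAvg_add, levelAvg_mul_left,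
        levelAvg_const]
    refine (third_add_le (min_le_right _ _) h1.le ?_ ?_).trans (ENNReal.ofReal_le_ofReal ?_)
    · have h2 := queuePot_nonneg hA X q
      have h3 := treePot_nonneg hA X
      positivity
    · have h2 := levelAvg_nonneg A.d fun p _ =>
        (queueFlush_pos hA (decLoad p X) (q + overflows A.ℓ X p)).le
      have h3 := levelAvg_nonneg A.d fun p _ => treeFlush_nonneg hA (decLoad p X)
      positivity
    · have h2 := mul_le_mul_of_nonneg_left (queueFlush_step hA hX q) ha
      have h3 := treeFlush_step hA X
      linarith
  unfold dequeueOp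
  split_ifs with hq
  · refine (hgeom X 0 (good_of_treePot_lt hA hX)).trans (ENNReal.ofReal_le_ofReal ?_)
    have h1 := queueFlush_zero_le hA hX
    have h2 := treeFlush_le hA hX
    have h3 : a * A.queueFlush X 0 ≤ 1 * A.idle :=
      mul_le_mul ha1 h1 (queueFlush_pos hA X 0).le zero_le_one
    linarith
  · obtain ⟨r, rfl⟩ : ∃ r, q = r + 1 := ⟨q - 1, by omega⟩
    refine (leafAvg_mono A.d fun p _ => hgeom _ _ (good_incLoad hA hX p)).trans ?_
    rw [leafAvg_ofReal A.d fun p _ => hH _ _, levelAvg_add, levelAvg_add, levelAvg_mul_left,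
      levelAvg_const, Nat.add_sub_cancel]
    refine ENNReal.ofReal_le_ofReal ?_
    have h1 := mul_le_mul_of_nonneg_left (levelAvg_queueFlush_incLoad_le hA X r) ha
    have h2 := levelAvg_treeFlush_incLoad_le hA hX
    linarith

theorem levelPot_zero_le (k : ℕ) :
    levelPot A.b k (fun _ => 0) ≤ Real.exp (A.b * 2 ^ k) := by
  have hb := hA.b_nonneg
  unfold levelPot wt
  rw [Finset.prod_const, card_level, mul_comm A.b (2 ^ k), pow_zero, mul_one]
  have h := Real.exp_nat_mul A.b (2 ^ k)
  push_cast at h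
  rw [h]
  gcongr
  have := Real.add_one_le_exp A.b
  linarith

theorem treePot_zero_le : A.treePot (fun _ => 0) ≤ 2 * A.d * 2 ^ A.d * Real.exp (-A.M) := by
  have hb := hA.b_nonneg
  have hM := hA.M_nonneg
  have h : ∀ t ∈ Finset.range A.d, Real.exp (-A.M) * expSum (t + 1) (fun _ => 0) +
      Real.exp (-potBound A.b A.M (t + 1)) * levelPot A.b (t + 1) (fun _ => 0) ≤
      2 * 2 ^ A.d * Real.exp (-A.M) := by
    intro t ht
    have htd : t + 1 ≤ A.d := Finset.mem_range.1 ht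
    have h1 : expSum (t + 1) (fun _ => 0) ≤ 2 ^ A.d := by
      unfold expSum
      simp only [pow_zero]
      rw [Finset.sum_const, card_level, nsmul_eq_mul, mul_one]
      push_cast
      exact pow_le_pow_right₀ one_le_two htd
    have h2 : Real.exp (-potBound A.b A.M (t + 1)) * levelPot A.b (t + 1) (fun _ => 0) ≤
        Real.exp (-A.M) := by
      refine (mul_le_mul_of_nonneg_left (levelPot_zero_le hA (t + 1)) (Real.exp_nonneg _)).trans ?_
      rw [← Real.exp_add]
      refine Real.exp_le_exp.2 ?_
      unfold potBound
      have h3 : 0 ≤ A.b * 2 ^ (t + 1) := by positivity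
      nlinarith
    have h3 := mul_le_mul_of_nonneg_left h1 (Real.exp_nonneg (-A.M))
    have h4 : (1 : ℝ) ≤ 2 ^ A.d := one_le_pow₀ one_le_two
    nlinarith [Real.exp_nonneg (-A.M)]
  refine (Finset.sum_le_sum h).trans (le_of_eq ?_)
  rw [Finset.sum_const, Finset.card_range, nsmul_eq_mul]
  ring

theorem queuePot_zero_le : A.queuePot (fun _ => 0) 0 ≤ A.idle := by
  have hb := hA.b_nonneg
  have hM := hA.M_nonneg
  have hD0 := hA.D_pos
  set B := (2 + A.M) * (25 * A.b * A.D) + A.M + 1 with hB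
  have hB0 : 0 ≤ B := by positivity
  have h1 : ∀ t, A.low t (fun _ => 0) ≤ Real.exp B := by
    intro t
    unfold low
    split_ifs with hD
    · refine (levelPot_zero_le hA (t + 1)).trans (Real.exp_le_exp.2 ?_)
      have h2 : A.b * 2 ^ (t + 1) ≤ A.b * A.D := by gcongr
      have h3 : 0 ≤ A.b * A.D := by positivity
      nlinarith
    · exact Real.one_le_exp hB0
  have h2 : ∏ t ∈ Finset.range A.d, A.low t (fun _ => 0) ^ (1 / ((A.d : ℝ) + 1)) ≤
      Real.exp B := by
    refine (Finset.prod_le_prod (fun t _ => Real.rpow_nonneg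
      (zero_le_one.trans (one_le_low hA t _)) _) fun t _ => Real.rpow_le_rpow
        (zero_le_one.trans (one_le_low hA t _)) (h1 t) (by positivity)).trans ?_
    rw [Finset.prod_const, Finset.card_range, ← Real.exp_mul, ← Real.exp_nat_mul]
    gcongr
    rw [mul_one_div, mul_div_assoc', div_le_iff₀ (by positivity)]
    nlinarith
  unfold queuePot idle
  rw [Real.exp_add]
  have h3 : ((0 : ℕ) : ℝ) + 2 - (A.qmax : ℝ) = 2 - A.qmax := by simp
  rw [h3]
  have h5 := mul_le_mul_of_nonneg_left h2
    (Real.exp_nonneg (price * (2 - A.qmax) / (A.d + 1)))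
  have h6 := mul_nonneg (Real.exp_nonneg (price * (2 - A.qmax) / (A.d + 1))) (Real.exp_nonneg B)
  linarith

/-- The potentials before the second `Dequeue`, the first one and the fetched insertion differ by
powers of `rate` and by additive errors. The cycle closes because one insertion multiplies the queue
potential by `exp (price / (d + 1))` and `rate ^ 2` undoes this. -/
theorem bounded : Bounded A.d A.ℓ A.qmax (ENNReal.ofReal A.err) := by
  have hidle := A.idle_nonneg
  have hM := Real.exp_nonneg (-A.M)
  have hr := rate_nonneg hA
  have hr1 := rate_le_one hA
  set ν := A.idle + 3 * A.d * Real.exp (-A.M) with hν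
  have hν0 : 0 ≤ ν := by positivity
  have h2d : (1 : ℝ) ≤ 2 ^ A.d := one_le_pow₀ one_le_two
  have hd : A.d * Real.exp (-A.M) ≤ A.d * 2 ^ A.d * Real.exp (-A.M) := by
    gcongr
    exact le_mul_of_one_le_right (by positivity) h2d
  have herr : 2 * ν ≤ A.err := by
    unfold err
    linarith
  refine ⟨A.pot 1 0, A.pot (1 * A.rate) (0 + ν), A.pot (1 * A.rate * A.rate) (0 + ν + ν),
    admissible_pot hA (by nlinarith) le_rfl, admissible_pot hA (by nlinarith) (by linarith),
    admissible_pot hA (by nlinarith) (by linarith),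
    dequeueOp_pot_le hA zero_le_one le_rfl le_rfl,
    dequeueOp_pot_le hA (by linarith) (by linarith) (by linarith), fun X q => ?_, ?_⟩
  · unfold pot
    have h1 := queuePot_succ X q (A := A)
    have h2 : 1 * A.rate * A.rate * A.queuePot X (q + 1) ≤ 1 * A.queuePot X q := by
      rw [h1]
      calc _ = Real.exp (price / (A.d + 1)) * A.rate ^ 2 * A.queuePot X q := by ring
        _ ≤ _ := mul_le_mul_of_nonneg_right hA.rate_le (queuePot_nonneg hA X q)
    have h3 : ENNReal.ofReal (1 * A.rate * A.rate * A.queuePot X (q + 1) + A.treePot X +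
        (0 + ν + ν)) ≤ ENNReal.ofReal (1 * A.queuePot X q + A.treePot X + 0) +
          ENNReal.ofReal A.err := by
      rw [← ENNReal.ofReal_add (by
        have := queuePot_nonneg hA X q
        have := treePot_nonneg hA X
        linarith) (by linarith)]
      exact ENNReal.ofReal_le_ofReal (by linarith)
    rcases min_cases (1 : ENNReal) (ENNReal.ofReal (1 * A.queuePot X q + A.treePot X + 0)) with h | h
    · rw [h.1]
      exact (min_le_left _ _).trans le_self_add
    · rw [h.1]
      exact (min_le_right _ _).trans h3
  · refine (min_le_right _ _).trans (ENNReal.ofReal_le_ofReal ?_)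
    have h1 := treePot_zero_le hA
    have h2 := queuePot_zero_le hA
    unfold err
    have h3 : 0 ≤ A.d * 2 ^ A.d * Real.exp (-A.M) := by positivity
    linarith

end Scale
end ORAM
end

noncomputable section
namespace ORAM

open Filter Topology

/-! ### The choice of the constants -/

/-- The trivial bound, which serves the finitely many small `n`. -/
theorem bounded_one (d ℓ qmax : ℕ) : Bounded d ℓ qmax 1 := by
  have h : Admissible qmax fun _ _ => 1 := ⟨fun _ _ _ _ _ _ => le_rfl, fun _ _ _ => le_rfl⟩
  exact ⟨_, _, _, h, h, h, dequeueOp_le_one fun _ _ => le_rfl, dequeueOp_le_one fun _ _ => le_rfl,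
    fun _ _ => le_self_add, le_rfl⟩

theorem price_pos : 0 < Scale.price := Real.log_pos (by norm_num)

/-- The constant `20` gives `ℓ / 2 * log (11/10) ≥ 10 * log x`; `(ℓ + 1) / 2` is the least integer
load that counts as overloaded. -/
theorem pow_half_le {ℓ : ℕ} {x : ℝ} (hx : 0 < x)
    (hℓ : 20 / Real.logb 2 (11 / 10) * Real.logb 2 x ≤ ℓ) :
    (10 / 11 : ℝ) ^ ((ℓ + 1) / 2) ≤ 1 / x ^ 10 := by
  have hlog : 0 < Real.log (11 / 10) := Real.log_pos (by norm_num)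
  have h2 : 0 < Real.log 2 := Real.log_pos one_lt_two
  have h1 : 20 / Real.logb 2 (11 / 10) * Real.logb 2 x = 20 * Real.log x / Real.log (11 / 10) := by
    unfold Real.logb
    field_simp
  rw [h1, div_le_iff₀ hlog] at hℓ
  have h3 : (ℓ : ℝ) ≤ 2 * ((ℓ + 1) / 2 : ℕ) := by
    have : ℓ ≤ 2 * ((ℓ + 1) / 2) := by omega
    exact_mod_cast this
  have h4 : x ^ 10 ≤ (11 / 10 : ℝ) ^ ((ℓ + 1) / 2) := by
    rw [← Real.log_le_log_iff (by positivity) (by positivity), Real.log_pow, Real.log_pow]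
    push_cast
    nlinarith
  calc (10 / 11 : ℝ) ^ ((ℓ + 1) / 2) = 1 / (11 / 10 : ℝ) ^ ((ℓ + 1) / 2) := by
        rw [one_div, ← inv_pow]
        norm_num
    _ ≤ 1 / x ^ 10 := one_div_le_one_div_of_le (by positivity) h4

theorem one_le_pow_half_mul {ℓ x : ℕ} (h : ℓ ≤ 2 * x) :
    1 ≤ (10 / 11 : ℝ) ^ ((ℓ + 1) / 2) * (11 / 10) ^ x := by
  have h1 : (11 / 10 : ℝ) ^ ((ℓ + 1) / 2) ≤ (11 / 10) ^ x :=
    pow_le_pow_right₀ (by norm_num) (by omega)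
  calc (1 : ℝ) = (10 / 11 : ℝ) ^ ((ℓ + 1) / 2) * (11 / 10) ^ ((ℓ + 1) / 2) := by
        rw [← mul_pow]
        norm_num
    _ ≤ _ := by gcongr

/-- The error of an ORAM with a tree of depth `d` in terms of a number `L ≥ d - 1`. -/
theorem bounded_of_le {d ℓ qmax : ℕ} {L M : ℝ} (hL : 2 ≤ L) (hd : (d : ℝ) ≤ L + 1)
    (hℓ : 20 / Real.logb 2 (11 / 10) * Real.logb 2 L ≤ ℓ) (hM : 4 ≤ M) (hML : M ≤ L ^ 2)
    (hLp : 16 / Scale.price ≤ L) (hq : 3 * M * (2 * L) ≤ Scale.price * (qmax - 2)) :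
    Bounded d ℓ qmax (ENNReal.ofReal ((4 + 6 * (L + 1) * 2 ^ d) * Real.exp (-M))) := by
  have hp := price_pos
  have hL0 : 0 < L := by linarith
  -- The smallest `b` that this argument allows: `b * 1.1 ^ x ≥ 1` as soon as `2 * x ≥ ℓ`.
  set b : ℝ := (10 / 11) ^ ((ℓ + 1) / 2) with hb
  have hb0 : 0 ≤ b := by positivity
  have hbL : b ≤ 1 / L ^ 10 := pow_half_le hL0 hℓ
  have hp1 : Scale.price ≤ 1 := by
    have := Real.log_le_sub_one_of_pos (by norm_num : (0 : ℝ) < 1601 / 1600)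
    unfold Scale.price
    linarith
  have hL16 : 16 ≤ L := by
    rw [div_le_iff₀ hp] at hLp
    nlinarith
  -- With `b ≤ L ^ (-10)` and `M ≤ L ^ 2`, the tenth power leaves room for levels of up to `L ^ 4`
  -- nodes.
  have hMb : (2 + M) * (25 * b * L ^ 4) ≤ 1 / 4 := by
    have h1 : (2 + M) * (25 * b * L ^ 4) ≤ (2 * L ^ 2) * (25 * (1 / L ^ 10) * L ^ 4) := by
      gcongr
      nlinarith
    have h2 : (2 * L ^ 2) * (25 * (1 / L ^ 10) * L ^ 4) = 50 / L ^ 4 := by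
      field_simp
      norm_num
    rw [h2] at h1
    refine h1.trans ?_
    rw [div_le_iff₀ (by positivity)]
    have : (16 : ℝ) ^ 4 ≤ L ^ 4 := by gcongr
    linarith
  -- The threshold `D = L ^ 4` is large enough to make `M / D ≤ 1 / L ^ 2`, which is negligible
  -- against the gain of order `1 / L` per `Dequeue`.
  set A : Scale := ⟨d, ℓ, qmax, b, M, L ^ 4⟩ with hA
  have hb1 : b ≤ 1 / L ^ 2 := by
    refine hbL.trans (one_div_le_one_div_of_le (by positivity) ?_)
    exact pow_le_pow_right₀ (by linarith) (by norm_num)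
  have hwt : A.wtBound ≤ 2 / L ^ 2 := by
    have h1 : A.wtBound = 11 / 10 * (((2 + M) * (25 * b * L ^ 4)) / L ^ 4 + M / L ^ 4) := by
      simp only [Scale.wtBound, hA]
      field_simp
    rw [h1]
    have h2 : ((2 + M) * (25 * b * L ^ 4)) / L ^ 4 ≤ 1 / 4 / L ^ 2 := by
      have : L ^ 2 ≤ L ^ 4 := pow_le_pow_right₀ (by linarith) (by norm_num)
      gcongr
    have h3 : M / L ^ 4 ≤ 1 / L ^ 2 := by
      rw [div_le_div_iff₀ (by positivity) (by positivity)]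
      nlinarith [sq_nonneg L]
    calc _ ≤ 11 / 10 * (1 / 4 / L ^ 2 + 1 / L ^ 2) := by gcongr
      _ = 55 / 40 / L ^ 2 := by ring
      _ ≤ 2 / L ^ 2 := by gcongr; norm_num
  have hd0 : (0 : ℝ) < d + 1 := by positivity
  have hd1 : (d : ℝ) + 1 ≤ 2 * L := by linarith
  have hpd : Scale.price / (2 * L) ≤ Scale.price / (d + 1) := by gcongr
  -- The gain from shortening the queue exceeds all losses in `rate_le`, which amount to `6 / L ^
  -- 2`.
  have h8 : 8 / L ^ 2 ≤ Scale.price / (2 * L) := by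
    rw [div_le_div_iff₀ (by positivity) (by positivity)]
    rw [div_le_iff₀ hp] at hLp
    nlinarith
  have hV : A.Valid := by
    refine ⟨hb0, ?_, by linarith, by positivity, fun x hx => one_le_pow_half_mul hx, ?_, ?_⟩
    · refine hb1.trans ?_
      rw [div_le_one (by positivity)]
      nlinarith
    · refine hwt.trans ?_
      rw [div_le_one (by positivity)]
      nlinarith
    · have h1 : 0 ≤ (1 + A.wtBound) * (1 + b / 2) := by
        have : 0 ≤ A.wtBound := by
          simp only [Scale.wtBound, hA]
          positivity
        positivity
      have h2 : (1 + A.wtBound) * (1 + b / 2) ≤ Real.exp (3 / L ^ 2) := by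
        have h3 : (1 + A.wtBound) ≤ Real.exp (2 / L ^ 2) := by
          have := Real.add_one_le_exp (2 / L ^ 2)
          linarith
        have h4 : (1 + b / 2) ≤ Real.exp (1 / L ^ 2) := by
          have := Real.add_one_le_exp (1 / L ^ 2)
          linarith
        calc _ ≤ Real.exp (2 / L ^ 2) * Real.exp (1 / L ^ 2) :=
              mul_le_mul h3 h4 (by positivity) (Real.exp_nonneg _)
          _ = _ := by
            rw [← Real.exp_add]
            congr 1
            ring
      have h5 : Real.exp (Scale.price / (d + 1)) *
          (Real.exp (-(Scale.price / (d + 1))) * ((1 + A.wtBound) * (1 + b / 2))) ^ 2 ≤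
          Real.exp (Scale.price / (d + 1)) *
          (Real.exp (-(Scale.price / (d + 1))) * Real.exp (3 / L ^ 2)) ^ 2 := by gcongr
      refine h5.trans ?_
      rw [← Real.exp_add, ← Real.exp_nat_mul, ← Real.exp_add, Real.exp_le_one_iff]
      push_cast
      have h6 : 2 * (3 / L ^ 2) ≤ 8 / L ^ 2 := by
        rw [mul_div_assoc']
        gcongr
        norm_num
      linarith
  obtain ⟨G₀, G₁, G₂, h0, h1, h2, h3, h4, h5, h6⟩ := A.bounded hV
  have hidle : A.idle ≤ 2 * Real.exp (-M) := by
    unfold Scale.idle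
    gcongr
    -- Three times `M`: the level potentials use up `M + 5/4`, and at least `M` must remain.
    have h7 : Scale.price * (2 - qmax) / (d + 1) ≤ -(3 * M) := by
      rw [div_le_iff₀ hd0]
      nlinarith
    show Scale.price * (2 - qmax) / (d + 1) + ((2 + M) * (25 * b * L ^ 4) + M + 1) ≤ -M
    linarith
  have herr : A.err ≤ (4 + 6 * (L + 1) * 2 ^ d) * Real.exp (-M) := by
    have h7 : A.err = 2 * A.idle + 6 * d * 2 ^ d * Real.exp (-M) := rfl
    have h8 : 6 * d * 2 ^ d * Real.exp (-M) ≤ 6 * (L + 1) * 2 ^ d * Real.exp (-M) := by gcongr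
    rw [h7]
    linarith
  have herr' := ENNReal.ofReal_le_ofReal herr
  exact ⟨G₀, G₁, G₂, h0, h1, h2, h3, h4, fun X q => (h5 X q).trans (by gcongr), h6.trans herr'⟩

/-- Only the crude bound by `log n` matters; the denominator `log n * log log n ≥ 2` cancels the
factor `2`. -/
theorem depth_le {P : Params} (hα : 1 ≤ P.α) (hn : 2 ≤ Real.logb 2 P.n) {N : ℕ} (hN : N ≤ P.n) :
    P.depth N ≤ Nat.clog 2 P.n := by
  unfold Params.depth
  refine Nat.clog_mono_right 2 (Nat.ceil_le.2 ?_)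
  have h1 : 1 ≤ Real.logb 2 (Real.logb 2 P.n) := by
    rw [Real.le_logb_iff_rpow_le one_lt_two (by linarith)]
    simpa using hn
  have h2 : (N : ℝ) / P.α ≤ P.n := by
    refine (div_le_self (Nat.cast_nonneg _) (by exact_mod_cast hα)).trans (by exact_mod_cast hN)
  rw [div_le_iff₀ (by nlinarith)]
  have h3 : (2 : ℝ) ≤ Real.logb 2 P.n * Real.logb 2 (Real.logb 2 P.n) := by nlinarith
  have h4 := mul_le_mul_of_nonneg_left h3 (Nat.cast_nonneg (α := ℝ) P.n)
  linarith

theorem clog_le_logb (n : ℕ) (hn : 1 ≤ n) : (Nat.clog 2 n : ℝ) ≤ Real.logb 2 n + 1 := by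
  rw [← Real.natCeil_logb_natCast]
  exact (Nat.ceil_lt_add_one (Real.logb_nonneg (by norm_num) (by exact_mod_cast hn))).le

theorem two_pow_clog_le (n : ℕ) (hn : 1 ≤ n) : (2 : ℝ) ^ Nat.clog 2 n ≤ 2 * n := by
  have hn' : (0 : ℝ) < n := by exact_mod_cast hn
  calc (2 : ℝ) ^ Nat.clog 2 n = 2 ^ (Nat.clog 2 n : ℝ) := (Real.rpow_natCast _ _).symm
    _ ≤ 2 ^ (Real.logb 2 n + 1) := Real.rpow_le_rpow_of_exponent_le one_le_two (clog_le_logb n hn)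
    _ = 2 * n := by
      rw [Real.rpow_add two_pos, Real.rpow_logb two_pos (by norm_num) hn']
      simp [mul_comm]

theorem tendsto_logb_natCast : Tendsto (fun n : ℕ => Real.logb 2 n) atTop atTop :=
  (Real.tendsto_logb_atTop one_lt_two).comp tendsto_natCast_atTop_atTop

/-- With `M = (log n) ^ (1 + η)` and depth at most about `log n`, the queue needs size of order `M *
log n`, which is less than `(log n) ^ (2 + ε)` as `η < ε`. -/
theorem eventually_bounded {α : ℕ} {ε K η : ℝ} {ℓ ℓ' qmax : ℕ → ℕ} (hα : 2 ≤ α) (hη : 0 < η)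
    (hη1 : η < 1) (hηε : η < ε) (hK : 0 < K)
    (hℓ : ∀ᶠ n : ℕ in atTop, 20 / Real.logb 2 (11 / 10) * Real.logb 2 (Real.logb 2 n) ≤ ℓ n)
    (hq : ∀ᶠ n : ℕ in atTop, K * Real.logb 2 n ^ (2 + ε) ≤ qmax n) :
    ∀ᶠ n : ℕ in atTop, ∀ (pull spill : List (ℕ × List Bool) → ℕ) (N : ℕ), N ≤ n →
      Bounded ((⟨n, α, ℓ n, ℓ' n, qmax n, pull, spill⟩ : Params).depth N) (ℓ n) (qmax n)
        (ENNReal.ofReal (40 * n ^ 2 * Real.exp (-Real.logb 2 n ^ (1 + η)))) := by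
  have hp := price_pos
  have h1 := tendsto_logb_natCast.eventually_ge_atTop (16 / Scale.price)
  have h2 := tendsto_logb_natCast.eventually_ge_atTop 4
  have h3 := ((tendsto_rpow_atTop (sub_pos.2 hηε)).comp
    tendsto_logb_natCast).eventually_ge_atTop ((6 / Scale.price + 2) / K)
  filter_upwards [hℓ, hq, h1, h2, h3, eventually_ge_atTop 1] with n hℓ hq h1 h2 h3 hn pull spill N hN
  set L := Real.logb 2 n with hL
  have hL0 : 0 < L := by linarith
  have hn' : (1 : ℝ) ≤ n := by exact_mod_cast hn
  have hd : (⟨n, α, ℓ n, ℓ' n, qmax n, pull, spill⟩ : Params).depth N ≤ Nat.clog 2 n :=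
    depth_le (by exact le_trans one_le_two hα) (by show 2 ≤ L; linarith) hN
  set d := (⟨n, α, ℓ n, ℓ' n, qmax n, pull, spill⟩ : Params).depth N
  set M := L ^ (1 + η) with hM
  have hM4 : 4 ≤ M := by
    calc (4 : ℝ) ≤ L ^ (1 : ℝ) := by rw [Real.rpow_one]; exact h2
      _ ≤ M := Real.rpow_le_rpow_of_exponent_le (by linarith) (by linarith)
  have hML : M ≤ L ^ 2 := by
    rw [← Real.rpow_natCast]
    refine Real.rpow_le_rpow_of_exponent_le (by linarith) ?_
    push_cast
    linarith
  have hqM : 3 * M * (2 * L) ≤ Scale.price * (qmax n - 2) := by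
    have h4 : L ^ (2 + ε) = L ^ (ε - η) * M * L := by
      have h5 : L = L ^ (1 : ℝ) := (Real.rpow_one L).symm
      rw [hM]
      nth_rewrite 4 [h5]
      rw [← Real.rpow_add hL0, ← Real.rpow_add hL0]
      congr 1
      ring
    simp only [Function.comp] at h3
    rw [div_le_iff₀ hK] at h3
    rw [h4] at hq
    have h6 : (6 / Scale.price + 2) * (M * L) ≤ qmax n := by
      refine le_trans ?_ hq
      calc _ ≤ L ^ (ε - η) * K * (M * L) := by gcongr
        _ = _ := by ring
    have h7 : Scale.price * ((6 / Scale.price + 2) * (M * L)) =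
        6 * (M * L) + Scale.price * (2 * (M * L)) := by
      field_simp
    have h8 := mul_le_mul_of_nonneg_left h6 hp.le
    rw [h7] at h8
    have h9 : Scale.price * 2 ≤ Scale.price * (2 * (M * L)) := by
      gcongr
      nlinarith
    linarith
  have hdL : (d : ℝ) ≤ L + 1 := le_trans (by exact_mod_cast hd) (clog_le_logb n hn)
  obtain ⟨G₀, G₁, G₂, g0, g1, g2, g3, g4, g5, g6⟩ :=
    bounded_of_le (by linarith) hdL hℓ hM4 hML h1 hqM
  have hLn : L ≤ n := by
    have h5 := Real.add_one_le_exp (n * Real.log 2)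
    have : Real.logb 2 n ≤ Real.logb 2 (2 ^ (n : ℝ)) := by
      refine Real.logb_le_logb_of_le one_lt_two (by linarith) ?_
      rw [Real.rpow_natCast]
      exact_mod_cast Nat.lt_two_pow_self.le
    rwa [Real.logb_rpow two_pos (by norm_num)] at this
  have hle : (4 + 6 * (L + 1) * 2 ^ d) * Real.exp (-M) ≤ 40 * n ^ 2 * Real.exp (-M) := by
    have h5 : (2 : ℝ) ^ d ≤ 2 * n :=
      (pow_le_pow_right₀ one_le_two hd).trans (two_pow_clog_le n hn)
    gcongr
    calc 4 + 6 * (L + 1) * 2 ^ d ≤ 4 + 6 * (n + n) * (2 * n) := by gcongr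
      _ ≤ 40 * n ^ 2 := by nlinarith
  have hle' := ENNReal.ofReal_le_ofReal hle
  exact ⟨G₀, G₁, G₂, g0, g1, g2, g3, g4, fun X q => (g5 X q).trans (by gcongr), g6.trans hle'⟩

/-- Powers of `n` and `3 ^ R` are exponentials of `O(log n)`, and `(log n) ^ (1 + η)` outgrows them.
-/
theorem superpolynomialDecay_bound {η K' : ℝ} (hη : 0 < η) {R : ℕ → ℕ}
    (hR : ∀ᶠ n : ℕ in atTop, (R n : ℝ) ≤ K' * Real.logb 2 n) :
    Asymptotics.SuperpolynomialDecay atTop (fun n : ℕ => (n : ℝ)) fun n =>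
      2 * (3 ^ (R n + 1) * (40 * n ^ 2 * Real.exp (-Real.logb 2 n ^ (1 + η)))) := by
  intro j
  set c := (j + 2) * Real.log 2 + K' * Real.log 3 with hc
  have hlim : Tendsto (fun n : ℕ => 240 * Real.exp (Real.logb 2 n * (c - Real.logb 2 n ^ η)))
      atTop (𝓝 0) := by
    have h1 : Tendsto (fun x : ℝ => x * (c - x ^ η)) atTop atBot := by
      refine Tendsto.atTop_mul_atBot₀ tendsto_id ?_
      simp only [sub_eq_add_neg]
      exact tendsto_atBot_add_const_left _ _ (tendsto_neg_atTop_atBot.comp (tendsto_rpow_atTop hη))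
    have h2 := (Real.tendsto_exp_atBot.comp (h1.comp tendsto_logb_natCast)).const_mul 240
    simpa using h2
  refine squeeze_zero' (Eventually.of_forall fun n => by positivity) ?_ hlim
  filter_upwards [hR, eventually_ge_atTop 1, tendsto_logb_natCast.eventually_gt_atTop 0] with
    n hR hn hL
  have hn' : (0 : ℝ) < n := by exact_mod_cast hn
  set L := Real.logb 2 n with hLdef
  have h1 : (n : ℝ) = Real.exp (L * Real.log 2) := by
    rw [hLdef, Real.logb, div_mul_cancel₀ _ (Real.log_pos one_lt_two).ne', Real.exp_log hn']
  have h2 : (3 : ℝ) ^ R n ≤ Real.exp (K' * L * Real.log 3) := by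
    rw [← Real.rpow_natCast, Real.rpow_def_of_pos (by norm_num), mul_comm]
    have := Real.log_pos (by norm_num : (1 : ℝ) < 3)
    gcongr
  have h3 : L ^ (1 + η) = L * L ^ η := by
    rw [Real.rpow_add hL, Real.rpow_one]
  calc (n : ℝ) ^ j * (2 * (3 ^ (R n + 1) * (40 * n ^ 2 * Real.exp (-L ^ (1 + η)))))
      = 240 * ((n : ℝ) ^ (j + 2) * 3 ^ R n * Real.exp (-L ^ (1 + η))) := by ring
    _ ≤ 240 * ((n : ℝ) ^ (j + 2) * Real.exp (K' * L * Real.log 3) * Real.exp (-L ^ (1 + η))) := by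
        gcongr
    _ = 240 * Real.exp (L * (c - L ^ η)) := by
        rw [h1, ← Real.exp_nat_mul, ← Real.exp_add, ← Real.exp_add, h3, hc]
        congr 2
        push_cast
        ring

end ORAM
end

theorem mainTheorem2 :
    ∃ C : ℝ, 0 < C ∧
      ∀ (α : ℕ) (ε K K' : ℝ) (ℓ ℓ' qmax R : ℕ → ℕ), 2 ≤ α → 0 < ε → 0 < K →
        (∀ᶠ n : ℕ in Filter.atTop, C * Real.logb 2 (Real.logb 2 n) ≤ ℓ n) →
        (∀ᶠ n : ℕ in Filter.atTop, K * Real.logb 2 n ^ (2 + ε) ≤ qmax n) →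
        (∀ᶠ n : ℕ in Filter.atTop, (R n : ℝ) ≤ K' * Real.logb 2 n) →
        ∃ μ : ℕ → ℝ,
          Asymptotics.SuperpolynomialDecay Filter.atTop (fun n : ℕ => (n : ℝ)) μ ∧
          ∀ (Q : ORAM.Program) (n : ℕ) (x : List Bool) (T : ℕ)
            (pull spill : List (ℕ × List Bool) → ℕ),
            Q.HaltsWithin n x T →
              Q.probAbortQueue ⟨n, α, ℓ n, ℓ' n, qmax n, pull, spill⟩ (R n) x ≤
                ENNReal.ofReal (T * μ n) := by
  -- This makes the base weight `b` at most `(log n) ^ (-10)`.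
  refine ⟨20 / Real.logb 2 (11 / 10),
    div_pos (by norm_num) (Real.logb_pos one_lt_two (by norm_num)), ?_⟩
  intro α ε K K' ℓ ℓ' qmax R hα hε hK hℓ hq hR
  -- `η < ε` leaves room in `qmax`, and `η < 1` ensures `M ≤ (log n) ^ 2`.
  obtain ⟨η, hη, hη1, hηε⟩ : ∃ η : ℝ, 0 < η ∧ η < 1 ∧ η < ε := by
    obtain ⟨η, hη, h⟩ := exists_between (lt_min hε one_pos)
    exact ⟨η, hη, (lt_min_iff.1 h).2, (lt_min_iff.1 h).1⟩
  obtain ⟨n₀, hn₀⟩ := Filter.eventually_atTop.1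
    (ORAM.eventually_bounded (ℓ' := ℓ') hα hη hη1 hηε hK hℓ hq)
  -- The factor `2` covers the initial potential and `3 ^ (R n + 1)` the recursion. Below `n₀` the
  -- per-tree error is replaced by the trivial `1`.
  refine ⟨fun n => 2 * (3 ^ (R n + 1) *
    if n₀ ≤ n then 40 * n ^ 2 * Real.exp (-Real.logb 2 n ^ (1 + η)) else 1), ?_, ?_⟩
  · refine (ORAM.superpolynomialDecay_bound hη hR).congr' ?_
    filter_upwards [Filter.eventually_ge_atTop n₀] with n hn
    rw [if_pos hn]
  · intro Q n x T pull spill hT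
    dsimp only
    set ν : ℝ := if n₀ ≤ n then 40 * n ^ 2 * Real.exp (-Real.logb 2 n ^ (1 + η)) else 1 with hν
    have hb : ∀ N ≤ n, ORAM.Bounded
        ((⟨n, α, ℓ n, ℓ' n, qmax n, pull, spill⟩ : ORAM.Params).depth N) (ℓ n) (qmax n)
        (ENNReal.ofReal ν) := by
      intro N hN
      rw [hν]
      split_ifs with hn
      · exact hn₀ n hn pull spill N hN
      · rw [ENNReal.ofReal_one]
        exact ORAM.bounded_one _ _ _
    have hν0 : 0 ≤ ν := by
      rw [hν]
      split_ifs <;> positivity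
    obtain ⟨O⟩ := ORAM.exists_obl_compiledMem
      (P := ⟨n, α, ℓ n, ℓ' n, qmax n, pull, spill⟩) (by show 0 < α; omega) hb (R n)
    refine (ORAM.probAbortQueue_le O Q x T hT).trans (le_of_eq ?_)
    rw [ENNReal.ofReal_mul (by positivity), ENNReal.ofReal_mul (by norm_num),
      ENNReal.ofReal_mul (by positivity), ENNReal.ofReal_pow (by norm_num)]
    simp
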